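/- **Independence of $V^{\underline\otimes\nu}$ of the splitting.** Fix $\nu\in\mathbb C$. *Deligne's category.* Let $\bar P_{r,s}$ be the set of partitions of $\{1,\dots,r\}\sqcup\{1',\dots,s'\}$ in which no two distinct elements of the upper row $\{1,\dots,r\}$, and no two distinct elements of the lower row $\{1',\dots,s'\}$, lie in one part; such a partition is a partial matching of the two rows. Consider the $\mathbb C$-linear category with objects $\Delta_k$ ($k\ge 0$) in which $\mathrm{Hom}(\Delta_r,\Delta_s)$ has basis $\bar P_{r,s}$, and in which, for $\pi\in\bar P_{r,s}$ and $\rho\in\bar P_{s,t}$, $$\rho\circ\pi=\sum_\tau\ \prod_{i=0}^{m-1}\bigl(\nu-|\tau|-i\bigr)\ \tau .$$ Here $m$ is the number of middle vertices isolated in both $\pi$ and $\rho$, $|\tau|$ is the number of parts of $\tau$, and $\tau$ runs over the partitions in $\bar P_{r,t}$ which contain all edges of the glued diagram $\rho\star\pi$ and whose other edges join an upper vertex isolated in $\pi$ to a lower vertex isolated in $\rho$. $\underline{Rep}(S_\nu)$ is the Karoubi envelope of the additive envelope of this category, and $Ind\text{-}\underline{Rep}(S_\nu)$ is its category of ind-objects.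 For an injective map $\iota:\{1,\dots,l\}\to\{1,\dots,k\}$ let $res_\iota:\Delta_k\to\Delta_l$ be the diagram with edges $(\iota(i),i')$. Let $res_l:\Delta_{k+1}\to\Delta_k$ be $res_\iota$ for the increasing $\iota$ that omits $l$, and let $res_l^*:\Delta_k\to\Delta_{k+1}$ be the reflected diagram. *The tensor power.* Let $V$ be a finite-dimensional complex vector space with a splitting $V=\mathbb C\mathbb 1\oplus U$, $\mathbb 1\ne 0$. Put $$V_U^{\underline\otimes\nu}:=\bigoplus_{k\ge 0}(U^{\otimes k}\otimes\Delta_k)^{S_k}\in Ind\text{-}\underline{Rep}(S_\nu).$$ Identify $\mathfrak{gl}(V)=\mathbb C\,\mathrm{id}_V\oplus U\oplus U^*\oplus\mathfrak{gl}(U)$, where $u\in U$ is the map $\mathbb 1\mapsto u$, $U\mapsto 0$; where $f\in U^*$ is the map $\mathbb 1\mapsto 0$, $v\mapsto f(v)\mathbb 1$ for $v\in U$; and where $\mathfrak{gl}(U)$ kills $\mathbb 1$. Define a linear map $\rho_U:\mathfrak{gl}(V)\to\mathrm{End}(V_U^{\underline\otimes\nu})$ as follows. $\mathrm{id}_V$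 acts by $\nu$. On the $k$-th summand, $u\in U$ acts by $F_u=\frac1{k+1}\sum_{l=1}^{k+1}u^{(l)}\otimes res_l^*$ (where $u^{(l)}$ inserts $u$ as the $l$-th factor); $f\in U^*$ acts by $E_f=\sum_{l=1}^{k}f^{(l)}\otimes res_l$ (where $f^{(l)}$ contracts the $l$-th factor with $f$), and by $0$ if $k=0$; $A\in\mathfrak{gl}(U)$ acts by $\sum_{i=1}^kA^{(i)}\otimes\mathrm{id}$. *Actions of parabolic type.* For a splitting $V=\mathbb C\mathbb 1\oplus U$, an action $\rho:\mathfrak{gl}(V)\to\mathrm{End}(X)$ of the Lie algebra $\mathfrak{gl}(V)$ on $X\in Ind\text{-}\underline{Rep}(S_\nu)$ is an $\mathcal O^{\mathfrak p}_{\nu,V}$-action if the following hold. (i) $X\cong\bigoplus_iY_i\otimes E_i$ compatibly with $\mathfrak{gl}(U)$, where $Y_i\in Ind\text{-}\underline{Rep}(S_\nu)$ and each $E_i$ is a finite-dimensional polynomial $\mathfrak{gl}(U)$-module (a direct summand of a finite direct sum of tensor powers of $U$). (ii) $\{\varphi:\mathrm{Im}\,\varphi\subseteq\mathbb C\mathbb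 1\subseteq\mathrm{Ker}\,\varphi\}\cong U^*$ acts locally finitely: each morphism $Y\to X$ with $Y\in\underline{Rep}(S_\nu)$ lies in a finite-dimensional subspace of $\mathrm{Hom}(Y,X)$ stable under these operators. (iii) $\mathrm{id}_V$ acts by $\nu$. Ind-objects with such an action, and the morphisms that commute with $\mathfrak{gl}(V)$, form the category $Ind\text{-}(\underline{Rep}(S_\nu)\boxtimes\mathcal O^{\mathfrak p}_{\nu,V})$. *Theorem.* 1. Let $\mathbf{Uni}$ be the category of triples $(V,\mathbb 1,U)$ as above, with morphisms $(V,\mathbb 1,U)\to(V',\mathbb 1',U')$ the linear maps $\varphi:V\to V'$ with $\varphi(\mathbb 1)=\mathbb 1'$. There is a functor $(\cdot)^{\underline\otimes\nu}:\mathbf{Uni}\to Ind\text{-}\underline{Rep}(S_\nu)$ which sends $(V,\mathbb 1,U)$ to $V_U^{\underline\otimes\nu}$, and sends $\varphi$ to the morphism whose matrix coefficient $(U^{\otimes k}\otimes\Delta_k)^{S_k}\to(U'^{\otimes l}\otimes\Delta_l)^{S_l}$ comes from $$\sum_{\substack{\iota:\{1,\dots,l\}\to\{1,\dots,k\}\\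 \text{strictly increasing}}}\varphi_{U,U'}^{(\mathrm{Im}\,\iota)}\otimes\varphi_{U,\mathbb 1'}^{(\{1,\dots,k\}\setminus\mathrm{Im}\,\iota)}\otimes res_\iota .$$ Here $\varphi_{U,U'}:U\to U'$ and $\varphi_{U,\mathbb 1'}:U\to\mathbb C$ are the components of $\varphi|_U$, that is, $\varphi(u)=\varphi_{U,U'}(u)+\varphi_{U,\mathbb 1'}(u)\mathbb 1'$; the upper index of each gives the tensor factors to which it is applied. 2. On automorphisms this functor integrates the mirabolic action. If $\varphi\in\mathfrak{gl}(V)$ and $\varphi(\mathbb 1)=0$, then $\exp(\varphi)$ is an endomorphism of $(V,\mathbb 1,U)$ in $\mathbf{Uni}$, and $(\exp\varphi)^{\underline\otimes\nu}=\exp(\rho_U(\varphi))$: for each $Y\in\underline{Rep}(S_\nu)$ the operator $\rho_U(\varphi)$ is locally finite on $\mathrm{Hom}(Y,V_U^{\underline\otimes\nu})$, and its exponential there is $(\exp\varphi)^{\underline\otimes\nu}$. 3. Let $V$ be a finite-dimensional complex vector space and $\mathbb 1\in V\setminus\{0\}$. For each splitting $V=\mathbb C\mathbb 1\oplus U$ the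 map $\rho_U$ is an action of the Lie algebra $\mathfrak{gl}(V)$. Let $V=\mathbb C\mathbb 1\oplus R$ be any reference splitting, used to define $\mathcal O^{\mathfrak p}_{\nu,V}$-actions. Then all pairs $(V_U^{\underline\otimes\nu},\rho_U)$ are objects of $Ind\text{-}(\underline{Rep}(S_\nu)\boxtimes\mathcal O^{\mathfrak p}_{\nu,V})$. For any two splittings $V=\mathbb C\mathbb 1\oplus U=\mathbb C\mathbb 1\oplus W$, the morphism $e_{U,W}:=(\mathrm{id}_V)^{\underline\otimes\nu}:(V_U^{\underline\otimes\nu},\rho_U)\to(V_W^{\underline\otimes\nu},\rho_W)$ is an isomorphism in this category; in particular it commutes with the actions of $\mathfrak{gl}(V)$. Moreover $e_{U,U}=\mathrm{id}$, and $e_{W,W'}\circ e_{U,W}=e_{U,W'}$ for any three splittings. Hence $V^{\underline\otimes\nu}$, as an object of $Ind\text{-}(\underline{Rep}(S_\nu)\boxtimes\mathcal O^{\mathfrak p}_{\nu,V})$, depends up to canonical isomorphism only on $(V,\mathbb 1)$. -/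

import Mathlib

open CategoryTheory

namespace DeligneCat

/-- Partitions of `{1,…,r} ⊔ {1',…,s'}` in which no two distinct unprimed and no two distinct primed
vertices share a part: each is the same thing as a partial matching of the two rows, `π i = some j`
meaning that the vertices `i` and `j'` are joined by an edge. -/
abbrev Diag (r s : ℕ) : Type := Fin r ≃. Fin s

noncomputable instance (r s : ℕ) : Fintype (Diag r s) :=
  haveI : Finite (Diag r s) := DFunLike.finite _
  Fintype.ofFinite _

noncomputable instance (r s : ℕ) : DecidableEq (Diag r s) := Classical.decEq _

/-- The number of parts of a diagram: all upper vertices, and the isolated lower ones. -/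
def numParts {r s : ℕ} (τ : Diag r s) : ℕ :=
  r + (Finset.univ.filter fun j : Fin s => τ.symm j = none).card

/-- The number of vertices of the middle row which are isolated in the gluing of `π` and `ρ`. -/
def numMiddle {r s t : ℕ} (π : Diag r s) (ρ : Diag s t) : ℕ :=
  (Finset.univ.filter fun m : Fin s => π.symm m = none ∧ ρ m = none).card

/-- `τ` is obtained from the gluing of `π` (on top) and `ρ` by joining some of those parts that do
not meet the middle row: `τ` contains `ρ ⋆ π`, and each of its other edges joins an upper vertex
isolated in `π` to a lower vertex isolated in `ρ`. -/
def IsGluing {r s t : ℕ} (π : Diag r s) (ρ : Diag s t) (τ : Diag r t) : Prop :=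
  (∀ i j, (π.trans ρ) i = some j → τ i = some j) ∧
    ∀ i j, τ i = some j → (π.trans ρ) i = some j ∨ (π i = none ∧ ρ.symm j = none)

open scoped Classical in
/-- The coefficient of `τ` in `ρ ∘ π`. -/
noncomputable def coef (x : ℂ) {r s t : ℕ} (π : Diag r s) (ρ : Diag s t) (τ : Diag r t) : ℂ :=
  if IsGluing π ρ τ then ∏ i ∈ Finset.range (numMiddle π ρ), (x - numParts τ - i) else 0

/-! ### Associativity, by interpolation from the symmetric groups -/

section Assoc

/-- The relative position of two injections. -/
noncomputable def relPos {r s n : ℕ} (f : Fin r ↪ Fin n) (g : Fin s ↪ Fin n) : Diag r s where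
  toFun i := if h : ∃ j, f i = g j then some h.choose else none
  invFun j := if h : ∃ i, f i = g j then some h.choose else none
  inv i j := by
    have key1 : (if h : ∃ i, f i = g j then some h.choose else none) = some i ↔ f i = g j := by
      split_ifs with h
      · have := h.choose_spec
        constructor
        · intro e
          rw [Option.some.injEq] at e
          rw [← e]; exact this
        · intro e
          rw [Option.some.injEq]
          exact f.injective (this.trans e.symm)
      · simp only [false_iff]
        exact fun e => h ⟨_, e⟩
    have key2 : (if h : ∃ j, f i = g j then some h.choose else none) = some j ↔ f i = g j := by
      split_ifs with h
      · have := h.choose_spec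
        constructor
        · intro e
          rw [Option.some.injEq] at e
          rw [← e]; exact this
        · intro e
          rw [Option.some.injEq]
          exact g.injective (this.symm.trans e)
      · simp only [false_iff]
        exact fun e => h ⟨_, e⟩
    rw [key1, key2]

theorem relPos_eq_some {r s n : ℕ} {f : Fin r ↪ Fin n} {g : Fin s ↪ Fin n} {i : Fin r}
    {j : Fin s} : relPos f g i = some j ↔ f i = g j := by
  change (if h : ∃ j, f i = g j then some h.choose else none) = some j ↔ f i = g j
  split_ifs with h
  · have := h.choose_spec
    constructor
    · intro e
      rw [Option.some.injEq] at e
      rw [← e]; exact this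
    · intro e
      rw [Option.some.injEq]
      exact g.injective (this.symm.trans e)
  · simp only [false_iff]
    exact fun e => h ⟨_, e⟩

theorem relPos_symm_eq_some {r s n : ℕ} {f : Fin r ↪ Fin n} {g : Fin s ↪ Fin n} {i : Fin r}
    {j : Fin s} : (relPos f g).symm j = some i ↔ f i = g j := by
  rw [PEquiv.eq_some_iff, relPos_eq_some]

theorem relPos_eq_iff {r s n : ℕ} {f : Fin r ↪ Fin n} {g : Fin s ↪ Fin n} {π : Diag r s} :
    relPos f g = π ↔ ∀ i j, f i = g j ↔ π i = some j := by
  constructor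
  · rintro rfl i j
    exact relPos_eq_some.symm
  · intro h
    ext i j
    exact (relPos_eq_some).trans (h i j)

theorem trans_eq_some {r s t : ℕ} {π : Diag r s} {ρ : Diag s t} {i : Fin r} {j : Fin t} :
    (π.trans ρ) i = some j ↔ ∃ m, π i = some m ∧ ρ m = some j := by
  exact PEquiv.trans_eq_some _ _ _ _

theorem isGluing_relPos {r s t n : ℕ} (f : Fin r ↪ Fin n) (g : Fin s ↪ Fin n)
    (h : Fin t ↪ Fin n) : IsGluing (relPos f g) (relPos g h) (relPos f h) := by
  constructor
  · intro i j hij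
    obtain ⟨m, h1, h2⟩ := trans_eq_some.1 hij
    rw [relPos_eq_some] at *
    exact h1.trans h2
  · intro i j hij
    rw [relPos_eq_some] at hij
    by_cases hm : ∃ m, f i = g m
    · obtain ⟨m, hm⟩ := hm
      left
      rw [trans_eq_some]
      exact ⟨m, relPos_eq_some.2 hm, relPos_eq_some.2 (hm.symm.trans hij)⟩
    · right
      constructor
      · rw [Option.eq_none_iff_forall_ne_some]
        intro m h1
        exact hm ⟨m, relPos_eq_some.1 h1⟩
      · rw [Option.eq_none_iff_forall_ne_some]
        intro m h1
        exact hm ⟨m, hij.trans (relPos_symm_eq_some.1 h1).symm⟩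

/-- The values not taken by `f` and `h`. -/
abbrev Free {r t n : ℕ} (f : Fin r ↪ Fin n) (h : Fin t ↪ Fin n) : Type :=
  {x : Fin n // (∀ i, f i ≠ x) ∧ ∀ j, h j ≠ x}

theorem card_free {r t n : ℕ} (f : Fin r ↪ Fin n) (h : Fin t ↪ Fin n) :
    Fintype.card (Free f h) + numParts (relPos f h) = n := by
  classical
  have e1 : Fintype.card (Free f h) =
      (Finset.univ.filter fun x => (∀ i, f i ≠ x) ∧ ∀ j, h j ≠ x).card :=
    Fintype.card_subtype _
  have e2 : (Finset.univ.map f).card = r := by simp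
  have e3 : (Finset.univ.filter fun j : Fin t => (relPos f h).symm j = none).card =
      ((Finset.univ.filter fun j : Fin t => (relPos f h).symm j = none).map h).card := by simp
  have e4 : numParts (relPos f h) = (Finset.univ.map f).card +
      ((Finset.univ.filter fun j : Fin t => (relPos f h).symm j = none).map h).card := by
    rw [e2, ← e3, numParts]
  rw [e4, e1, ← Finset.card_union_of_disjoint, ← Finset.card_union_of_disjoint]
  · conv_rhs => rw [← Fintype.card_fin n, ← Finset.card_univ]
    congr 1
    ext x
    simp only [Finset.mem_union, Finset.mem_filter, Finset.mem_univ, true_and, Finset.mem_map,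
      iff_true]
    by_cases h1 : ∃ i, f i = x
    · exact Or.inr (Or.inl h1)
    · by_cases h2 : ∃ j, h j = x
      · obtain ⟨j, rfl⟩ := h2
        refine Or.inr (Or.inr ⟨j, ?_, rfl⟩)
        rw [Option.eq_none_iff_forall_ne_some]
        intro m hm
        exact h1 ⟨m, relPos_symm_eq_some.1 hm⟩
      · push Not at h1 h2
        exact Or.inl ⟨h1, h2⟩
  · rw [Finset.disjoint_left]
    intro x hx hx2
    simp only [Finset.mem_union, Finset.mem_filter, Finset.mem_univ, true_and,
      Finset.mem_map] at hx hx2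
    rcases hx2 with ⟨i, hi⟩ | ⟨j, -, hj⟩
    · exact hx.1 i hi
    · exact hx.2 j hj
  · rw [Finset.disjoint_left]
    intro x hx hx2
    simp only [Finset.mem_filter, Finset.mem_univ, true_and, Finset.mem_map] at hx hx2
    obtain ⟨i, rfl⟩ := hx
    obtain ⟨j, hj, hij⟩ := hx2
    rw [(relPos_symm_eq_some (f := f) (g := h)).2 hij.symm] at hj
    simp at hj

section Count

variable {r s t n : ℕ} (f : Fin r ↪ Fin n) (h : Fin t ↪ Fin n) (π : Diag r s) (ρ : Diag s t)

/-- The isolated vertices of the middle row. -/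
abbrev Mid : Type := {m : Fin s // π.symm m = none ∧ ρ m = none}

/-- The middle injection with prescribed values on the isolated vertices. -/
def extFun (e : Mid π ρ → Fin n) (m : Fin s) : Fin n :=
  match h1 : π.symm m, h2 : ρ m with
  | some i, _ => f i
  | none, some j => h j
  | none, none => e ⟨m, h1, h2⟩

variable {f h π ρ}

theorem extFun_left (e : Mid π ρ → Fin n) {m : Fin s} {i : Fin r} (h1 : π.symm m = some i) :
    extFun f h π ρ e m = f i := by
  unfold extFun
  split <;> simp_all

theorem extFun_right (e : Mid π ρ → Fin n) {m : Fin s} {j : Fin t} (h1 : π.symm m = none)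
    (h2 : ρ m = some j) : extFun f h π ρ e m = h j := by
  unfold extFun
  split <;> simp_all

theorem extFun_mid (e : Mid π ρ → Fin n) {m : Fin s} (h1 : π.symm m = none)
    (h2 : ρ m = none) : extFun f h π ρ e m = e ⟨m, h1, h2⟩ := by
  unfold extFun
  split <;> simp_all

theorem extFun_right_of (hc : IsGluing π ρ (relPos f h)) (e : Mid π ρ → Fin n) {m : Fin s}
    {j : Fin t} (h2 : ρ m = some j) : extFun f h π ρ e m = h j := by
  rcases h1 : π.symm m with _ | i
  · exact extFun_right e h1 h2
  · rw [extFun_left e h1]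
    exact relPos_eq_some.1 (hc.1 i j (trans_eq_some.2 ⟨m, (PEquiv.eq_some_iff _).1 h1, h2⟩))

theorem extFun_left_iff (hc : IsGluing π ρ (relPos f h)) (e : Mid π ρ → Free f h) (i : Fin r)
    (m : Fin s) : f i = extFun f h π ρ (fun x => (e x).1) m ↔ π i = some m := by
  constructor
  · intro hi
    rcases h1 : π.symm m with _ | i'
    · rcases h2 : ρ m with _ | j
      · rw [extFun_mid _ h1 h2] at hi
        exact absurd hi ((e ⟨m, h1, h2⟩).2.1 i)
      · rw [extFun_right _ h1 h2] at hi
        rcases hc.2 i j (relPos_eq_some.2 hi) with h3 | ⟨-, h3⟩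
        · obtain ⟨m', h4, h5⟩ := trans_eq_some.1 h3
          rw [← PEquiv.eq_some_iff] at h2 h5
          rw [h2, Option.some.injEq] at h5
          rw [h5]; exact h4
        · rw [← PEquiv.eq_some_iff] at h2
          rw [h2] at h3
          simp at h3
    · rw [extFun_left _ h1] at hi
      rw [f.injective hi]
      exact (PEquiv.eq_some_iff _).1 h1
  · intro hi
    rw [extFun_left _ ((PEquiv.eq_some_iff _).2 hi)]

theorem extFun_right_iff (hc : IsGluing π ρ (relPos f h)) (e : Mid π ρ → Free f h) (m : Fin s)
    (j : Fin t) : extFun f h π ρ (fun x => (e x).1) m = h j ↔ ρ m = some j := by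
  constructor
  · intro hj
    rcases h2 : ρ m with _ | j'
    · rcases h1 : π.symm m with _ | i
      · rw [extFun_mid _ h1 h2] at hj
        exact absurd hj.symm ((e ⟨m, h1, h2⟩).2.2 j)
      · rw [extFun_left _ h1] at hj
        rw [PEquiv.eq_some_iff] at h1
        rcases hc.2 i j (relPos_eq_some.2 hj) with h3 | ⟨h3, -⟩
        · obtain ⟨m', h4, h5⟩ := trans_eq_some.1 h3
          rw [h1, Option.some.injEq] at h4
          rw [h4, h5] at h2
          simp at h2
        · rw [h1] at h3
          simp at h3
    · rw [extFun_right_of hc _ h2] at hj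
      rw [h.injective hj]
  · intro hj
    exact extFun_right_of hc _ hj

theorem extFun_injective (hc : IsGluing π ρ (relPos f h)) (e : Mid π ρ ↪ Free f h) :
    Function.Injective (extFun f h π ρ (fun x => (e x).1)) := by
  intro m m' hm
  rcases h1 : π.symm m with _ | i
  · rcases h2 : ρ m with _ | j
    · rcases h1' : π.symm m' with _ | i'
      · rcases h2' : ρ m' with _ | j'
        · rw [extFun_mid _ h1 h2, extFun_mid _ h1' h2'] at hm
          have := e.injective (Subtype.ext hm)
          exact congrArg Subtype.val this
        · have := (extFun_right_iff hc e m' j').2 h2'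
          rw [← hm, extFun_right_iff hc e, h2] at this
          simp at this
      · have := (extFun_left_iff hc e i' m').2 ((PEquiv.eq_some_iff _).1 h1')
        rw [← hm, extFun_left_iff hc e, ← PEquiv.eq_some_iff, h1] at this
        simp at this
    · have := (extFun_right_iff hc e m j).2 h2
      rw [hm, extFun_right_iff hc e, ← PEquiv.eq_some_iff] at this
      rw [← PEquiv.eq_some_iff, this, Option.some.injEq] at h2
      exact h2.symm
  · have := (extFun_left_iff hc e i m).2 ((PEquiv.eq_some_iff _).1 h1)
    rw [hm, extFun_left_iff hc e] at this
    rw [PEquiv.eq_some_iff, this, Option.some.injEq] at h1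
    exact h1.symm

/-- Middle injections in given relative position to the outer ones are given by their values on
the isolated vertices. -/
noncomputable def extEquiv (hc : IsGluing π ρ (relPos f h)) :
    {g : Fin s ↪ Fin n // relPos f g = π ∧ relPos g h = ρ} ≃ (Mid π ρ ↪ Free f h) where
  toFun g :=
    { toFun := fun m => ⟨g.1 m.1, by
        refine ⟨fun i hi => ?_, fun j hj => ?_⟩
        · have := (relPos_symm_eq_some (f := f) (g := g.1)).2 hi
          rw [g.2.1, m.2.1] at this
          simp at this
        · have := (relPos_eq_some (f := g.1) (g := h)).2 hj.symm
          rw [g.2.2, m.2.2] at this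
          simp at this⟩
      inj' := fun m m' hm => Subtype.ext (g.1.injective (congrArg Subtype.val hm)) }
  invFun e := ⟨⟨extFun f h π ρ (fun x => (e x).1), extFun_injective hc e⟩,
    relPos_eq_iff.2 fun i m => extFun_left_iff hc e i m,
    relPos_eq_iff.2 fun m j => extFun_right_iff hc e m j⟩
  left_inv g := by
    apply Subtype.ext
    ext1 m
    change extFun f h π ρ (fun x => g.1 x.1) m = g.1 m
    rcases h1 : π.symm m with _ | i
    · rcases h2 : ρ m with _ | j
      · rw [extFun_mid _ h1 h2]
      · rw [extFun_right _ h1 h2]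
        rw [← g.2.2] at h2
        exact (relPos_eq_some.1 h2).symm
    · rw [extFun_left _ h1]
      rw [← g.2.1] at h1
      exact relPos_symm_eq_some.1 h1
  right_inv e := by
    ext1 m
    apply Subtype.ext
    change extFun f h π ρ (fun x => (e x).1) m.1 = (e m).1
    rw [extFun_mid _ m.2.1 m.2.2]

end Count

theorem card_between {r s t n : ℕ} (f : Fin r ↪ Fin n) (h : Fin t ↪ Fin n) (π : Diag r s)
    (ρ : Diag s t) :
    ((Finset.univ.filter fun g : Fin s ↪ Fin n => relPos f g = π ∧ relPos g h = ρ).card : ℂ) =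
      coef (n : ℂ) π ρ (relPos f h) := by
  classical
  rw [coef]
  split_ifs with hc
  · have h1 : (Finset.univ.filter fun g : Fin s ↪ Fin n =>
        relPos f g = π ∧ relPos g h = ρ).card =
        (n - numParts (relPos f h)).descFactorial (numMiddle π ρ) := by
      have := Fintype.card_congr (extEquiv hc)
      rw [Fintype.card_embedding_eq] at this
      have hn : n - numParts (relPos f h) = Fintype.card (Free f h) := by
        have := card_free f h
        omega
      rw [hn, ← Fintype.card_subtype]
      rw [numMiddle, ← Fintype.card_subtype]
      convert this
    have h2 : ((n : ℂ) - numParts (relPos f h)) = ((n - numParts (relPos f h) : ℕ) : ℂ) := by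
      rw [Nat.cast_sub]
      have := card_free f h
      omega
    rw [h1, h2, ← descPochhammer_eval_eq_descFactorial, descPochhammer_eval_eq_prod_range]
  · rw [Nat.cast_eq_zero, Finset.card_eq_zero, Finset.filter_eq_empty_iff]
    rintro g - ⟨rfl, rfl⟩
    exact hc (isGluing_relPos f g h)

/-- The coefficient as a polynomial in the parameter. -/
theorem exists_coefPoly {r s t : ℕ} (π : Diag r s) (ρ : Diag s t) (τ : Diag r t) :
    ∃ p : Polynomial ℂ, ∀ x, p.eval x = coef x π ρ τ := by
  classical
  by_cases h : IsGluing π ρ τ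
  · refine ⟨∏ i ∈ Finset.range (numMiddle π ρ),
      (Polynomial.X - Polynomial.C (numParts τ : ℂ) - Polynomial.C (i : ℂ)), fun x => ?_⟩
    simp [coef, h, Polynomial.eval_prod]
  · exact ⟨0, fun x => by simp [coef, h]⟩

theorem exists_relPos {r t n : ℕ} (hn : r + t ≤ n) (ω : Diag r t) :
    ∃ (f : Fin r ↪ Fin n) (h : Fin t ↪ Fin n), relPos f h = ω := by
  let F : Fin r → Fin n := fun i => ⟨i, by omega⟩
  let H : Fin t → Fin n := fun j =>
    match ω.symm j with
    | some i => F i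
    | none => ⟨r + j, by omega⟩
  have hF : Function.Injective F := fun i i' hi => by
    simpa [F, Fin.ext_iff] using hi
  have hS : ∀ {j i}, ω.symm j = some i → H j = F i := fun {j i} e => by simp only [H, e]
  have hN : ∀ {j}, ω.symm j = none → H j = ⟨r + j, by omega⟩ := fun {j} e => by simp only [H, e]
  have hFH : ∀ i j, F i = H j ↔ ω i = some j := by
    intro i j
    rw [← PEquiv.eq_some_iff]
    rcases e : ω.symm j with _ | i'
    · rw [hN e]
      simp only [F, Fin.mk.injEq, reduceCtorEq, iff_false]
      omega
    · rw [hS e, hF.eq_iff, Option.some.injEq, eq_comm]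
  have hH : Function.Injective H := by
    intro j j' hj
    rcases e : ω.symm j with _ | i
    · rcases e' : ω.symm j' with _ | i'
      · rw [hN e, hN e'] at hj
        simpa [Fin.ext_iff] using hj
      · rw [hN e, hS e'] at hj
        simp only [F, Fin.mk.injEq] at hj
        omega
    · have h1 := (hFH i j).1 (hS e).symm
      have h2 := (hFH i j').1 ((hS e).symm.trans hj)
      rw [h1, Option.some.injEq] at h2
      exact h2
  exact ⟨⟨F, hF⟩, ⟨H, hH⟩, relPos_eq_iff.2 hFH⟩

theorem coef_assoc_nat {r s t u n : ℕ} (hn : r + u ≤ n) (π : Diag r s) (ρ : Diag s t)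
    (σ : Diag t u) (ω : Diag r u) :
    ∑ τ : Diag r t, coef (n : ℂ) π ρ τ * coef (n : ℂ) τ σ ω =
      ∑ τ : Diag s u, coef (n : ℂ) ρ σ τ * coef (n : ℂ) π τ ω := by
  classical
  obtain ⟨f, k, rfl⟩ := exists_relPos hn ω
  have L : ∀ τ : Diag r t, coef (n : ℂ) π ρ τ * coef (n : ℂ) τ σ (relPos f k) =
      ∑ h : Fin t ↪ Fin n, if relPos f h = τ ∧ relPos h k = σ then
        ∑ g : Fin s ↪ Fin n, (if relPos f g = π ∧ relPos g h = ρ then (1 : ℂ) else 0) else 0 := by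
    intro τ
    rw [← card_between f k τ σ, Finset.natCast_card_filter, Finset.mul_sum]
    refine Finset.sum_congr rfl fun h _ => ?_
    split_ifs with hh
    · rw [mul_one, ← hh.1, ← card_between f h π ρ, Finset.natCast_card_filter]
    · rw [mul_zero]
  have R : ∀ τ : Diag s u, coef (n : ℂ) ρ σ τ * coef (n : ℂ) π τ (relPos f k) =
      ∑ g : Fin s ↪ Fin n, if relPos f g = π ∧ relPos g k = τ then
        ∑ h : Fin t ↪ Fin n, (if relPos g h = ρ ∧ relPos h k = σ then (1 : ℂ) else 0) else 0 := by
    intro τ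
    rw [← card_between f k π τ, Finset.natCast_card_filter, Finset.mul_sum]
    refine Finset.sum_congr rfl fun g _ => ?_
    split_ifs with hh
    · rw [mul_one, ← hh.2, ← card_between g k ρ σ, Finset.natCast_card_filter]
    · rw [mul_zero]
  rw [Finset.sum_congr rfl fun τ _ => L τ, Finset.sum_congr rfl fun τ _ => R τ,
    Finset.sum_comm]
  have L2 : ∀ h : Fin t ↪ Fin n, (∑ τ : Diag r t, if relPos f h = τ ∧ relPos h k = σ then
        ∑ g : Fin s ↪ Fin n, (if relPos f g = π ∧ relPos g h = ρ then (1 : ℂ) else 0) else 0) =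
      ∑ g : Fin s ↪ Fin n,
        if relPos f g = π ∧ relPos g h = ρ ∧ relPos h k = σ then (1 : ℂ) else 0 := by
    intro h
    rw [Finset.sum_eq_single (relPos f h) (fun b _ hb => if_neg fun hh => hb hh.1.symm) (by simp)]
    by_cases hs : relPos h k = σ
    · simp [hs]
    · simp [hs]
  have R2 : ∀ g : Fin s ↪ Fin n, (∑ τ : Diag s u, if relPos f g = π ∧ relPos g k = τ then
        ∑ h : Fin t ↪ Fin n, (if relPos g h = ρ ∧ relPos h k = σ then (1 : ℂ) else 0) else 0) =
      ∑ h : Fin t ↪ Fin n,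
        if relPos f g = π ∧ relPos g h = ρ ∧ relPos h k = σ then (1 : ℂ) else 0 := by
    intro g
    rw [Finset.sum_eq_single (relPos g k) (fun b _ hb => if_neg fun hh => hb hh.2.symm) (by simp)]
    by_cases hs : relPos f g = π
    · simp [hs]
    · simp [hs]
  rw [Finset.sum_congr rfl fun h _ => L2 h, Finset.sum_comm]
  conv_rhs => rw [Finset.sum_comm, Finset.sum_congr rfl fun g _ => R2 g] 

end Assoc

theorem coef_assoc (x : ℂ) {r s t u : ℕ} (π : Diag r s) (ρ : Diag s t) (σ : Diag t u)
    (ω : Diag r u) :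
    ∑ τ : Diag r t, coef x π ρ τ * coef x τ σ ω =
      ∑ τ : Diag s u, coef x ρ σ τ * coef x π τ ω := by
  choose p1 h1 using fun τ : Diag r t => exists_coefPoly π ρ τ
  choose p2 h2 using fun τ : Diag r t => exists_coefPoly τ σ ω
  choose p3 h3 using fun τ : Diag s u => exists_coefPoly ρ σ τ
  choose p4 h4 using fun τ : Diag s u => exists_coefPoly π τ ω
  have key : (∑ τ, p1 τ * p2 τ) = ∑ τ, p3 τ * p4 τ := by
    apply Polynomial.eq_of_infinite_eval_eq
    refine Set.Infinite.mono (s := (fun n : ℕ => (n : ℂ)) '' Set.Ici (r + u)) ?_ ?_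
    · rintro _ ⟨n, hn, rfl⟩
      simp only [Set.mem_ofPred_eq, Polynomial.eval_finsetSum, Polynomial.eval_mul, h1, h2, h3, h4]
      exact coef_assoc_nat hn π ρ σ ω
    · exact (Set.Ici_infinite _).image (Nat.cast_injective.injOn)
  have := congrArg (Polynomial.eval x) key
  simpa only [Polynomial.eval_finsetSum, Polynomial.eval_mul, h1, h2, h3, h4] using this

/-- Composition with a diagram in which all upper vertices are joined and which leaves no isolated
middle vertex. -/
theorem coef_of_total_left (x : ℂ) {r s t : ℕ} (π : Diag r s) (ρ : Diag s t) (τ : Diag r t)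
    (h1 : ∀ i, π i ≠ none) (h2 : ∀ m, π.symm m ≠ none) :
    coef x π ρ τ = if τ = π.trans ρ then 1 else 0 := by
  have h3 : numMiddle π ρ = 0 := by simp [numMiddle, h2]
  have h4 : IsGluing π ρ τ ↔ τ = π.trans ρ := by
    constructor
    · rintro ⟨ha, hb⟩
      ext i j
      exact ⟨fun hij => (hb i j hij).resolve_right fun hh => h1 i hh.1, fun hij => ha i j hij⟩
    · rintro rfl
      exact ⟨fun _ _ h => h, fun _ _ h => Or.inl h⟩
  simp only [coef, h3, h4, Finset.range_zero, Finset.prod_empty]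

theorem coef_of_total_right (x : ℂ) {r s t : ℕ} (π : Diag r s) (ρ : Diag s t) (τ : Diag r t)
    (h1 : ∀ i, ρ i ≠ none) (h2 : ∀ m, ρ.symm m ≠ none) :
    coef x π ρ τ = if τ = π.trans ρ then 1 else 0 := by
  have h3 : numMiddle π ρ = 0 := by simp [numMiddle, h1]
  have h4 : IsGluing π ρ τ ↔ τ = π.trans ρ := by
    constructor
    · rintro ⟨ha, hb⟩
      ext i j
      exact ⟨fun hij => (hb i j hij).resolve_right fun hh => h2 j hh.2, fun hij => ha i j hij⟩
    · rintro rfl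
      exact ⟨fun _ _ h => h, fun _ _ h => Or.inl h⟩
  simp only [coef, h3, h4, Finset.range_zero, Finset.prod_empty]

/-! ### The category of the objects `Δ_k` -/

/-- The objects `Δ_k`, for `k ≥ 0`. -/
structure DeltaCat (ν : ℂ) : Type where
  k : ℕ

/-- Morphisms `Δ_r ⟶ Δ_s` : linear combinations of diagrams, given by their coefficients. -/
def DeltaHom (r s : ℕ) : Type := Diag r s → ℂ

instance (r s : ℕ) : AddCommGroup (DeltaHom r s) :=
  inferInstanceAs (AddCommGroup (Diag r s → ℂ))

noncomputable instance (r s : ℕ) : Module ℂ (DeltaHom r s) :=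
  inferInstanceAs (Module ℂ (Diag r s → ℂ))

/-- A diagram as a morphism. -/
noncomputable def DeltaHom.of {r s : ℕ} (π : Diag r s) : DeltaHom r s := fun τ => if τ = π then 1 else 0

/-- The bilinear composition, `π` first and then `ρ` being sent to `∑ τ, coef ν π ρ τ • τ`. -/
noncomputable def DeltaHom.comp (ν : ℂ) {r s t : ℕ} (a : DeltaHom r s) (b : DeltaHom s t) :
    DeltaHom r t :=
  fun τ => ∑ π : Diag r s, ∑ ρ : Diag s t, a π * b ρ * coef ν π ρ τ

noncomputable instance (ν : ℂ) : Category (DeltaCat ν) where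
  Hom X Y := DeltaHom X.k Y.k
  id X := DeltaHom.of (PEquiv.refl (Fin X.k))
  comp a b := DeltaHom.comp ν a b
  id_comp {X Y} b := by
    funext τ
    simp only [DeltaHom.comp, DeltaHom.of]
    rw [Finset.sum_eq_single (PEquiv.refl _) (fun π _ hπ => by simp [hπ]) (by simp)]
    rw [Finset.sum_eq_single τ]
    · simp [coef_of_total_left ν (PEquiv.refl (Fin X.k)) τ τ (by simp) (by simp)]
    · intro ρ _ hρ
      simp [coef_of_total_left ν (PEquiv.refl (Fin X.k)) ρ τ (by simp) (by simp), hρ.symm]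
    · simp
  comp_id {X Y} a := by
    funext τ
    simp only [DeltaHom.comp, DeltaHom.of]
    rw [Finset.sum_comm,
      Finset.sum_eq_single (PEquiv.refl _) (fun π _ hπ => by simp [hπ]) (by simp)]
    rw [Finset.sum_eq_single τ]
    · simp [coef_of_total_right ν τ (PEquiv.refl (Fin Y.k)) τ (by simp) (by simp)]
    · intro ρ _ hρ
      simp [coef_of_total_right ν ρ (PEquiv.refl (Fin Y.k)) τ (by simp) (by simp), hρ.symm]
    · simp
  assoc {X Y Z W} a b c := by
    funext ω
    simp only [DeltaHom.comp, Finset.sum_mul, Finset.mul_sum]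
    have L : ∀ (τ : Diag X.k Z.k) (σ : Diag Z.k W.k) (π : Diag X.k Y.k) (ρ : Diag Y.k Z.k),
        a π * b ρ * coef ν π ρ τ * c σ * coef ν τ σ ω =
          a π * b ρ * c σ * (coef ν π ρ τ * coef ν τ σ ω) := fun _ _ _ _ => by ring
    have R : ∀ (π : Diag X.k Y.k) (τ : Diag Y.k W.k) (ρ : Diag Y.k Z.k) (σ : Diag Z.k W.k),
        a π * (b ρ * c σ * coef ν ρ σ τ) * coef ν π τ ω =
          a π * b ρ * c σ * (coef ν ρ σ τ * coef ν π τ ω) := fun _ _ _ _ => by ring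
    simp only [L, R]
    calc _ = ∑ π : Diag X.k Y.k, ∑ ρ : Diag Y.k Z.k, ∑ σ : Diag Z.k W.k,
          a π * b ρ * c σ * ∑ τ : Diag X.k Z.k, coef ν π ρ τ * coef ν τ σ ω := by
          simp only [Finset.mul_sum]
          rw [Finset.sum_comm]
          rw [Finset.sum_congr rfl fun σ _ => Finset.sum_comm, Finset.sum_comm]
          refine Finset.sum_congr rfl fun π _ => ?_
          rw [Finset.sum_congr rfl fun σ _ => Finset.sum_comm, Finset.sum_comm]
      _ = ∑ π : Diag X.k Y.k, ∑ ρ : Diag Y.k Z.k, ∑ σ : Diag Z.k W.k,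
          a π * b ρ * c σ * ∑ τ : Diag Y.k W.k, coef ν ρ σ τ * coef ν π τ ω := by
          refine Finset.sum_congr rfl fun π _ => Finset.sum_congr rfl fun ρ _ =>
            Finset.sum_congr rfl fun σ _ => ?_
          rw [coef_assoc]
      _ = _ := by
          simp only [Finset.mul_sum]
          refine Finset.sum_congr rfl fun π _ => ?_
          rw [Finset.sum_congr rfl fun ρ _ => Finset.sum_comm, Finset.sum_comm]

noncomputable instance (ν : ℂ) : Preadditive (DeltaCat ν) where
  homGroup X Y := inferInstanceAs (AddCommGroup (DeltaHom X.k Y.k))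
  add_comp X Y Z f f' g := by
    funext τ
    change ∑ π, ∑ ρ, (f π + f' π) * g ρ * coef ν π ρ τ = (∑ π, ∑ ρ, f π * g ρ * coef ν π ρ τ) +
      ∑ π, ∑ ρ, f' π * g ρ * coef ν π ρ τ
    simp only [add_mul, Finset.sum_add_distrib]
  comp_add X Y Z f g g' := by
    funext τ
    change ∑ π, ∑ ρ, f π * (g ρ + g' ρ) * coef ν π ρ τ = (∑ π, ∑ ρ, f π * g ρ * coef ν π ρ τ) +
      ∑ π, ∑ ρ, f π * g' ρ * coef ν π ρ τ
    simp only [add_mul, mul_add, Finset.sum_add_distrib]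

noncomputable instance (ν : ℂ) : Linear ℂ (DeltaCat ν) where
  homModule X Y := inferInstanceAs (Module ℂ (DeltaHom X.k Y.k))
  smul_comp X Y Z c f g := by
    funext τ
    change ∑ π, ∑ ρ, (c * f π) * g ρ * coef ν π ρ τ = c * ∑ π, ∑ ρ, f π * g ρ * coef ν π ρ τ
    simp only [Finset.mul_sum, mul_assoc]
  comp_smul X Y Z f c g := by
    funext τ
    change ∑ π, ∑ ρ, f π * (c * g ρ) * coef ν π ρ τ = c * ∑ π, ∑ ρ, f π * g ρ * coef ν π ρ τ
    simp only [Finset.mul_sum, mul_assoc, mul_left_comm]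

/-- The object `Δ_k`. -/
def Delta (ν : ℂ) (k : ℕ) : DeltaCat ν := ⟨k⟩

/-- A diagram as a morphism `Δ_r ⟶ Δ_s`. -/
noncomputable def diagHom (ν : ℂ) {r s : ℕ} (π : Diag r s) : Delta ν r ⟶ Delta ν s := DeltaHom.of π

theorem diagHom_comp_of_total_left (ν : ℂ) {r s t : ℕ} (π : Diag r s) (ρ : Diag s t)
    (h1 : ∀ i, π i ≠ none) (h2 : ∀ m, π.symm m ≠ none) :
    diagHom ν π ≫ diagHom ν ρ = diagHom ν (π.trans ρ) := by
  funext (τ : Diag r t)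
  change ∑ π', ∑ ρ', (if π' = π then (1 : ℂ) else 0) * (if ρ' = ρ then (1 : ℂ) else 0) *
    coef ν π' ρ' τ = if τ = (π.trans ρ : Diag r t) then 1 else 0
  rw [Finset.sum_eq_single π (fun π _ hπ => by simp [hπ]) (by simp),
    Finset.sum_eq_single ρ (fun π _ hπ => by simp [hπ]) (by simp),
    coef_of_total_left ν π ρ τ h1 h2]
  simp

/-- The permutation `σ` as an endomorphism of `Δ_k`: the diagram with the edges `(i, σ(i)')`. -/
noncomputable def permHom (ν : ℂ) {k : ℕ} (σ : Equiv.Perm (Fin k)) : Delta ν k ⟶ Delta ν k :=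
  diagHom ν σ.toPEquiv

theorem permHom_comp (ν : ℂ) {k : ℕ} (σ τ : Equiv.Perm (Fin k)) :
    permHom ν σ ≫ permHom ν τ = permHom ν (τ * σ) := by
  rw [permHom, permHom, diagHom_comp_of_total_left]
  · rw [permHom, Equiv.Perm.mul_def, Equiv.toPEquiv_trans]
  · intro i
    simp [Equiv.toPEquiv_apply]
  · intro i
    rw [← Equiv.toPEquiv_symm]
    simp [Equiv.toPEquiv_apply]

/-- The partial matching with the edges `(ι(i), i')`. -/
noncomputable def resDiag {l k : ℕ} (ι : Fin l ↪ Fin k) : Diag k l :=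
  PEquiv.symm
    { toFun := fun i => some (ι i)
      invFun := fun m => if h : ∃ i, ι i = m then some h.choose else none
      inv := fun i m => by
        rw [Option.some.injEq]
        split_ifs with h
        · rw [Option.some.injEq]
          have := h.choose_spec
          exact ⟨fun e => e ▸ this, fun e => ι.injective (this.trans e.symm)⟩
        · simp only [false_iff]
          exact fun e => h ⟨i, e⟩ }

/-- `res_ι : Δ_k ⟶ Δ_l`. -/
noncomputable def resHom (ν : ℂ) {l k : ℕ} (ι : Fin l ↪ Fin k) : Delta ν k ⟶ Delta ν l :=
  diagHom ν (resDiag ι)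

/-- `res_l : Δ_{k+1} ⟶ Δ_k`, forgetting the vertex `l` of the upper row. -/
noncomputable def res (ν : ℂ) {k : ℕ} (l : Fin (k + 1)) : Delta ν (k + 1) ⟶ Delta ν k :=
  diagHom ν (resDiag l.succAboveEmb)

/-- `res_l^* : Δ_k ⟶ Δ_{k+1}`, inserting an isolated vertex at `l` in the lower row. -/
noncomputable def resStar (ν : ℂ) {k : ℕ} (l : Fin (k + 1)) : Delta ν k ⟶ Delta ν (k + 1) :=
  diagHom ν (resDiag l.succAboveEmb).symm

/-! ### The Karoubi envelope -/

section LinearInstances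

variable {C : Type*} [Category C] [Preadditive C] [Linear ℂ C]

instance matModule (M N : Mat_ C) : Module ℂ (M ⟶ N) :=
  inferInstanceAs (Module ℂ (∀ (i : M.ι) (j : N.ι), M.X i ⟶ N.X j))

@[simp]
theorem mat_smul_apply {M N : Mat_ C} (c : ℂ) (f : M ⟶ N) (i : M.ι) (j : N.ι) :
    (c • f) i j = c • f i j := rfl

instance matLinear : Linear ℂ (Mat_ C) where
  homModule M N := matModule M N
  smul_comp M N K c f g := by
    ext i j
    simp [Finset.smul_sum]
  comp_smul M N K f c g := by
    ext i j
    simp [Finset.smul_sum]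

open Idempotents

instance karoubiSMul (P Q : Karoubi C) : SMul ℂ (P ⟶ Q) where
  smul c f := ⟨c • f.f, by rw [Linear.smul_comp, Linear.comp_smul, f.comm]⟩

@[simp]
theorem karoubi_smul_f {P Q : Karoubi C} (c : ℂ) (f : P ⟶ Q) : (c • f).f = c • f.f := rfl

instance karoubiModule (P Q : Karoubi C) : Module ℂ (P ⟶ Q) where
  one_smul f := by ext; simp
  mul_smul a b f := by ext; simp [mul_smul]
  smul_zero a := by ext; simp
  smul_add a f g := by ext; simp
  add_smul a b f := by ext; simp [add_smul]
  zero_smul f := by ext; simp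

instance karoubiLinear : Linear ℂ (Karoubi C) where
  homModule P Q := karoubiModule P Q
  smul_comp P Q R c f g := by ext; simp
  comp_smul P Q R f c g := by ext; simp

end LinearInstances

/-- Deligne's category: the Karoubi envelope of the additive envelope of the category of the
objects `Δ_k`. -/
abbrev RepS (ν : ℂ) : Type 1 := Idempotents.Karoubi (Mat_ (DeltaCat ν))

/-! ### Ind-objects of a `ℂ`-linear category -/

section IndObjects

set_option linter.unusedSectionVars false

open Limits Opposite

universe u

variable (C : Type u) [Category.{0} C] [Preadditive C] [Linear ℂ C]

/-- A `ℂ`-linear presheaf whose underlying presheaf of sets is an ind-object, that is, a filtered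
colimit of representable presheaves. -/
def IsLinearInd : ObjectProperty (Cᵒᵖ ⥤ ModuleCat.{0} ℂ) := fun F =>
  (∀ {Y Z : C} (c : ℂ) (f g : Y ⟶ Z), F.map (c • f + g).op = c • F.map f.op + F.map g.op) ∧
    IsIndObject (F ⋙ forget (ModuleCat.{0} ℂ))

/-- The category of ind-objects of the `ℂ`-linear category `C`. Any presheaf of sets on the additive
category `C` which is a filtered colimit of representables carries a unique structure of a
`ℂ`-linear presheaf of vector spaces, and all morphisms of presheaves of sets between such are
linear; so this is the usual category of ind-objects, with its `ℂ`-linear structure. -/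
abbrev IndLin := (IsLinearInd C).FullSubcategory

variable {C}

/-- The vector space of morphisms from the object `Y` of `C` to the ind-object `X`. -/
abbrev IndLin.sec (X : IndLin C) (Y : C) : Type := X.obj.obj (op Y)

/-- The linear map induced on morphisms from `Y` by a morphism of ind-objects. -/
abbrev IndLin.secMap {X X' : IndLin C} (f : X ⟶ X') (Y : C) : X.sec Y →ₗ[ℂ] X'.sec Y :=
  (f.hom.app (op Y)).hom

/-- The presheaf `Y ↦ ⨁ k, Hom(Y, P k)`. -/
noncomputable def sumPresheaf (P : ℕ → C) : Cᵒᵖ ⥤ ModuleCat.{0} ℂ where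
  obj Y := ModuleCat.of ℂ (DirectSum ℕ fun k => (Y.unop ⟶ P k))
  map f := ModuleCat.ofHom (DirectSum.lmap fun k => Linear.leftComp ℂ (P k) f.unop)
  map_id Y := by
    apply ModuleCat.hom_ext
    apply LinearMap.ext
    intro x
    apply DFinsupp.ext
    intro k
    change 𝟙 Y.unop ≫ _ = _
    rw [Category.id_comp]
    rfl
  map_comp f g := by
    apply ModuleCat.hom_ext
    apply LinearMap.ext
    intro x
    apply DFinsupp.ext
    intro k
    change (g.unop ≫ f.unop) ≫ _ = g.unop ≫ f.unop ≫ _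
    rw [Category.assoc]

variable [HasFiniteBiproducts C]

/-- The sum of the objects `P k`, for `k` in the finite set `s`. -/
noncomputable abbrev finObj (P : ℕ → C) (s : Finset ℕ) : C := ⨁ fun k : {k // k ∈ s} => P k.1

/-- The inclusion of a finite sum into a larger one. -/
noncomputable def finMap (P : ℕ → C) {s t : Finset ℕ} (h : s ⊆ t) : finObj P s ⟶ finObj P t :=
  biproduct.desc fun k => biproduct.ι (fun k : {k // k ∈ t} => P k.1) ⟨k.1, h k.2⟩

/-- The diagram of the finite sums of the objects `P k`. -/
noncomputable def finiteSums (P : ℕ → C) : Finset ℕ ⥤ C where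
  obj s := finObj P s
  map h := finMap P (leOfHom h)
  map_id s := by
    apply biproduct.hom_ext'
    intro k
    simp [finMap]
  map_comp {s t v} h h' := by
    apply biproduct.hom_ext'
    intro k
    simp [finMap]

theorem finMap_π (P : ℕ → C) {s t : Finset ℕ} (h : s ⊆ t) (k : ℕ) (hk : k ∈ t) :
    finMap P h ≫ biproduct.π (fun k : {k // k ∈ t} => P k.1) ⟨k, hk⟩ =
      if hs : k ∈ s then biproduct.π (fun k : {k // k ∈ s} => P k.1) ⟨k, hs⟩ else 0 := by
  apply biproduct.hom_ext'
  rintro ⟨j, hj⟩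
  rw [finMap, biproduct.ι_desc_assoc]
  by_cases hjk : j = k
  · obtain rfl := hjk
    simp [hj]
  · rw [biproduct.ι_π_ne _ (fun e => hjk (congrArg Subtype.val e))]
    split_ifs with hs
    · rw [biproduct.ι_π_ne _ (fun e => hjk (congrArg Subtype.val e))]
    · simp

/-- The components of a morphism into a finite sum. -/
noncomputable def toSum (P : ℕ → C) (s : Finset ℕ) {Y : C} (f : Y ⟶ finObj P s) :
    DirectSum ℕ fun k => (Y ⟶ P k) :=
  DFinsupp.mk s fun k => f ≫ biproduct.π (fun k : {k // k ∈ s} => P k.1) k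

theorem toSum_apply (P : ℕ → C) (s : Finset ℕ) {Y : C} (f : Y ⟶ finObj P s) (k : ℕ) :
    toSum P s f k =
      if hk : k ∈ s then f ≫ biproduct.π (fun k : {k // k ∈ s} => P k.1) ⟨k, hk⟩ else 0 :=
  DFinsupp.mk_apply

theorem toSum_map (P : ℕ → C) {s t : Finset ℕ} (h : s ⊆ t) {Y : C} (f : Y ⟶ finObj P s) :
    toSum P t (f ≫ finMap P h) = toSum P s f := by
  apply DFinsupp.ext
  intro k
  rw [toSum_apply, toSum_apply]
  by_cases hk : k ∈ t
  · rw [dif_pos hk, Category.assoc, finMap_π]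
    by_cases hs : k ∈ s
    · simp [hs]
    · simp [hs]
  · rw [dif_neg hk, dif_neg fun hs => hk (h hs)]

theorem toSum_injective (P : ℕ → C) (s : Finset ℕ) {Y : C} :
    Function.Injective (toSum P s (Y := Y)) := by
  intro f g hfg
  apply biproduct.hom_ext
  rintro ⟨k, hk⟩
  have := DFunLike.congr_fun hfg k
  rw [toSum_apply, toSum_apply, dif_pos hk, dif_pos hk] at this
  exact this

theorem toSum_surjective (P : ℕ → C) {Y : C} (x : DirectSum ℕ fun k => (Y ⟶ P k)) :
    ∃ (s : Finset ℕ) (f : Y ⟶ finObj P s), x = toSum P s f := by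
  classical
  refine ⟨DFinsupp.support x, biproduct.lift fun k => x k.1, ?_⟩
  apply DFinsupp.ext
  intro k
  rw [toSum_apply]
  split_ifs with hk
  · simp
  · simpa using hk

theorem toSum_comp (P : ℕ → C) (s : Finset ℕ) {Y Z : C} (e : Z ⟶ Y) (f : Y ⟶ finObj P s) :
    toSum P s (e ≫ f) = DirectSum.lmap (fun k => Linear.leftComp ℂ (P k) e) (toSum P s f) := by
  apply DFinsupp.ext
  intro k
  rw [DirectSum.lmap_apply, toSum_apply, toSum_apply]
  split_ifs with hk <;> simp

theorem isIndObject_sumPresheaf (P : ℕ → C) :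
    IsIndObject (sumPresheaf P ⋙ forget (ModuleCat.{0} ℂ)) := by
  refine IsIndObject.mk
    { I := Finset ℕ
      F := finiteSums P
      ι :=
        { app := fun s =>
            { app := fun Y => ↾fun f => toSum P s f
              naturality := fun Y Z e => by
                ext f
                exact toSum_comp P s e.unop f }
          naturality := fun s t h => by
            ext Y f
            exact toSum_map P (leOfHom h) f }
      isColimit := evaluationJointlyReflectsColimits _ fun Y => ?_ }
  refine Types.FilteredColimit.isColimitOf' _ _ (fun x => ?_) (fun s f g hfg => ?_)
  · exact toSum_surjective P x
  · exact ⟨s, 𝟙 s, congrArg _ (toSum_injective P s hfg)⟩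

/-- The ind-object `⨁ k, P k`, for a sequence `P` of objects of `C`. -/
noncomputable def indSum (P : ℕ → C) : IndLin C where
  obj := sumPresheaf P
  property := by
    refine ⟨fun {Y Z} c f g => ?_, isIndObject_sumPresheaf P⟩
    apply ModuleCat.hom_ext
    apply LinearMap.ext
    intro (x : DirectSum ℕ fun k => (Z ⟶ P k))
    apply DFinsupp.ext
    intro k
    change (c • f + g) ≫ x k = c • (f ≫ x k) + g ≫ x k
    simp

/-- The value at `x` of the morphism `P ⟶ X` given by `c`, as a linear map. -/
noncomputable def IndLin.evalAt (X : IndLin C) {P : C} (c : X.sec P) (Y : C) :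
    (Y ⟶ P) →ₗ[ℂ] X.sec Y where
  toFun x := (X.obj.map x.op).hom c
  map_add' x y := by
    have := X.property.1 1 x y
    rw [one_smul, one_smul] at this
    rw [this]; rfl
  map_smul' a x := by
    have h := X.property.1 a x 0
    have h0 := X.property.1 (-1) x x
    have h1 : X.obj.map (0 : Y ⟶ P).op = 0 := by simpa using h0
    rw [add_zero, h1, add_zero] at h
    rw [h]; rfl

/-- The value at `x = (x_k)_k` of the morphism with the restriction `c k` to the summand `P k`. -/
noncomputable def indSumDescApp (P : ℕ → C) (X : IndLin C) (c : ∀ k, X.sec (P k)) (Y : C) :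
    (DirectSum ℕ fun k => (Y ⟶ P k)) →ₗ[ℂ] X.sec Y :=
  DirectSum.toModule ℂ ℕ (X.sec Y) fun k => X.evalAt (c k) Y

theorem indSumDescApp_of (P : ℕ → C) (X : IndLin C) (c : ∀ k, X.sec (P k)) (Y : C) (k : ℕ)
    (g : Y ⟶ P k) :
    indSumDescApp P X c Y (DirectSum.of (fun k => (Y ⟶ P k)) k g) =
      (X.obj.map g.op).hom (c k) :=
  DirectSum.toModule_lof (R := ℂ) (N := X.sec Y) (φ := fun k => X.evalAt (c k) Y) k g

/-- The morphism `⨁ k, P k ⟶ X` whose restriction to the summand `P k` is `c k`. -/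
noncomputable def indSumDesc (P : ℕ → C) (X : IndLin C) (c : ∀ k, X.sec (P k)) : indSum P ⟶ X :=
  ObjectProperty.homMk
    { app := fun Y => ModuleCat.ofHom (indSumDescApp P X c Y.unop)
      naturality := fun Y Z e => by
        ext x
        change indSumDescApp P X c Z.unop
            (DirectSum.lmap (fun k => Linear.leftComp ℂ (P k) e.unop) x) =
          (X.obj.map e).hom (indSumDescApp P X c Y.unop x)
        induction x using DirectSum.induction_on with
        | zero => simp only [map_zero]
        | of k f =>
          rw [DirectSum.lmap_of]
          rw [indSumDescApp_of, indSumDescApp_of]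
          change (X.obj.map (e.unop ≫ f).op).hom (c k) = _
          rw [op_comp, X.obj.map_comp]
          rfl
        | add x y hx hy => simp only [map_add, hx, hy] }

end IndObjects

/-! ### Tensor products with vector spaces -/

open scoped TensorProduct

section Tensor

universe u v w

variable {C : Type*} [Category C] [Preadditive C] [Linear ℂ C]

/-- The object `W ⊗ X`, for a finite-dimensional vector space `W`: the sum of `dim W` copies of `X`,
indexed by a basis of `W`. -/
noncomputable def tens (W : Type u) [AddCommGroup W] [Module ℂ W] [FiniteDimensional ℂ W]
    (X : C) : Mat_ C where
  ι := Fin (Module.finrank ℂ W)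
  X := fun _ => X

/-- The morphism `f ⊗ a : W ⊗ X ⟶ W' ⊗ X'`, given by the matrix of `f`. -/
noncomputable def tensMap {W : Type u} [AddCommGroup W] [Module ℂ W] [FiniteDimensional ℂ W]
    {W' : Type v} [AddCommGroup W'] [Module ℂ W'] [FiniteDimensional ℂ W'] {X X' : C}
    (f : W →ₗ[ℂ] W') (a : X ⟶ X') : tens W X ⟶ tens W' X' :=
  fun i j => (Module.finBasis ℂ W').repr (f (Module.finBasis ℂ W i)) j • a

theorem tensMap_comp {W : Type u} [AddCommGroup W] [Module ℂ W] [FiniteDimensional ℂ W]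
    {W' : Type v} [AddCommGroup W'] [Module ℂ W'] [FiniteDimensional ℂ W']
    {W'' : Type w} [AddCommGroup W''] [Module ℂ W''] [FiniteDimensional ℂ W''] {X X' X'' : C}
    (f : W →ₗ[ℂ] W') (a : X ⟶ X') (g : W' →ₗ[ℂ] W'') (b : X' ⟶ X'') :
    tensMap f a ≫ tensMap g b = tensMap (g ∘ₗ f) (a ≫ b) := by
  apply Mat_.hom_ext
  intro (i : Fin (Module.finrank ℂ W)) (k : Fin (Module.finrank ℂ W''))
  change ∑ j : Fin (Module.finrank ℂ W'),
      ((Module.finBasis ℂ W').repr (f (Module.finBasis ℂ W i)) j • a) ≫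
        ((Module.finBasis ℂ W'').repr (g (Module.finBasis ℂ W' j)) k • b) =
    (Module.finBasis ℂ W'').repr (g (f (Module.finBasis ℂ W i))) k • (a ≫ b)
  conv_rhs => rw [← (Module.finBasis ℂ W').sum_repr (f (Module.finBasis ℂ W i)), map_sum, map_sum,
    Finsupp.coe_finsetSum, Finset.sum_apply, Finset.sum_smul]
  refine Finset.sum_congr rfl fun j _ => ?_
  rw [Linear.smul_comp, Linear.comp_smul, smul_smul, map_smul, map_smul, Finsupp.smul_apply,
    smul_eq_mul]

end Tensor

/-- The tensor power `U^{⊗ k}`. -/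
abbrev TPow (U : Type*) [AddCommGroup U] [Module ℂ U] (k : ℕ) : Type _ := ⨂[ℂ] _ : Fin k, U

section Pieces

universe u v

variable (ν : ℂ) (U : Type u) [AddCommGroup U] [Module ℂ U] [FiniteDimensional ℂ U]

/-- The object `U^{⊗ k} ⊗ Δ_k`. -/
noncomputable abbrev tensObj (k : ℕ) : Mat_ (DeltaCat ν) := tens (TPow U k) (Delta ν k)

/-- The action of `σ ∈ S_k` on `U^{⊗ k} ⊗ Δ_k`; on `U^{⊗ k}` it moves the `i`-th factor to the
position `σ(i)`. -/
noncomputable def permAct (k : ℕ) (σ : Equiv.Perm (Fin k)) : tensObj ν U k ⟶ tensObj ν U k :=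
  tensMap (PiTensorProduct.reindex ℂ (fun _ : Fin k => U) σ).toLinearMap (permHom ν σ)

theorem permAct_comp (k : ℕ) (σ τ : Equiv.Perm (Fin k)) :
    permAct ν U k σ ≫ permAct ν U k τ = permAct ν U k (τ * σ) := by
  rw [permAct, permAct, tensMap_comp, permHom_comp, permAct]
  congr 1
  ext x
  simp [Equiv.Perm.mul_def]

/-- The projection of `U^{⊗ k} ⊗ Δ_k` onto its `S_k`-invariants. -/
noncomputable def symProj (k : ℕ) : tensObj ν U k ⟶ tensObj ν U k :=
  (k.factorial : ℂ)⁻¹ • ∑ σ : Equiv.Perm (Fin k), permAct ν U k σ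

theorem symProj_idem (k : ℕ) : symProj ν U k ≫ symProj ν U k = symProj ν U k := by
  have h : ∀ σ : Equiv.Perm (Fin k), permAct ν U k σ ≫ ∑ τ : Equiv.Perm (Fin k), permAct ν U k τ =
      ∑ τ : Equiv.Perm (Fin k), permAct ν U k τ := by
    intro σ
    rw [Preadditive.comp_sum]
    simp only [permAct_comp]
    exact Fintype.sum_equiv (Equiv.mulRight σ) _ _ fun τ => rfl
  have hk : (k.factorial : ℂ) ≠ 0 := Nat.cast_ne_zero.2 k.factorial_ne_zero
  rw [symProj, Linear.smul_comp, Linear.comp_smul, Preadditive.sum_comp]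
  simp only [h]
  rw [Finset.sum_const, Finset.card_univ, Fintype.card_perm, Fintype.card_fin,
    ← Nat.cast_smul_eq_nsmul ℂ, smul_smul, smul_smul, mul_assoc, inv_mul_cancel₀ hk, mul_one]

/-- The object `(U^{⊗ k} ⊗ Δ_k)^{S_k}` of Deligne's category. -/
noncomputable def piece (k : ℕ) : RepS ν where
  X := tensObj ν U k
  p := symProj ν U k
  idem := symProj_idem ν U k

variable {U} {U' : Type v} [AddCommGroup U'] [Module ℂ U'] [FiniteDimensional ℂ U']

/-- The morphism between the objects of invariants coming from a morphism
`U^{⊗ k} ⊗ Δ_k ⟶ U'^{⊗ l} ⊗ Δ_l` (inclusion of the invariants, the given morphism, projection onto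
the invariants). -/
noncomputable def pieceMap {k l : ℕ} (m : tensObj ν U k ⟶ tensObj ν U' l) :
    piece ν U k ⟶ piece ν U' l where
  f := symProj ν U k ≫ m ≫ symProj ν U' l
  comm := by
    simp only [piece, Category.assoc, symProj_idem]
    rw [← Category.assoc (symProj ν U k), symProj_idem]

end Pieces

section Operators

universe u v

variable {U : Type u} [AddCommGroup U] [Module ℂ U] {U' : Type v} [AddCommGroup U'] [Module ℂ U']

/-- `A^{(i)}` : the operator `A` applied to the `i`-th factor. -/
noncomputable def actAt {k : ℕ} (i : Fin k) (A : U →ₗ[ℂ] U) : TPow U k →ₗ[ℂ] TPow U k :=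
  PiTensorProduct.map (Function.update (fun _ => LinearMap.id) i A)

/-- The action of `A ∈ gl(U)` on `U^{⊗ k}`. -/
noncomputable def diagAct (k : ℕ) (A : U →ₗ[ℂ] U) : TPow U k →ₗ[ℂ] TPow U k :=
  ∑ i : Fin k, actAt i A

/-- `u^{(l)}` : inserting the vector `u` at the position `l`. -/
noncomputable def insertAt {k : ℕ} (l : Fin (k + 1)) (u : U) : TPow U k →ₗ[ℂ] TPow U (k + 1) :=
  PiTensorProduct.lift ((PiTensorProduct.tprod ℂ (s := fun _ : Fin (k + 1) => U)).curryMid l u)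

theorem insertAt_tprod {k : ℕ} (l : Fin (k + 1)) (u : U) (x : Fin k → U) :
    insertAt l u (PiTensorProduct.tprod ℂ x) =
      PiTensorProduct.tprod ℂ (l.insertNth (α := fun _ => U) u x) := by
  simp [insertAt]

/-- `f^{(l)}` : contracting the factor at the position `l` with the functional `f`. -/
noncomputable def contractAt {k : ℕ} (l : Fin (k + 1)) (f : U →ₗ[ℂ] ℂ) :
    TPow U (k + 1) →ₗ[ℂ] TPow U k :=
  PiTensorProduct.lift (LinearMap.uncurryMid (M := fun _ : Fin (k + 1) => U) l
    (f.smulRight (PiTensorProduct.tprod ℂ (s := fun _ : Fin k => U))))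

theorem contractAt_tprod {k : ℕ} (l : Fin (k + 1)) (f : U →ₗ[ℂ] ℂ) (x : Fin (k + 1) → U) :
    contractAt l f (PiTensorProduct.tprod ℂ x) =
      f (x l) • PiTensorProduct.tprod ℂ (fun i => x (l.succAbove i)) := by
  simp [contractAt]
  rfl

theorem mixed_prod_of_mem {k l : ℕ} (ι : Fin l ↪o Fin k) [DecidablePred fun i => i ∉ Set.range ι]
    (a : U →ₗ[ℂ] ℂ) (x : Fin k → U) (j : Fin l) (y : U) :
    ∏ i with i ∉ Set.range ι, a (Function.update x (ι j) y i) =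
      ∏ i with i ∉ Set.range ι, a (x i) := by
  refine Finset.prod_congr rfl fun i hi => ?_
  rw [Function.update_of_ne]
  rintro rfl
  simp at hi

theorem mixed_prod_of_notMem {k l : ℕ} (ι : Fin l ↪o Fin k)
    [DecidablePred fun i => i ∉ Set.range ι] (a : U →ₗ[ℂ] ℂ) (x : Fin k → U) {i : Fin k}
    (hi : i ∉ Set.range ι) (y : U) :
    ∏ i' with i' ∉ Set.range ι, a (Function.update x i y i') =
      a y * ∏ i' ∈ (Finset.univ.filter fun i' => i' ∉ Set.range ι).erase i, a (x i') := by
  rw [← Finset.mul_prod_erase _ _ (Finset.mem_filter.2 ⟨Finset.mem_univ i, hi⟩),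
    Function.update_self]
  congr 1
  refine Finset.prod_congr rfl fun i' hi' => ?_
  rw [Function.update_of_ne (Finset.ne_of_mem_erase hi')]

theorem mixed_arg_of_mem {k l : ℕ} (ι : Fin l ↪o Fin k) (b : U →ₗ[ℂ] U') (x : Fin k → U)
    (j : Fin l) (y : U) :
    (fun j' => b (Function.update x (ι j) y (ι j'))) =
      Function.update (fun j' => b (x (ι j'))) j (b y) := by
  funext j'
  by_cases h : j' = j
  · subst h
    simp
  · rw [Function.update_of_ne h, Function.update_of_ne (fun e => h (ι.injective e))]

theorem mixed_arg_of_notMem {k l : ℕ} (ι : Fin l ↪o Fin k) (b : U →ₗ[ℂ] U') (x : Fin k → U)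
    {i : Fin k} (hi : i ∉ Set.range ι) (y : U) :
    (fun j' => b (Function.update x i y (ι j'))) = fun j' => b (x (ι j')) := by
  funext j'
  rw [Function.update_of_ne (fun e => hi ⟨j', e⟩)]

/-- The multilinear map sending `(x_1, …, x_k)` to `∏_{i ∉ Im ι} a(x_i)` times
`b(x_{ι(1)}) ⊗ ⋯ ⊗ b(x_{ι(l)})`. -/
noncomputable def mixedMulti {k l : ℕ} (ι : Fin l ↪o Fin k) (b : U →ₗ[ℂ] U') (a : U →ₗ[ℂ] ℂ) :
    MultilinearMap ℂ (fun _ : Fin k => U) (TPow U' l) :=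
  haveI := Classical.decPred fun i => i ∉ Set.range ι
  MultilinearMap.mk' (fun x => (∏ i with i ∉ Set.range ι, a (x i)) •
      PiTensorProduct.tprod ℂ fun j => b (x (ι j)))
    (by
      intro x i y z
      by_cases hi : i ∈ Set.range ι
      · obtain ⟨j, rfl⟩ := hi
        simp only [mixed_prod_of_mem, mixed_arg_of_mem, map_add, MultilinearMap.map_update_add,
          smul_add]
      · simp only [mixed_prod_of_notMem ι a x hi, mixed_arg_of_notMem ι b x hi, map_add, add_mul,
          add_smul])
    (by
      intro x i c y
      by_cases hi : i ∈ Set.range ι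
      · obtain ⟨j, rfl⟩ := hi
        simp only [mixed_prod_of_mem, mixed_arg_of_mem, map_smul, MultilinearMap.map_update_smul,
          smul_comm c]
      · simp only [mixed_prod_of_notMem ι a x hi, mixed_arg_of_notMem ι b x hi, map_smul,
          smul_eq_mul, mul_assoc, mul_smul])

/-- Applying `b` to the factors in the image of `ι` and the functional `a` to the other factors. -/
noncomputable def mixedAct {k l : ℕ} (ι : Fin l ↪o Fin k) (b : U →ₗ[ℂ] U') (a : U →ₗ[ℂ] ℂ) :
    TPow U k →ₗ[ℂ] TPow U' l :=
  PiTensorProduct.lift (mixedMulti ι b a)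

end Operators

/-! ### Unital vector spaces -/

section Unital

universe u

/-- Finite-dimensional complex vector spaces `V` with a distinguished non-zero vector `𝟙` and a
splitting `V = ℂ 𝟙 ⊕ U`. -/
structure SplitUnital : Type (u + 1) where
  V : Type u
  [addCommGroup : AddCommGroup V]
  [module : Module ℂ V]
  [finiteDimensional : FiniteDimensional ℂ V]
  one : V
  one_ne_zero : one ≠ 0
  U : Submodule ℂ V
  isCompl : IsCompl (ℂ ∙ one) U

attribute [instance] SplitUnital.addCommGroup SplitUnital.module SplitUnital.finiteDimensional

namespace SplitUnital

/-- Morphisms: the linear maps that respect the distinguished vectors. -/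
@[ext]
structure Hom (S T : SplitUnital.{u}) : Type u where
  lin : S.V →ₗ[ℂ] T.V
  map_one : lin S.one = T.one

instance : Category SplitUnital.{u} where
  Hom S T := Hom S T
  id S := ⟨LinearMap.id, rfl⟩
  comp f g := ⟨g.lin ∘ₗ f.lin, by rw [LinearMap.comp_apply, f.map_one, g.map_one]⟩

/-- The projection of `V` onto `U` along `ℂ 𝟙`. -/
noncomputable def projU (S : SplitUnital.{u}) : S.V →ₗ[ℂ] S.U :=
  S.U.projectionOnto (ℂ ∙ S.one) S.isCompl.symm

/-- The functional which vanishes on `U` and takes the value `1` at `𝟙`. -/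
noncomputable def coordOne (S : SplitUnital.{u}) : S.V →ₗ[ℂ] ℂ :=
  (LinearEquiv.toSpanNonzeroSingleton ℂ S.V S.one S.one_ne_zero).symm.toLinearMap ∘ₗ
    (ℂ ∙ S.one).projectionOnto S.U S.isCompl

theorem coordOne_smul_add_projU (S : SplitUnital.{u}) (v : S.V) :
    S.coordOne v • S.one + (S.projU v : S.V) = v := by
  have h : S.coordOne v • S.one = ((ℂ ∙ S.one).projectionOnto S.U S.isCompl v : S.V) := by
    have := LinearEquiv.apply_symm_apply
      (LinearEquiv.toSpanNonzeroSingleton ℂ S.V S.one S.one_ne_zero)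
      ((ℂ ∙ S.one).projectionOnto S.U S.isCompl v)
    exact congrArg Subtype.val this
  have h2 := Submodule.projection_add_projection_eq_self S.isCompl v
  rw [Submodule.projection_apply, Submodule.projection_apply] at h2
  rw [h]
  exact h2

end SplitUnital

/-! ### The complex tensor power -/

variable (ν : ℂ)

section ActionOperators

variable {U : Type u} [AddCommGroup U] [Module ℂ U] [FiniteDimensional ℂ U]

/-- `F_u = (1/(k+1)) ∑_l u^{(l)} ⊗ res_l^*`. -/
noncomputable def opF (k : ℕ) (u : U) : piece ν U k ⟶ piece ν U (k + 1) :=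
  pieceMap ν ((1 / ((k : ℂ) + 1)) • ∑ l : Fin (k + 1), tensMap (insertAt l u) (resStar ν l))

/-- `E_f = ∑_l f^{(l)} ⊗ res_l`. -/
noncomputable def opE (k : ℕ) (f : U →ₗ[ℂ] ℂ) : piece ν U (k + 1) ⟶ piece ν U k :=
  pieceMap ν (∑ l : Fin (k + 1), tensMap (contractAt l f) (res ν l))

/-- The action of `A ∈ gl(U)`, namely `∑_i A^{(i)} ⊗ id`. -/
noncomputable def opA (k : ℕ) (A : U →ₗ[ℂ] U) : piece ν U k ⟶ piece ν U k :=
  pieceMap ν (∑ i : Fin k, tensMap (actAt i A) (𝟙 (Delta ν k)))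

end ActionOperators

/-- The object `⨁_{k ≥ 0} (U^{⊗ k} ⊗ Δ_k)^{S_k}`. -/
noncomputable def tensorPowerObj (S : SplitUnital.{u}) : IndLin (RepS ν) := indSum (piece ν S.U)

/-- The morphism from `Y` to the tensor power given by a morphism to the `k`-th summand. -/
noncomputable def toSummand (S : SplitUnital.{u}) {Y : RepS ν} (k : ℕ) (m : Y ⟶ piece ν S.U k) :
    (tensorPowerObj ν S).sec Y :=
  (DirectSum.of (fun k => (Y ⟶ piece ν S.U k)) k m : DirectSum ℕ fun k => (Y ⟶ piece ν S.U k))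

/-- The `(l, k)` matrix coefficient of the morphism of tensor powers given by `φ`. -/
noncomputable def tensorPowerCoeff {S T : SplitUnital.{u}} (φ : S ⟶ T) (l k : ℕ) :
    piece ν S.U k ⟶ piece ν T.U l :=
  haveI : Fintype (Fin l ↪o Fin k) := Fintype.ofFinite _
  pieceMap ν (∑ ι : Fin l ↪o Fin k,
    tensMap (mixedAct ι (T.projU ∘ₗ φ.lin ∘ₗ S.U.subtype) (T.coordOne ∘ₗ φ.lin ∘ₗ S.U.subtype))
      (resHom ν ι.toEmbedding))

/-- The morphism of tensor powers given by `φ`. -/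
noncomputable def tensorPowerMap {S T : SplitUnital.{u}} (φ : S ⟶ T) :
    tensorPowerObj ν S ⟶ tensorPowerObj ν T :=
  indSumDesc (piece ν S.U) (tensorPowerObj ν T) fun k =>
    ∑ l ∈ Finset.range (k + 1), toSummand ν T l (tensorPowerCoeff ν φ l k)

/-- The assignment `S ↦ ⨁_{k ≥ 0} (U^{⊗ k} ⊗ Δ_k)^{S_k}`, on objects and on morphisms. -/
noncomputable def tensorPower : SplitUnital.{u} ⥤q IndLin (RepS ν) where
  obj S := tensorPowerObj ν S
  map φ := tensorPowerMap ν φ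

/-- The components `gl(V) = ℂ id_V ⊕ U ⊕ U^* ⊕ gl(U)` of an endomorphism of `V = ℂ 𝟙 ⊕ U`, where
`u ∈ U` stands for `𝟙 ↦ u`, `U ↦ 0`, where `f ∈ U^*` stands for `𝟙 ↦ 0`, `v ↦ f(v) 𝟙` for `v ∈ U`,
and where `gl(U)` acts by zero on `𝟙`. -/
noncomputable def glScalar (S : SplitUnital.{u}) (A : Module.End ℂ S.V) : ℂ := S.coordOne (A S.one)

noncomputable def glVec (S : SplitUnital.{u}) (A : Module.End ℂ S.V) : S.U := S.projU (A S.one)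

noncomputable def glCovec (S : SplitUnital.{u}) (A : Module.End ℂ S.V) : S.U →ₗ[ℂ] ℂ :=
  S.coordOne ∘ₗ A ∘ₗ S.U.subtype

noncomputable def glEndU (S : SplitUnital.{u}) (A : Module.End ℂ S.V) : S.U →ₗ[ℂ] S.U :=
  S.projU ∘ₗ A ∘ₗ S.U.subtype - glScalar S A • LinearMap.id

/-- The endomorphism of `V` which is `A` on `U` and zero on `𝟙`. -/
noncomputable def extendU (S : SplitUnital.{u}) (A : S.U →ₗ[ℂ] S.U) : Module.End ℂ S.V :=
  S.U.subtype ∘ₗ A ∘ₗ S.projU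

theorem gl_decomposition (S : SplitUnital.{u}) (A : Module.End ℂ S.V) (v : S.V) :
    A v = glScalar S A • v + S.coordOne v • (glVec S A : S.V) +
      glCovec S A (S.projU v) • S.one + extendU S (glEndU S A) v := by
  have h1 := S.coordOne_smul_add_projU v
  have h2 := S.coordOne_smul_add_projU (A S.one)
  have h3 := S.coordOne_smul_add_projU (A (S.projU v))
  have h4 : A v = S.coordOne v • A S.one + A (S.projU v) := by
    conv_lhs => rw [← h1]
    rw [map_add, map_smul]
  rw [h4]
  conv_lhs => rw [← h2, ← h3]
  have h5 : glScalar S A • v = glScalar S A • S.coordOne v • S.one +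
      glScalar S A • (S.projU v : S.V) := by
    rw [← smul_add, h1]
  rw [h5]
  simp only [glScalar, glVec, glCovec, glEndU, extendU, LinearMap.comp_apply, LinearMap.sub_apply,
    LinearMap.smul_apply, LinearMap.id_apply, Submodule.subtype_apply,
    Submodule.coe_sub, Submodule.coe_smul]
  module

/-- The part of the action of `A` given by `U^*`, on the `k`-th summand. -/
noncomputable def lowerPart (S : SplitUnital.{u}) (f : S.U →ₗ[ℂ] ℂ) :
    ∀ k : ℕ, (tensorPowerObj ν S).sec (piece ν S.U k)
  | 0 => 0
  | k + 1 => toSummand ν S k (opE ν k f)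

/-- The action of `A ∈ gl(V)` on the tensor power: `id_V` acts by `ν`, `u ∈ U` by `F_u`, `f ∈ U^*` by
`E_f` and `gl(U)` diagonally. -/
noncomputable def glAct (S : SplitUnital.{u}) (A : Module.End ℂ S.V) :
    End (tensorPowerObj ν S) :=
  indSumDesc (piece ν S.U) (tensorPowerObj ν S) fun k =>
    (glScalar S A * ν) • toSummand ν S k (𝟙 _) + toSummand ν S (k + 1) (opF ν k (glVec S A)) +
      lowerPart ν S (glCovec S A) k + toSummand ν S k (opA ν k (glEndU S A))

end Unital

attribute [instance] LieRing.ofAssociativeRing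

/-! ### Ind-objects with an action of `gl(V)` of parabolic type -/

section Parabolic

universe u

/-- Finite-dimensional polynomial representations of `gl(U)`: direct summands of finite direct sums
of tensor powers of `U`. -/
structure PolyRep (U : Type u) [AddCommGroup U] [Module ℂ U] where
  E : Type
  [addCommGroup : AddCommGroup E]
  [module : Module ℂ E]
  [finiteDimensional : FiniteDimensional ℂ E]
  act : Module.End ℂ U →ₗ⁅ℂ⁆ Module.End ℂ E
  polynomial : ∃ (m : ℕ) (n : Fin m → ℕ) (i : E →ₗ[ℂ] ∀ j, TPow U (n j))
    (p : (∀ j, TPow U (n j)) →ₗ[ℂ] E), p ∘ₗ i = LinearMap.id ∧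
      (∀ A e j, i (act A e) j = diagAct (n j) A (i e j)) ∧
      ∀ A x, p (fun j => diagAct (n j) A (x j)) = act A (p x)

attribute [instance] PolyRep.addCommGroup PolyRep.module PolyRep.finiteDimensional

/-- A splitting `V = ℂ 𝟙 ⊕ U` of the unital vector space `(V, 𝟙)`. -/
structure Splitting {V : Type u} [AddCommGroup V] [Module ℂ V] (one : V) where
  U : Submodule ℂ V
  isCompl : IsCompl (ℂ ∙ one) U

variable {V : Type u} [AddCommGroup V] [Module ℂ V] [FiniteDimensional ℂ V] {one : V}

/-- The split unital vector space given by a splitting. -/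
abbrev Splitting.toUnital (S : Splitting one) (hne : one ≠ 0) : SplitUnital.{u} :=
  ⟨V, one, hne, S.U, S.isCompl⟩

/-- The identity of `V` as a morphism between two splittings of `(V, 𝟙)`. -/
def Splitting.idHom (hne : one ≠ 0) (S T : Splitting one) : S.toUnital hne ⟶ T.toUnital hne :=
  SplitUnital.Hom.mk (S := S.toUnital hne) (T := T.toUnital hne) (LinearMap.id (M := V)) rfl

/-- The endomorphism of `V` which is `A` on `U` and zero on `𝟙`. -/
noncomputable def Splitting.extend (R : Splitting one) (A : Module.End ℂ R.U) : Module.End ℂ V :=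
  R.U.subtype ∘ₗ A ∘ₗ R.U.projectionOnto (ℂ ∙ one) R.isCompl.symm

variable (ν : ℂ)

/-- The subalgebra `gl(U)` acts polynomially on `X`: there are ind-objects `Y_i` and polynomial
representations `E_i` such that `X ≅ ⨁_i Y_i ⊗ E_i`, compatibly with the actions. The sum is described
by its universal property: giving a morphism `X ⟶ Z` amounts to giving linear maps
`E_i → Hom(Y_i, Z)`. -/
def ActsPolynomially (R : Splitting one) (X : IndLin (RepS ν))
    (ρ : Module.End ℂ V →ₗ⁅ℂ⁆ End X) : Prop :=
  ∃ (I : Type) (Y : I → IndLin (RepS ν)) (E : I → PolyRep R.U)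
    (j : ∀ i, (E i).E →ₗ[ℂ] (Y i ⟶ X)),
    (∀ Z : IndLin (RepS ν), Function.Bijective
      fun (f : X ⟶ Z) (i : I) => Linear.rightComp ℂ (Y i) f ∘ₗ j i) ∧
    ∀ i (A : Module.End ℂ R.U) e, j i ((E i).act A e) = j i e ≫ ρ (R.extend A)

/-- The subalgebra of the endomorphisms `φ` with `Im φ ⊆ ℂ 𝟙 ⊆ Ker φ` acts locally finitely on `X`:
each morphism from an object `Y` to `X` lies in a finite-dimensional space of morphisms which is
stable under this subalgebra. -/
def ActsLocallyFinitely (one : V) (X : IndLin (RepS ν))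
    (ρ : Module.End ℂ V →ₗ⁅ℂ⁆ End X) : Prop :=
  ∀ (Y : RepS ν) (f : X.sec Y), ∃ M : Submodule ℂ (X.sec Y), FiniteDimensional ℂ M ∧ f ∈ M ∧
    ∀ φ : Module.End ℂ V, LinearMap.range φ ≤ ℂ ∙ one → ℂ ∙ one ≤ LinearMap.ker φ →
      ∀ g ∈ M, IndLin.secMap (ρ φ) Y g ∈ M

/-- The action `ρ` of `gl(V)` on `X` is of the type of the parabolic category `O` of degree `ν`, for
the splitting `R` of `V`. -/
structure IsParabolicAction (R : Splitting one) (X : IndLin (RepS ν))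
    (ρ : Module.End ℂ V →ₗ⁅ℂ⁆ End X) : Prop where
  polynomial : ActsPolynomially ν R X ρ
  locallyFinite : ActsLocallyFinitely ν one X ρ
  degree : ρ 1 = ν • (1 : End X)

/-- The ind-objects of Deligne's category with an action of `gl(V)` of the type of the parabolic
category `O` of degree `ν`. -/
structure ParabolicInd (R : Splitting one) where
  X : IndLin (RepS ν)
  ρ : Module.End ℂ V →ₗ⁅ℂ⁆ End X
  isParabolic : IsParabolicAction ν R X ρ

/-- Morphisms of ind-objects that commute with the actions of `gl(V)`. -/
@[ext]
structure ParabolicInd.Hom {R : Splitting one} (M N : ParabolicInd ν R) where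
  hom : M.X ⟶ N.X
  comm : ∀ A : Module.End ℂ V, M.ρ A ≫ hom = hom ≫ N.ρ A

noncomputable instance (R : Splitting one) : Category (ParabolicInd ν R) where
  Hom M N := ParabolicInd.Hom ν M N
  id M := ⟨𝟙 M.X, fun A => by rw [Category.comp_id]; exact (Category.id_comp _).symm⟩
  comp f g := ⟨f.hom ≫ g.hom, fun A => by
    rw [← Category.assoc, f.comm A, Category.assoc, g.comm A, Category.assoc]⟩
  id_comp f := ParabolicInd.Hom.ext (Category.id_comp f.hom)
  comp_id f := ParabolicInd.Hom.ext (Category.comp_id f.hom)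
  assoc f g h := ParabolicInd.Hom.ext (Category.assoc f.hom g.hom h.hom)

end Parabolic

/-- `T` is a locally finite endomorphism of the complex vector space `M` and `g = exp(T)`: each vector
`x` lies in a finite-dimensional `T`-stable subspace, and `∑ T^n x / n!` converges to `g x`. (The
convergence takes place in a finite-dimensional space, where it may be tested by linear
functionals.) -/
def IsLocallyFiniteExp {M : Type*} [AddCommGroup M] [Module ℂ M] (T g : M →ₗ[ℂ] M) : Prop :=
  ∀ x : M, (∃ N : Submodule ℂ M, FiniteDimensional ℂ N ∧ x ∈ N ∧ ∀ y ∈ N, T y ∈ N) ∧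
    ∀ l : M →ₗ[ℂ] ℂ, HasSum (fun n : ℕ => (n.factorial : ℂ)⁻¹ * l ((T ^ n) x)) (l (g x))

end DeligneCat

open DeligneCat

universe u

namespace DeligneCat
open scoped TensorProduct

/-! ### Composition of diagrams -/

/-! Split a morphism φ : V → V' of Uni into its components b : U → U' and a : U → ℂ. Everything
rests on one factorization: φ^{⊗ν} is exp(E_a) followed on the k-th summand by b^{⊗k} ⊗ id
(`tensorPowerMap_eq`). Permutations are invisible on S_k-invariants, and S_k is transitive on the
injections ι. So all binom(k,l) terms of a matrix coefficient equal the contraction of the first j =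
k - l factors with a, followed by b^{⊗l}. On the other hand E_a^j is k(k-1)…(l+1) times that
contraction, and the ratio of the two factors is 1/j!.

Functoriality follows. The operators E commute with one another, so exp(E_a) exp(E_{a'}) =
exp(E_{a+a'}) (`shear_comp_shear`); maps that respect the splittings intertwine E_{a∘b} with E_a
(`strictMap_comp_shear`); and the pairs (b, a) compose like affine maps.

That ρ_U is a Lie action comes down to relations between F, E and gl(U) on the summands. The
essential one is the bracket of E_f and F_u (`opF_comp_opE_succ`). Contracting the vector just
inserted gives f(u)(ν-k), from the only vertex isolated on both sides. Contracting another factor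
gives F_u E_f up to the diagrams in which the forgotten vertex is joined to the inserted one. Those
diagrams are permutations, and on invariants they become the action of the rank one operator u ⊗ f
in gl(U).

Equivariance: if φA = Bφ, then φ^{⊗ν} intertwines ρ(A) and ρ(B) (`glAct_comp_tensorPowerMap`). For
maps respecting the splittings the blocks of A and B are compared. For a shear 1 + n with n² = 0,
conjugation is 1 + ad n + (ad n)²/2 on gl(V), and the same formula holds on the tensor power because
ρ is a Lie homomorphism and the shear acts there by exp(ρ(n)). Taking φ = id_V between two
splittings and A = B gives the canonical isomorphisms; their cocycle property is functoriality.

Integration: adjoin a new unit, so that V itself becomes the complement in V ⊕ ℂ. There φ ⊕ 0 acts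
only through gl of the complement, and the exponential is computed factor by factor. The morphism V
⊕ ℂ → V which sends the new unit to 𝟙 is split in Uni and intertwines φ ⊕ 0 with φ, because φ(𝟙) =
0. Hence the statement descends to V (`exists_isLocallyFiniteExp_tensorPowerMap`).

Parabolic type: for the reference splitting, a Schur–Weyl argument with primitive idempotents of
ℂ[S_k] decomposes each summand (`exists_decomposition_piece`). For any other splitting the
decomposition is transported along the equivariant isomorphism. Local finiteness holds because E
lowers k and the morphism spaces of Deligne's category are finite-dimensional. -/

theorem diagHom_comp (ν : ℂ) {r s t : ℕ} (π : Diag r s) (ρ : Diag s t) :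
    diagHom ν π ≫ diagHom ν ρ = ∑ τ, coef ν π ρ τ • diagHom ν τ := by
  funext (τ : Diag r t)
  have h : (∑ τ', coef ν π ρ τ' • diagHom ν τ') τ =
      ∑ τ', coef ν π ρ τ' * (if τ = τ' then 1 else 0) :=
    Finset.sum_apply (M := fun _ : Diag r t => ℂ) τ Finset.univ
      (fun τ' => fun x : Diag r t => coef ν π ρ τ' * (if x = τ' then 1 else 0))
  rw [h]
  change ∑ π', ∑ ρ', (if π' = π then (1 : ℂ) else 0) * (if ρ' = ρ then (1 : ℂ) else 0) *
    coef ν π' ρ' τ = _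
  rw [Finset.sum_eq_single π (fun π _ hπ => by simp [hπ]) (by simp),
    Finset.sum_eq_single ρ (fun π _ hπ => by simp [hπ]) (by simp)]
  simp

/-- With no middle vertex isolated on both sides the product in the coefficient is empty, so every
gluing counts once and ν disappears. -/
theorem diagHom_comp_of_numMiddle_eq_zero (ν : ℂ) {r s t : ℕ} (π : Diag r s) (ρ : Diag s t)
    (hm : ∀ m, π.symm m ≠ none ∨ ρ m ≠ none) :
    diagHom ν π ≫ diagHom ν ρ =
      haveI := Classical.decPred (IsGluing π ρ)
      ∑ τ with IsGluing π ρ τ, diagHom ν τ := by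
  classical
  have h3 : numMiddle π ρ = 0 := by
    rw [numMiddle, Finset.card_eq_zero, Finset.filter_eq_empty_iff]
    rintro m - ⟨h, h'⟩
    exact (hm m).elim (· h) (· h')
  rw [diagHom_comp, Finset.sum_filter]
  refine Finset.sum_congr rfl fun τ _ => ?_
  rw [coef, h3]
  split_ifs <;> simp

/-- An extra edge needs an upper vertex isolated in π and a lower vertex isolated in ρ. If either
kind is absent, nothing can be added to the glued diagram. -/
theorem isGluing_iff_of_total {r s t : ℕ} {π : Diag r s} {ρ : Diag s t}
    (h : (∀ i, π i ≠ none) ∨ ∀ j, ρ.symm j ≠ none) (τ : Diag r t) :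
    IsGluing π ρ τ ↔ τ = π.trans ρ := by
  constructor
  · rintro ⟨ha, hb⟩
    ext i j
    exact ⟨fun hij => (hb i j hij).resolve_right fun hh => h.elim (fun h => h i hh.1)
      (fun h => h j hh.2), fun hij => ha i j hij⟩
  · rintro rfl
    exact ⟨fun _ _ h => h, fun _ _ h => Or.inl h⟩

theorem diagHom_comp_eq_trans (ν : ℂ) {r s t : ℕ} (π : Diag r s) (ρ : Diag s t)
    (hm : ∀ m, π.symm m ≠ none ∨ ρ m ≠ none)
    (h : (∀ i, π i ≠ none) ∨ ∀ j, ρ.symm j ≠ none) :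
    diagHom ν π ≫ diagHom ν ρ = diagHom ν (π.trans ρ) := by
  classical
  rw [diagHom_comp_of_numMiddle_eq_zero ν π ρ hm,
    Finset.sum_eq_single (π.trans ρ : Diag r t)]
  · intro τ hτ hne
    exact absurd ((isGluing_iff_of_total h τ).1 (Finset.mem_filter.1 hτ).2) hne
  · intro hn
    exact absurd (Finset.mem_filter.2 ⟨Finset.mem_univ _, (isGluing_iff_of_total h _).2 rfl⟩) hn

/-! ### Composites of restriction diagrams and permutations -/

theorem resDiag_symm_apply {l k : ℕ} (ι : Fin l ↪ Fin k) (i : Fin l) :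
    (resDiag ι).symm i = some (ι i) := rfl

theorem resDiag_eq_some {l k : ℕ} {ι : Fin l ↪ Fin k} {i : Fin k} {j : Fin l} :
    resDiag ι i = some j ↔ ι j = i := by
  rw [← PEquiv.eq_some_iff, resDiag_symm_apply, Option.some.injEq]

theorem resDiag_ne_none {l k : ℕ} {ι : Fin l ↪ Fin k} {i : Fin k} (h : i ∈ Set.range ι) :
    resDiag ι i ≠ none := by
  obtain ⟨j, hj⟩ := h
  rw [resDiag_eq_some.2 hj]
  simp

theorem toPEquiv_ne_none {k : ℕ} (σ : Equiv.Perm (Fin k)) (i : Fin k) : σ.toPEquiv i ≠ none := by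
  simp [Equiv.toPEquiv_apply]

theorem toPEquiv_symm_ne_none {k : ℕ} (σ : Equiv.Perm (Fin k)) (i : Fin k) :
    σ.toPEquiv.symm i ≠ none := by
  rw [← Equiv.toPEquiv_symm]
  exact toPEquiv_ne_none _ _

theorem diag_ext {r s : ℕ} {π ρ : Diag r s} (h : ∀ i j, π i = some j ↔ ρ i = some j) : π = ρ := by
  ext i j
  exact h i j

theorem toPEquiv_eq_some {k : ℕ} (σ : Equiv.Perm (Fin k)) {i j : Fin k} :
    σ.toPEquiv i = some j ↔ σ i = j := by
  rw [Equiv.toPEquiv_apply, Option.some.injEq]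

theorem resDiag_symm_eq_some {l k : ℕ} {ι : Fin l ↪ Fin k} {i : Fin l} {j : Fin k} :
    (resDiag ι).symm i = some j ↔ ι i = j := by
  rw [resDiag_symm_apply, Option.some.injEq]

theorem permHom_comp_resHom (ν : ℂ) {l k : ℕ} (σ : Equiv.Perm (Fin k)) (ι ι' : Fin l ↪ Fin k)
    (h : ∀ j, σ (ι j) = ι' j) : permHom ν σ ≫ resHom ν ι' = resHom ν ι := by
  rw [permHom, resHom, resHom, diagHom_comp_eq_trans ν _ _
    (fun m => Or.inl (toPEquiv_symm_ne_none σ m)) (Or.inl (toPEquiv_ne_none σ))]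
  congr 1
  refine diag_ext fun i j => ?_
  rw [trans_eq_some, resDiag_eq_some]
  simp only [toPEquiv_eq_some, resDiag_eq_some]
  constructor
  · rintro ⟨m, rfl, hm⟩
    rw [← h] at hm
    exact σ.injective hm
  · rintro rfl
    exact ⟨_, rfl, (h j).symm⟩

theorem resHom_comp_permHom (ν : ℂ) {l k : ℕ} (ι ι' : Fin l ↪ Fin k) (σ : Equiv.Perm (Fin l))
    (h : ∀ j, ι' (σ j) = ι j) : resHom ν ι ≫ permHom ν σ = resHom ν ι' := by
  rw [permHom, resHom, resHom, diagHom_comp_eq_trans ν _ _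
    (fun m => Or.inr (toPEquiv_ne_none σ m)) (Or.inr (toPEquiv_symm_ne_none σ))]
  congr 1
  refine diag_ext fun i j => ?_
  rw [trans_eq_some, resDiag_eq_some]
  simp only [toPEquiv_eq_some, resDiag_eq_some]
  constructor
  · rintro ⟨m, rfl, rfl⟩
    exact h m
  · rintro rfl
    exact ⟨σ.symm j, by rw [← h, Equiv.apply_symm_apply], by simp⟩

theorem resHom_comp_resHom (ν : ℂ) {m l k : ℕ} (ι : Fin l ↪ Fin k) (κ : Fin m ↪ Fin l) :
    resHom ν ι ≫ resHom ν κ = resHom ν (κ.trans ι) := by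
  rw [resHom, resHom, resHom, diagHom_comp_eq_trans ν _ _
    (fun m => Or.inl (by rw [resDiag_symm_apply]; simp))
    (Or.inr (fun m => by rw [resDiag_symm_apply]; simp))]
  congr 1
  refine diag_ext fun i j => ?_
  rw [trans_eq_some, resDiag_eq_some]
  simp only [resDiag_eq_some]
  constructor
  · rintro ⟨m, rfl, rfl⟩
    rfl
  · rintro rfl
    exact ⟨_, rfl, rfl⟩

theorem permHom_one (ν : ℂ) (k : ℕ) : permHom ν (1 : Equiv.Perm (Fin k)) = 𝟙 (Delta ν k) := by
  change DeltaHom.of _ = DeltaHom.of _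
  congr 1
  

theorem resHom_refl (ν : ℂ) (k : ℕ) :
    resHom ν (Function.Embedding.refl (Fin k)) = 𝟙 (Delta ν k) := by
  change DeltaHom.of _ = DeltaHom.of _
  congr 1
  refine diag_ext fun i j => ?_
  refine resDiag_eq_some.trans ?_
  change j = i ↔ some i = some j
  rw [Option.some.injEq]
  exact eq_comm

/-- The diagram with the edges `(i, ι(i)')`. -/
noncomputable def resStarHom (ν : ℂ) {l k : ℕ} (ι : Fin l ↪ Fin k) : Delta ν l ⟶ Delta ν k :=
  diagHom ν (resDiag ι).symm

theorem resStarHom_comp_permHom (ν : ℂ) {l k : ℕ} (ι ι' : Fin l ↪ Fin k) (σ : Equiv.Perm (Fin k))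
    (h : ∀ j, σ (ι j) = ι' j) : resStarHom ν ι ≫ permHom ν σ = resStarHom ν ι' := by
  rw [permHom, resStarHom, resStarHom, diagHom_comp_eq_trans ν _ _
    (fun m => Or.inr (toPEquiv_ne_none σ m)) (Or.inr (toPEquiv_symm_ne_none σ))]
  congr 1
  refine diag_ext fun i j => ?_
  rw [trans_eq_some]
  simp only [toPEquiv_eq_some, resDiag_symm_eq_some]
  constructor
  · rintro ⟨m, rfl, rfl⟩
    exact (h i).symm
  · rintro rfl
    exact ⟨_, rfl, h i⟩

theorem permHom_comp_resStarHom (ν : ℂ) {l k : ℕ} (ι ι' : Fin l ↪ Fin k) (σ : Equiv.Perm (Fin l))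
    (h : ∀ j, ι' (σ j) = ι j) : permHom ν σ ≫ resStarHom ν ι' = resStarHom ν ι := by
  rw [permHom, resStarHom, resStarHom, diagHom_comp_eq_trans ν _ _
    (fun m => Or.inl (toPEquiv_symm_ne_none σ m)) (Or.inl (toPEquiv_ne_none σ))]
  congr 1
  refine diag_ext fun i j => ?_
  rw [trans_eq_some]
  simp only [toPEquiv_eq_some, resDiag_symm_eq_some]
  constructor
  · rintro ⟨m, rfl, rfl⟩
    exact (h i).symm
  · rintro rfl
    exact ⟨_, rfl, h i⟩

theorem resStarHom_comp_resStarHom (ν : ℂ) {m l k : ℕ} (κ : Fin m ↪ Fin l) (ι : Fin l ↪ Fin k) :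
    resStarHom ν κ ≫ resStarHom ν ι = resStarHom ν (κ.trans ι) := by
  rw [resStarHom, resStarHom, resStarHom, diagHom_comp_eq_trans ν _ _
    (fun m => Or.inr (by rw [resDiag_symm_apply]; simp))
    (Or.inl (fun m => by rw [resDiag_symm_apply]; simp))]
  congr 1
  refine diag_ext fun i j => ?_
  rw [trans_eq_some]
  simp only [resDiag_symm_eq_some]
  constructor
  · rintro ⟨m, rfl, rfl⟩
    rfl
  · rintro rfl
    exact ⟨_, rfl, rfl⟩

/-- This is where ν enters the relations. The inserted vertex l is the unique middle vertex isolated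
on both sides, and the only gluing is the identity, which has k parts; the coefficient is therefore
ν - k. -/
theorem resStar_comp_res_self (ν : ℂ) (k : ℕ) (l : Fin (k + 1)) :
    resStar ν l ≫ res ν l = (ν - k) • 𝟙 (Delta ν k) := by
  classical
  have htot : ∀ i : Fin k, (resDiag l.succAboveEmb).symm i ≠ none := fun i => by
    rw [resDiag_symm_apply]; simp
  have htr : (resDiag l.succAboveEmb).symm.trans (resDiag l.succAboveEmb) =
      PEquiv.refl (Fin k) := by
    refine diag_ext fun i j => ?_
    rw [trans_eq_some, PEquiv.refl_apply, Option.some.injEq]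
    simp only [resDiag_eq_some, resDiag_symm_eq_some]
    constructor
    · rintro ⟨m, rfl, hm⟩
      exact (l.succAboveEmb.injective hm).symm
    · rintro rfl
      exact ⟨_, rfl, rfl⟩
  have hiff : ∀ m : Fin (k + 1), resDiag l.succAboveEmb m = none ↔ m = l := by
    intro m
    constructor
    · intro hm
      by_contra hne
      obtain ⟨j, hj⟩ := Fin.exists_succAbove_eq hne
      exact resDiag_ne_none ⟨j, hj⟩ hm
    · rintro rfl
      rw [Option.eq_none_iff_forall_ne_some]
      intro j hj
      exact Fin.succAbove_ne _ _ (resDiag_eq_some.1 hj)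
  have hmid : numMiddle (resDiag l.succAboveEmb).symm (resDiag l.succAboveEmb) = 1 := by
    rw [numMiddle, Finset.card_eq_one]
    refine ⟨l, ?_⟩
    ext m
    rw [PEquiv.symm_symm]
    simp [hiff]
  have hparts : numParts (PEquiv.refl (Fin k)) = k := by
    simp [numParts]
  rw [resStar, res, diagHom_comp, Finset.sum_eq_single (PEquiv.refl (Fin k))]
  · rw [coef, if_pos ((isGluing_iff_of_total (Or.inl htot) _).2 htr.symm), hmid, hparts]
    simp
    rfl
  · intro τ _ hne
    rw [coef, if_neg, zero_smul]
    rw [isGluing_iff_of_total (Or.inl htot), htr]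
    exact hne
  · simp

/-- The inserted vertex survives as the isolated lower vertex 0, while the forgotten one was the
upper vertex l. This is the same diagram as forgetting l first, with no new edge allowed, since here
every upper vertex of the first factor is joined. -/
theorem resStar_zero_comp_res_succ (ν : ℂ) {k : ℕ} (l : Fin (k + 1)) :
    resStar ν (0 : Fin (k + 2)) ≫ res ν l.succ =
      diagHom ν ((resDiag l.succAboveEmb).trans (resDiag (Fin.succAboveEmb 0)).symm) := by
  rw [resStar, res, diagHom_comp_eq_trans]
  · congr 1
    refine diag_ext fun i j => ?_
    rw [trans_eq_some, trans_eq_some]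
    simp only [resDiag_eq_some, resDiag_symm_eq_some]
    constructor
    · rintro ⟨m, rfl, hm⟩
      induction j using Fin.cases with
      | zero => exact absurd hm (by simpa using (Fin.succ_ne_zero i).symm)
      | succ j =>
        refine ⟨j, ?_, by simp⟩
        simpa using hm
    · rintro ⟨m, rfl, rfl⟩
      exact ⟨_, rfl, by simp⟩
  · intro m
    induction m using Fin.cases with
    | zero => exact Or.inr (resDiag_ne_none ⟨0, by simp⟩)
    | succ m => exact Or.inl (by rw [PEquiv.symm_symm]; exact resDiag_ne_none ⟨m, by simp⟩)
  · exact Or.inl fun i => by rw [resDiag_symm_apply]; simp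

/-- After forgetting l and inserting 0, the upper vertex l and the lower vertex 0 are the only ones
that may be joined. Leaving them apart gives the first term; joining them gives the cycle that moves
l to 0. The second term is the source of the gl(U) part of the bracket of E_f and F_u. -/
theorem res_comp_resStar_zero (ν : ℂ) {k : ℕ} (l : Fin (k + 1)) :
    res ν l ≫ resStar ν (0 : Fin (k + 1)) =
      resStar ν (0 : Fin (k + 2)) ≫ res ν l.succ + permHom ν l.cycleRange := by
  classical
  rw [resStar_zero_comp_res_succ, res, resStar, permHom, diagHom_comp_of_numMiddle_eq_zero]
  swap
  · exact fun m => Or.inl (by rw [resDiag_symm_apply]; simp)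
  have htr : ∀ i j, ((resDiag l.succAboveEmb).trans (resDiag (Fin.succAboveEmb 0)).symm) i = some j
      ↔ ∃ m : Fin k, l.succAbove m = i ∧ m.succ = j := by
    intro i j
    rw [trans_eq_some]
    simp only [resDiag_eq_some, resDiag_symm_eq_some]
    simp
  have hl : resDiag l.succAboveEmb l = none := by
    rw [Option.eq_none_iff_forall_ne_some]
    intro j hj
    exact Fin.succAbove_ne _ _ (resDiag_eq_some.1 hj)
  have h0 : resDiag (Fin.succAboveEmb (0 : Fin (k + 1))) 0 = none := by
    rw [Option.eq_none_iff_forall_ne_some]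
    intro j hj
    exact Fin.succAbove_ne (0 : Fin (k + 1)) j (resDiag_eq_some.1 hj)
  have hcyc : ∀ m : Fin k, l.cycleRange (l.succAbove m) = m.succ := fun m =>
    Fin.cycleRange_succAbove l m
  rw [← Finset.sum_pair]
  · refine Finset.sum_congr ?_ fun _ _ => rfl
    ext τ
    simp only [Finset.mem_filter, Finset.mem_univ, true_and, Finset.mem_insert,
      Finset.mem_singleton]
    constructor
    · rintro ⟨ha, hb⟩
      -- A gluing is determined by the presence or absence of the one optional edge.
      by_cases h : τ l = some 0
      · right
        refine diag_ext fun i j => ?_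
        rw [toPEquiv_eq_some]
        by_cases hi : i = l
        · subst hi
          rw [h, Fin.cycleRange_self, Option.some.injEq]
        · obtain ⟨m, rfl⟩ := Fin.exists_succAbove_eq hi
          rw [ha _ m.succ ((htr _ _).2 ⟨m, rfl, rfl⟩), hcyc, Option.some.injEq]
      · left
        refine diag_ext fun i j => ⟨fun hij => (hb i j hij).resolve_right ?_, fun hij => ha i j hij⟩
        rintro ⟨h1, h2⟩
        have hi : i = l := by
          by_contra hi
          obtain ⟨m, rfl⟩ := Fin.exists_succAbove_eq hi
          exact resDiag_ne_none ⟨m, rfl⟩ h1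
        have hj : j = 0 := by
          by_contra hj
          obtain ⟨m, rfl⟩ := Fin.exists_succAbove_eq hj
          exact resDiag_ne_none ⟨m, rfl⟩ h2
        subst hi hj
        exact h hij
    · rintro (rfl | rfl)
      · exact ⟨fun _ _ h => h, fun _ _ h => Or.inl h⟩
      · constructor
        · intro i j hij
          obtain ⟨m, rfl, rfl⟩ := (htr i j).1 hij
          rw [toPEquiv_eq_some, hcyc]
        · intro i j hij
          rw [toPEquiv_eq_some] at hij
          by_cases hi : i = l
          · subst hi
            rw [Fin.cycleRange_self] at hij
            subst hij
            exact Or.inr ⟨hl, h0⟩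
          · obtain ⟨m, rfl⟩ := Fin.exists_succAbove_eq hi
            rw [hcyc] at hij
            exact Or.inl ((htr _ _).2 ⟨m, rfl, hij⟩)
  · intro h
    have h1 := (toPEquiv_eq_some l.cycleRange).2 (Fin.cycleRange_self l)
    rw [← h, htr] at h1
    obtain ⟨m, hm, -⟩ := h1
    exact Fin.succAbove_ne _ _ hm

/-! ### Bilinearity of the tensor product -/

section TensBilin

universe v w

variable {C : Type*} [Category C] [Preadditive C] [Linear ℂ C]
  (W : Type u) [AddCommGroup W] [Module ℂ W] [FiniteDimensional ℂ W]
  (W' : Type v) [AddCommGroup W'] [Module ℂ W'] [FiniteDimensional ℂ W'] (X X' : C)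

/-- The morphism `f ⊗ a` as a bilinear expression. -/
noncomputable def tensBilin :
    (W →ₗ[ℂ] W') →ₗ[ℂ] (X ⟶ X') →ₗ[ℂ] (tens W X ⟶ tens W' X') :=
  LinearMap.mk₂ ℂ tensMap
    (fun f g a => by
      apply Mat_.hom_ext
      intro (i : Fin (Module.finrank ℂ W)) (j : Fin (Module.finrank ℂ W'))
      change (Module.finBasis ℂ W').repr ((f + g) (Module.finBasis ℂ W i)) j • a = (Module.finBasis ℂ W').repr (f (Module.finBasis ℂ W i)) j • a + (Module.finBasis ℂ W').repr (g (Module.finBasis ℂ W i)) j • a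
      rw [LinearMap.add_apply, map_add, Finsupp.add_apply, add_smul])
    (fun c f a => by
      apply Mat_.hom_ext
      intro (i : Fin (Module.finrank ℂ W)) (j : Fin (Module.finrank ℂ W'))
      change (Module.finBasis ℂ W').repr ((c • f) (Module.finBasis ℂ W i)) j • a = c • ((Module.finBasis ℂ W').repr (f (Module.finBasis ℂ W i)) j • a)
      rw [LinearMap.smul_apply, map_smul, Finsupp.smul_apply, smul_smul, smul_eq_mul])
    (fun f a b => by
      apply Mat_.hom_ext
      intro i j
      exact smul_add _ a b)
    (fun c f a => by
      apply Mat_.hom_ext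
      intro i j
      exact smul_comm _ c a)

variable {W W' X X'}

theorem tensBilin_apply (f : W →ₗ[ℂ] W') (a : X ⟶ X') : tensBilin W W' X X' f a = tensMap f a := rfl

theorem tensMap_add_left (f g : W →ₗ[ℂ] W') (a : X ⟶ X') :
    tensMap (f + g) a = tensMap f a + tensMap g a :=
  LinearMap.map_add₂ (tensBilin W W' X X') f g a

theorem tensMap_smul_left (c : ℂ) (f : W →ₗ[ℂ] W') (a : X ⟶ X') :
    tensMap (c • f) a = c • tensMap f a :=
  LinearMap.map_smul₂ (tensBilin W W' X X') c f a

theorem tensMap_sum_left {ι : Type*} (s : Finset ι) (f : ι → W →ₗ[ℂ] W') (a : X ⟶ X') :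
    tensMap (∑ i ∈ s, f i) a = ∑ i ∈ s, tensMap (f i) a :=
  LinearMap.map_sum₂ (tensBilin W W' X X') s f a

theorem tensMap_add_right (f : W →ₗ[ℂ] W') (a b : X ⟶ X') :
    tensMap f (a + b) = tensMap f a + tensMap f b :=
  map_add (tensBilin W W' X X' f) a b

theorem tensMap_smul_right (c : ℂ) (f : W →ₗ[ℂ] W') (a : X ⟶ X') :
    tensMap f (c • a) = c • tensMap f a :=
  map_smul (tensBilin W W' X X' f) c a

variable (W X) in
theorem tensMap_id : tensMap (LinearMap.id : W →ₗ[ℂ] W) (𝟙 X) = 𝟙 (tens W X) := by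
  apply Mat_.hom_ext
  intro (i : Fin (Module.finrank ℂ W)) (j : Fin (Module.finrank ℂ W))
  change (Module.finBasis ℂ W).repr (Module.finBasis ℂ W i) j • 𝟙 X = _
  rw [Module.Basis.repr_self, Finsupp.single_apply]
  split_ifs with h
  · subst h
    rw [one_smul]
    exact (Mat_.id_apply_self (tens W X) i).symm
  · rw [zero_smul]
    exact (Mat_.id_apply_of_ne (tens W X) i j h).symm

end TensBilin

/-! ### Extension of permutations -/

section Extend

/-- The permutation `σ` maps `l` to `l'` and restricts to `τ` on the complements. -/
def ExtendsPerm {k : ℕ} (σ : Equiv.Perm (Fin (k + 1))) (l l' : Fin (k + 1))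
    (τ : Equiv.Perm (Fin k)) : Prop :=
  σ l = l' ∧ ∀ i, σ (l.succAbove i) = l'.succAbove (τ i)

/-- Used in two ways: with l = l' to lift a permutation of the other factors to one fixing the slot
l, and with τ = 1 to carry the slot 0 to the slot l. -/
theorem exists_extendsPerm {k : ℕ} (l l' : Fin (k + 1)) (τ : Equiv.Perm (Fin k)) :
    ∃ σ, ExtendsPerm σ l l' τ :=
  ⟨((finSuccEquiv' l).trans (Equiv.optionCongr τ)).trans (finSuccEquiv' l').symm, by
    simp [finSuccEquiv'_at], fun i => by simp [finSuccEquiv'_succAbove]⟩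

theorem exists_restrict_perm {k : ℕ} (σ : Equiv.Perm (Fin (k + 1))) (l : Fin (k + 1)) :
    ∃ τ, ExtendsPerm σ l (σ l) τ := by
  have h : ∀ i, ∃ j, (σ l).succAbove j = σ (l.succAbove i) := fun i =>
    Fin.exists_succAbove_eq fun e => Fin.succAbove_ne l i (σ.injective e)
  choose τ hτ using h
  have hinj : Function.Injective τ := fun i j hij =>
    Fin.succAbove_right_injective (p := l) (σ.injective (by rw [← hτ, ← hτ, hij]))
  exact ⟨Equiv.ofBijective τ (Finite.injective_iff_bijective.1 hinj), rfl, fun i => (hτ i).symm⟩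

theorem ExtendsPerm.symm_apply {k : ℕ} {σ : Equiv.Perm (Fin (k + 1))} {l l' : Fin (k + 1)}
    {τ : Equiv.Perm (Fin k)} (h : ExtendsPerm σ l l' τ) : σ.symm l' = l := by
  rw [Equiv.symm_apply_eq, h.1]

theorem ExtendsPerm.symm_succAbove {k : ℕ} {σ : Equiv.Perm (Fin (k + 1))} {l l' : Fin (k + 1)}
    {τ : Equiv.Perm (Fin k)} (h : ExtendsPerm σ l l' τ) (i : Fin k) :
    σ.symm (l'.succAbove i) = l.succAbove (τ.symm i) := by
  rw [Equiv.symm_apply_eq, h.2, Equiv.apply_symm_apply]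

end Extend

/-! ### Operators on tensor powers -/

section TensorOperators

variable {U : Type u} [AddCommGroup U] [Module ℂ U]

theorem reindex_tprod_apply {ι κ : Type} (e : ι ≃ κ) (x : ι → U) :
    PiTensorProduct.reindex ℂ (fun _ : ι => U) e (PiTensorProduct.tprod ℂ x) =
      PiTensorProduct.tprod ℂ fun i => x (e.symm i) :=
  PiTensorProduct.reindex_tprod e x


theorem actAt_tprod {k : ℕ} (i : Fin k) (A : U →ₗ[ℂ] U) (x : Fin k → U) :
    actAt i A (PiTensorProduct.tprod ℂ x) =
      PiTensorProduct.tprod ℂ (Function.update x i (A (x i))) := by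
  rw [actAt, PiTensorProduct.map_tprod]
  congr 1
  funext j
  by_cases h : j = i
  · subst h
    simp
  · simp [h]

theorem reindex_comp_actAt {k : ℕ} (σ : Equiv.Perm (Fin k)) (i : Fin k) (A : U →ₗ[ℂ] U) :
    (PiTensorProduct.reindex ℂ (fun _ : Fin k => U) σ).toLinearMap ∘ₗ actAt i A =
      actAt (σ i) A ∘ₗ (PiTensorProduct.reindex ℂ (fun _ : Fin k => U) σ).toLinearMap := by
  ext x
  simp only [LinearMap.compMultilinearMap_apply, LinearMap.comp_apply, LinearEquiv.coe_coe,
    reindex_tprod_apply, actAt_tprod]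
  congr 1
  funext j
  by_cases h : j = σ i
  · subst h
    rw [Equiv.symm_apply_apply, Function.update_self, Function.update_self]
  · rw [Function.update_of_ne h, Function.update_of_ne (fun e => h ((Equiv.symm_apply_eq _).1 e))]

theorem reindex_comp_diagAct {k : ℕ} (σ : Equiv.Perm (Fin k)) (A : U →ₗ[ℂ] U) :
    (PiTensorProduct.reindex ℂ (fun _ : Fin k => U) σ).toLinearMap ∘ₗ diagAct k A =
      diagAct k A ∘ₗ (PiTensorProduct.reindex ℂ (fun _ : Fin k => U) σ).toLinearMap := by
  ext x
  have h := fun i => LinearMap.congr_fun (reindex_comp_actAt σ i A) (PiTensorProduct.tprod ℂ x)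
  simp only [LinearMap.compMultilinearMap_apply, LinearMap.comp_apply, diagAct, LinearMap.sum_apply,
    map_sum] at h ⊢
  exact Fintype.sum_equiv σ _ _ h

theorem actAt_add {k : ℕ} (i : Fin k) (A B : U →ₗ[ℂ] U) :
    actAt i (A + B) = actAt i A + actAt i B := by
  ext x
  simp [actAt_tprod]

theorem actAt_smul {k : ℕ} (i : Fin k) (c : ℂ) (A : U →ₗ[ℂ] U) :
    actAt i (c • A) = c • actAt i A := by
  ext x
  simp [actAt_tprod]

theorem actAt_comp_self {k : ℕ} (i : Fin k) (A B : U →ₗ[ℂ] U) :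
    actAt i A ∘ₗ actAt i B = actAt i (A ∘ₗ B) := by
  ext x
  simp [actAt_tprod]

theorem actAt_id {k : ℕ} (i : Fin k) :
    actAt i (LinearMap.id : U →ₗ[ℂ] U) = LinearMap.id := by
  ext x
  simp [actAt_tprod]

theorem actAt_comm {k : ℕ} {i j : Fin k} (h : i ≠ j) (A B : U →ₗ[ℂ] U) :
    actAt i A ∘ₗ actAt j B = actAt j B ∘ₗ actAt i A := by
  ext x
  simp [actAt_tprod, h, h.symm, Function.update_comm h]

variable (U) in
/-- The operators `A^{(i)}` as a homomorphism of algebras. -/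
noncomputable def actAtHom {k : ℕ} (i : Fin k) :
    Module.End ℂ U →ₐ[ℂ] Module.End ℂ (TPow U k) :=
  AlgHom.ofLinearMap { toFun := actAt i, map_add' := actAt_add i, map_smul' := actAt_smul i }
    (actAt_id i) (fun A B => (actAt_comp_self i A B).symm)

variable (U) in
/-- The diagonal action of `gl(U)` on a tensor power as a homomorphism of Lie algebras. -/
noncomputable def diagActHom (k : ℕ) :
    Module.End ℂ U →ₗ⁅ℂ⁆ Module.End ℂ (TPow U k) where
  toFun := diagAct k
  map_add' A B := by
    simp only [diagAct, actAt_add, Finset.sum_add_distrib]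
  map_smul' c A := by
    simp only [diagAct, actAt_smul, Finset.smul_sum, RingHom.id_apply]
  map_lie' {A B} := by
    -- Operators at different positions commute, so only the terms with equal positions survive in
    -- the bracket of the two sums.
    have h : ∀ (i : Fin k) (A B : Module.End ℂ U), ⁅(actAt i A : Module.End ℂ (TPow U k)), diagAct k B⁆ =
        actAt i ⁅A, B⁆ := by
      intro i A B
      rw [diagAct, lie_sum, Finset.sum_eq_single i]
      · exact ((actAtHom U i).toLieHom.map_lie A B).symm
      · intro j _ hj
        exact sub_eq_zero.2 (actAt_comm hj.symm A B)
      · simp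
    change diagAct k ⁅A, B⁆ = ⁅(diagAct k A : Module.End ℂ (TPow U k)), diagAct k B⁆
    conv_rhs => rw [diagAct, sum_lie]
    rw [Finset.sum_congr rfl fun i _ => h i A B]
    rfl

theorem insertAt_comp_reindex {k : ℕ} {σ : Equiv.Perm (Fin (k + 1))} {l l' : Fin (k + 1)}
    {τ : Equiv.Perm (Fin k)} (h : ExtendsPerm σ l l' τ) (u : U) :
    insertAt l' u ∘ₗ (PiTensorProduct.reindex ℂ (fun _ : Fin k => U) τ).toLinearMap =
      (PiTensorProduct.reindex ℂ (fun _ : Fin (k + 1) => U) σ).toLinearMap ∘ₗ insertAt l u := by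
  ext x
  simp only [LinearMap.compMultilinearMap_apply, LinearMap.comp_apply, LinearEquiv.coe_coe,
    reindex_tprod_apply, insertAt_tprod]
  congr 1
  funext i
  by_cases hi : i = l'
  · subst hi
    rw [h.symm_apply]
    simp
  · obtain ⟨j, rfl⟩ := Fin.exists_succAbove_eq hi
    rw [h.symm_succAbove]
    simp

theorem contractAt_comp_reindex {k : ℕ} {σ : Equiv.Perm (Fin (k + 1))} {l l' : Fin (k + 1)}
    {τ : Equiv.Perm (Fin k)} (h : ExtendsPerm σ l l' τ) (f : U →ₗ[ℂ] ℂ) :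
    contractAt l' f ∘ₗ (PiTensorProduct.reindex ℂ (fun _ : Fin (k + 1) => U) σ).toLinearMap =
      (PiTensorProduct.reindex ℂ (fun _ : Fin k => U) τ).toLinearMap ∘ₗ contractAt l f := by
  ext x
  simp only [LinearMap.compMultilinearMap_apply, LinearMap.comp_apply, LinearEquiv.coe_coe,
    reindex_tprod_apply, contractAt_tprod, map_smul]
  rw [h.symm_apply]
  congr 2
  funext i
  rw [h.symm_succAbove]

end TensorOperators

/-! ### Morphisms between the objects of invariants -/

section PieceMaps

universe v w

variable (ν : ℂ) {U : Type u} [AddCommGroup U] [Module ℂ U] [FiniteDimensional ℂ U]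
  {U' : Type v} [AddCommGroup U'] [Module ℂ U'] [FiniteDimensional ℂ U']
  {U'' : Type w} [AddCommGroup U''] [Module ℂ U''] [FiniteDimensional ℂ U'']

theorem symProj_comp_of_forall {k : ℕ} {Z : Mat_ (DeltaCat ν)} (m : tensObj ν U k ⟶ Z)
    (h : ∀ σ, permAct ν U k σ ≫ m = m) : symProj ν U k ≫ m = m := by
  have hk : (k.factorial : ℂ) ≠ 0 := Nat.cast_ne_zero.2 k.factorial_ne_zero
  rw [symProj, Linear.smul_comp, Preadditive.sum_comp, Finset.sum_congr rfl fun σ _ => h σ,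
    Finset.sum_const, Finset.card_univ, Fintype.card_perm, Fintype.card_fin,
    ← Nat.cast_smul_eq_nsmul ℂ, smul_smul, inv_mul_cancel₀ hk, one_smul]

theorem comp_symProj_of_forall {k : ℕ} {Z : Mat_ (DeltaCat ν)} (m : Z ⟶ tensObj ν U k)
    (h : ∀ σ, m ≫ permAct ν U k σ = m) : m ≫ symProj ν U k = m := by
  have hk : (k.factorial : ℂ) ≠ 0 := Nat.cast_ne_zero.2 k.factorial_ne_zero
  rw [symProj, Linear.comp_smul, Preadditive.comp_sum, Finset.sum_congr rfl fun σ _ => h σ,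
    Finset.sum_const, Finset.card_univ, Fintype.card_perm, Fintype.card_fin,
    ← Nat.cast_smul_eq_nsmul ℂ, smul_smul, inv_mul_cancel₀ hk, one_smul]

theorem permAct_comp_symProj (k : ℕ) (σ : Equiv.Perm (Fin k)) :
    permAct ν U k σ ≫ symProj ν U k = symProj ν U k := by
  rw [symProj, Linear.comp_smul, Preadditive.comp_sum]
  simp only [permAct_comp]
  congr 1
  exact Fintype.sum_equiv (Equiv.mulRight σ) _ _ fun τ => rfl

theorem symProj_comp_permAct (k : ℕ) (σ : Equiv.Perm (Fin k)) :
    symProj ν U k ≫ permAct ν U k σ = symProj ν U k := by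
  rw [symProj, Linear.smul_comp, Preadditive.sum_comp]
  simp only [permAct_comp]
  congr 1
  exact Fintype.sum_equiv (Equiv.mulLeft σ) _ _ fun τ => rfl

/-- The morphism of invariants as a linear function of the given morphism. -/
noncomputable def pieceMapLin (k l : ℕ) :
    (tensObj ν U k ⟶ tensObj ν U' l) →ₗ[ℂ] (piece ν U k ⟶ piece ν U' l) where
  toFun := pieceMap ν
  map_add' m m' := by
    apply Idempotents.Karoubi.hom_ext
    change symProj ν U k ≫ (m + m') ≫ symProj ν U' l = symProj ν U k ≫ m ≫ symProj ν U' l +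
      symProj ν U k ≫ m' ≫ symProj ν U' l
    rw [Preadditive.add_comp, Preadditive.comp_add]
  map_smul' c m := by
    apply Idempotents.Karoubi.hom_ext
    change symProj ν U k ≫ (c • m) ≫ symProj ν U' l = c • symProj ν U k ≫ m ≫ symProj ν U' l
    rw [Linear.smul_comp, Linear.comp_smul]

variable {ν}

theorem pieceMap_add {k l : ℕ} (m m' : tensObj ν U k ⟶ tensObj ν U' l) :
    pieceMap ν (m + m') = pieceMap ν m + pieceMap ν m' := map_add (pieceMapLin ν k l) m m'

theorem pieceMap_sub {k l : ℕ} (m m' : tensObj ν U k ⟶ tensObj ν U' l) :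
    pieceMap ν (m - m') = pieceMap ν m - pieceMap ν m' := map_sub (pieceMapLin ν k l) m m'

theorem pieceMap_smul {k l : ℕ} (c : ℂ) (m : tensObj ν U k ⟶ tensObj ν U' l) :
    pieceMap ν (c • m) = c • pieceMap ν m := map_smul (pieceMapLin ν k l) c m

theorem pieceMap_sum {k l : ℕ} {ι : Type*} (s : Finset ι)
    (m : ι → (tensObj ν U k ⟶ tensObj ν U' l)) :
    pieceMap ν (∑ i ∈ s, m i) = ∑ i ∈ s, pieceMap ν (m i) := map_sum (pieceMapLin ν k l) m s

theorem pieceMap_id (k : ℕ) : pieceMap ν (𝟙 (tensObj ν U k)) = 𝟙 (piece ν U k) := by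
  apply Idempotents.Karoubi.hom_ext
  change symProj ν U k ≫ 𝟙 _ ≫ symProj ν U k = symProj ν U k
  rw [Category.id_comp, symProj_idem]

/-- The composite of two morphisms of invariants contains the projection in the middle. It is
absorbed on the left when `m` already carries invariants to invariants. -/
theorem pieceMap_comp_of_left {k l n : ℕ} (m : tensObj ν U k ⟶ tensObj ν U' l)
    (m' : tensObj ν U' l ⟶ tensObj ν U'' n)
    (h : (symProj ν U k ≫ m) ≫ symProj ν U' l = symProj ν U k ≫ m) :
    pieceMap ν m ≫ pieceMap ν m' = pieceMap ν (m ≫ m') := by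
  apply Idempotents.Karoubi.hom_ext
  change (symProj ν U k ≫ m ≫ symProj ν U' l) ≫ symProj ν U' l ≫ m' ≫ symProj ν U'' n =
    symProj ν U k ≫ (m ≫ m') ≫ symProj ν U'' n
  rw [← Category.assoc (symProj ν U k) m, h, ← Category.assoc _ (symProj ν U' l), h]
  simp only [Category.assoc]

/-- The dual criterion: after projection of its target, `m'` does not distinguish an element from
its symmetrization, so the middle projection is absorbed on the right. -/
theorem pieceMap_comp_of_right {k l n : ℕ} (m : tensObj ν U k ⟶ tensObj ν U' l)
    (m' : tensObj ν U' l ⟶ tensObj ν U'' n)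
    (h : symProj ν U' l ≫ m' ≫ symProj ν U'' n = m' ≫ symProj ν U'' n) :
    pieceMap ν m ≫ pieceMap ν m' = pieceMap ν (m ≫ m') := by
  apply Idempotents.Karoubi.hom_ext
  change (symProj ν U k ≫ m ≫ symProj ν U' l) ≫ symProj ν U' l ≫ m' ≫ symProj ν U'' n =
    symProj ν U k ≫ (m ≫ m') ≫ symProj ν U'' n
  rw [h]
  simp only [Category.assoc]
  rw [h]

theorem pieceMap_permAct_comp {k l : ℕ} (σ : Equiv.Perm (Fin k))
    (m : tensObj ν U k ⟶ tensObj ν U' l) :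
    pieceMap ν (permAct ν U k σ ≫ m) = pieceMap ν m := by
  apply Idempotents.Karoubi.hom_ext
  change symProj ν U k ≫ (permAct ν U k σ ≫ m) ≫ symProj ν U' l = _
  rw [Category.assoc, ← Category.assoc, symProj_comp_permAct]
  rfl

theorem pieceMap_comp_permAct {k l : ℕ} (m : tensObj ν U k ⟶ tensObj ν U' l)
    (σ : Equiv.Perm (Fin l)) :
    pieceMap ν (m ≫ permAct ν U' l σ) = pieceMap ν m := by
  apply Idempotents.Karoubi.hom_ext
  change symProj ν U k ≫ (m ≫ permAct ν U' l σ) ≫ symProj ν U' l = _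
  rw [Category.assoc, permAct_comp_symProj]
  rfl

end PieceMaps

/-! ### Insertion and contraction -/

section Elementary

variable (ν : ℂ) {U : Type u} [AddCommGroup U] [Module ℂ U] [FiniteDimensional ℂ U]

/-- `u^{(l)} ⊗ res_l^*`. -/
noncomputable def insertHom {k : ℕ} (l : Fin (k + 1)) (u : U) :
    tensObj ν U k ⟶ tensObj ν U (k + 1) :=
  tensMap (insertAt l u) (resStar ν l)

/-- `f^{(l)} ⊗ res_l`. -/
noncomputable def contractHom {k : ℕ} (l : Fin (k + 1)) (f : U →ₗ[ℂ] ℂ) :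
    tensObj ν U (k + 1) ⟶ tensObj ν U k :=
  tensMap (contractAt l f) (res ν l)

theorem permAct_comp_insertHom {k : ℕ} {σ : Equiv.Perm (Fin (k + 1))} {l l' : Fin (k + 1)}
    {τ : Equiv.Perm (Fin k)} (h : ExtendsPerm σ l l' τ) (u : U) :
    permAct ν U k τ ≫ insertHom ν l' u = insertHom ν l u ≫ permAct ν U (k + 1) σ := by
  rw [permAct, permAct, insertHom, insertHom, tensMap_comp, tensMap_comp, insertAt_comp_reindex h]
  congr 1
  have h1 := permHom_comp_resStarHom ν (τ.toEmbedding.trans l'.succAboveEmb) l'.succAboveEmb τ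
    fun j => rfl
  have h2 := resStarHom_comp_permHom ν l.succAboveEmb (τ.toEmbedding.trans l'.succAboveEmb) σ
    fun j => h.2 j
  exact h1.trans h2.symm

theorem permAct_comp_contractHom {k : ℕ} {σ : Equiv.Perm (Fin (k + 1))} {l l' : Fin (k + 1)}
    {τ : Equiv.Perm (Fin k)} (h : ExtendsPerm σ l l' τ) (f : U →ₗ[ℂ] ℂ) :
    permAct ν U (k + 1) σ ≫ contractHom ν l' f = contractHom ν l f ≫ permAct ν U k τ := by
  rw [permAct, permAct, contractHom, contractHom, tensMap_comp, tensMap_comp,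
    contractAt_comp_reindex h]
  congr 1
  have h1 := permHom_comp_resHom ν σ (τ.symm.toEmbedding.trans l.succAboveEmb) l'.succAboveEmb
    fun j => (h.2 _).trans (congrArg l'.succAbove (τ.apply_symm_apply j))
  have h2 := resHom_comp_permHom ν l.succAboveEmb (τ.symm.toEmbedding.trans l.succAboveEmb) τ
    fun j => congrArg l.succAbove (τ.symm_apply_apply j)
  exact h1.trans h2.symm

/-- Every permutation τ of the remaining factors lifts to a permutation fixing l, under which the
source is invariant. So a single contraction of an invariant is again invariant. -/
theorem symProj_comp_contractHom_comp_symProj {k : ℕ} (l : Fin (k + 1)) (f : U →ₗ[ℂ] ℂ) :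
    (symProj ν U (k + 1) ≫ contractHom ν l f) ≫ symProj ν U k =
      symProj ν U (k + 1) ≫ contractHom ν l f := by
  refine comp_symProj_of_forall ν _ fun τ => ?_
  obtain ⟨σ, h⟩ := exists_extendsPerm l l τ
  rw [Category.assoc, ← permAct_comp_contractHom ν h, ← Category.assoc, symProj_comp_permAct]

/-- Dually, a permutation of the old factors extends to one fixing the new slot, and this one
disappears in the target projection. The source need not be symmetrized first. -/
theorem symProj_comp_insertHom_comp_symProj {k : ℕ} (l : Fin (k + 1)) (u : U) :
    symProj ν U k ≫ insertHom ν l u ≫ symProj ν U (k + 1) =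
      insertHom ν l u ≫ symProj ν U (k + 1) := by
  refine symProj_comp_of_forall ν _ fun τ => ?_
  obtain ⟨σ, h⟩ := exists_extendsPerm l l τ
  rw [← Category.assoc, permAct_comp_insertHom ν h, Category.assoc, permAct_comp_symProj]

/-- A permutation of the source only permutes the slots being contracted, so for the full sum the
source need not be symmetrized. This allows E_f to be composed with an insertion in one fixed slot,
whose result is not symmetric. -/
theorem symProj_comp_sum_contractHom {k : ℕ} (f : U →ₗ[ℂ] ℂ) :
    symProj ν U (k + 1) ≫ (∑ l : Fin (k + 1), contractHom ν l f) ≫ symProj ν U k =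
      (∑ l : Fin (k + 1), contractHom ν l f) ≫ symProj ν U k := by
  refine symProj_comp_of_forall ν _ fun σ => ?_
  choose τ hτ using exists_restrict_perm σ
  rw [← Category.assoc, Preadditive.comp_sum, ← Fintype.sum_equiv σ
    (fun l => contractHom ν l f ≫ permAct ν U k (τ l)) _
    fun l => (permAct_comp_contractHom ν (hτ l) f).symm, Preadditive.sum_comp,
    Preadditive.sum_comp]
  refine Finset.sum_congr rfl fun l _ => ?_
  rw [Category.assoc, permAct_comp_symProj]

variable {ν}

theorem pieceMap_contractHom {k : ℕ} (l : Fin (k + 1)) (f : U →ₗ[ℂ] ℂ) :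
    pieceMap ν (contractHom ν l f) = pieceMap ν (contractHom ν 0 f) := by
  obtain ⟨σ, h⟩ := exists_extendsPerm 0 l (1 : Equiv.Perm (Fin k))
  rw [← pieceMap_permAct_comp σ, permAct_comp_contractHom ν h, pieceMap_comp_permAct]

theorem pieceMap_insertHom {k : ℕ} (l : Fin (k + 1)) (u : U) :
    pieceMap ν (insertHom ν l u) = pieceMap ν (insertHom ν 0 u) := by
  obtain ⟨σ, h⟩ := exists_extendsPerm 0 l (1 : Equiv.Perm (Fin k))
  rw [← pieceMap_permAct_comp 1, permAct_comp_insertHom ν h, pieceMap_comp_permAct]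

/-- The factor 1/(k+1) makes F_u the average of the insertions. On invariants they all coincide, so
a single insertion at 0 represents F_u. -/
theorem opF_eq (k : ℕ) (u : U) : opF ν k u = pieceMap ν (insertHom ν 0 u) := by
  change pieceMap ν ((1 / ((k : ℂ) + 1)) • ∑ l : Fin (k + 1), insertHom ν l u) = _
  have hk : (k : ℂ) + 1 ≠ 0 := Nat.cast_add_one_ne_zero k
  rw [pieceMap_smul, pieceMap_sum, Finset.sum_congr rfl fun l _ => pieceMap_insertHom l u,
    Finset.sum_const, Finset.card_univ, Fintype.card_fin, ← Nat.cast_smul_eq_nsmul ℂ, smul_smul,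
    Nat.cast_add, Nat.cast_one, one_div, inv_mul_cancel₀ hk, one_smul]

theorem opE_eq_sum (k : ℕ) (f : U →ₗ[ℂ] ℂ) :
    opE ν k f = pieceMap ν (∑ l : Fin (k + 1), contractHom ν l f) := rfl

/-- Unlike F_u, the operator E_f is a sum without normalization. The resulting factor k+1 produces
the falling factorials in the powers of E_f. -/
theorem opE_eq (k : ℕ) (f : U →ₗ[ℂ] ℂ) :
    opE ν k f = ((k : ℂ) + 1) • pieceMap ν (contractHom ν 0 f) := by
  rw [opE_eq_sum, pieceMap_sum, Finset.sum_congr rfl fun l _ => pieceMap_contractHom l f,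
    Finset.sum_const, Finset.card_univ, Fintype.card_fin, ← Nat.cast_smul_eq_nsmul ℂ,
    Nat.cast_add, Nat.cast_one]

theorem opA_eq (k : ℕ) (A : U →ₗ[ℂ] U) :
    opA ν k A = pieceMap ν (tensMap (diagAct k A) (𝟙 (Delta ν k))) := by
  rw [opA, diagAct, tensMap_sum_left]

theorem symProj_comp_tensMap_id {U' : Type*} [AddCommGroup U'] [Module ℂ U']
    [FiniteDimensional ℂ U'] {k : ℕ} (D : TPow U k →ₗ[ℂ] TPow U' k)
    (h : ∀ σ : Equiv.Perm (Fin k),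
      (PiTensorProduct.reindex ℂ (fun _ : Fin k => U') σ).toLinearMap ∘ₗ D =
        D ∘ₗ (PiTensorProduct.reindex ℂ (fun _ : Fin k => U) σ).toLinearMap) :
    symProj ν U k ≫ tensMap D (𝟙 (Delta ν k)) = tensMap D (𝟙 (Delta ν k)) ≫ symProj ν U' k := by
  rw [symProj, symProj, Linear.smul_comp, Linear.comp_smul, Preadditive.sum_comp,
    Preadditive.comp_sum]
  congr 1
  refine Finset.sum_congr rfl fun σ _ => ?_
  rw [permAct, permAct, tensMap_comp, tensMap_comp, h, Category.id_comp, Category.comp_id]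

theorem pieceMap_comp_tensMap {U' U'' : Type*} [AddCommGroup U'] [Module ℂ U']
    [FiniteDimensional ℂ U'] [AddCommGroup U''] [Module ℂ U'']
    [FiniteDimensional ℂ U''] {k l : ℕ} (m : tensObj ν U'' l ⟶ tensObj ν U k)
    (D : TPow U k →ₗ[ℂ] TPow U' k)
    (h : ∀ σ : Equiv.Perm (Fin k),
      (PiTensorProduct.reindex ℂ (fun _ : Fin k => U') σ).toLinearMap ∘ₗ D =
        D ∘ₗ (PiTensorProduct.reindex ℂ (fun _ : Fin k => U) σ).toLinearMap) :
    pieceMap ν m ≫ pieceMap ν (tensMap D (𝟙 (Delta ν k))) =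
      pieceMap ν (m ≫ tensMap D (𝟙 (Delta ν k))) := by
  refine pieceMap_comp_of_right _ _ ?_
  rw [← Category.assoc, symProj_comp_tensMap_id D h, Category.assoc, symProj_idem]

theorem tensMap_comp_pieceMap {U' U'' : Type*} [AddCommGroup U'] [Module ℂ U']
    [FiniteDimensional ℂ U'] [AddCommGroup U''] [Module ℂ U'']
    [FiniteDimensional ℂ U''] {k l : ℕ} (m : tensObj ν U' k ⟶ tensObj ν U'' l)
    (D : TPow U k →ₗ[ℂ] TPow U' k)
    (h : ∀ σ : Equiv.Perm (Fin k),
      (PiTensorProduct.reindex ℂ (fun _ : Fin k => U') σ).toLinearMap ∘ₗ D =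
        D ∘ₗ (PiTensorProduct.reindex ℂ (fun _ : Fin k => U) σ).toLinearMap) :
    pieceMap ν (tensMap D (𝟙 (Delta ν k))) ≫ pieceMap ν m =
      pieceMap ν (tensMap D (𝟙 (Delta ν k)) ≫ m) := by
  refine pieceMap_comp_of_left _ _ ?_
  rw [symProj_comp_tensMap_id D h, Category.assoc, symProj_idem]

end Elementary

/-! ### The relations between the operators on the summands -/

/-! ### Insertion, contraction and the diagonal action on tensor powers -/

section TensorRelations

variable {U : Type u} [AddCommGroup U] [Module ℂ U]

theorem insertAt_zero_tprod {k : ℕ} (u : U) (x : Fin k → U) :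
    insertAt 0 u (PiTensorProduct.tprod ℂ x) =
      PiTensorProduct.tprod ℂ (Fin.cons u x : Fin (k + 1) → U) := by
  rw [insertAt_tprod, Fin.insertNth_zero']

theorem contractAt_zero_tprod {k : ℕ} (f : U →ₗ[ℂ] ℂ) (x : Fin (k + 1) → U) :
    contractAt 0 f (PiTensorProduct.tprod ℂ x) =
      f (x 0) • PiTensorProduct.tprod ℂ (fun i : Fin k => x i.succ) := by
  rw [contractAt_tprod]
  rfl

theorem insertAt_comp_insertAt {k : ℕ} (u v : U) :
    (PiTensorProduct.reindex ℂ (fun _ : Fin (k + 2) => U) (Equiv.swap 0 1)).toLinearMap ∘ₗ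
      insertAt 0 v ∘ₗ insertAt 0 u = insertAt (0 : Fin (k + 2)) u ∘ₗ insertAt 0 v := by
  ext x
  simp only [LinearMap.compMultilinearMap_apply, LinearMap.comp_apply, LinearEquiv.coe_coe,
    reindex_tprod_apply, insertAt_zero_tprod]
  congr 1
  funext i
  rw [Equiv.symm_swap]
  induction i using Fin.cases with
  | zero => rw [Equiv.swap_apply_left]; rfl
  | succ i =>
    induction i using Fin.cases with
    | zero =>
      change _ = v
      rw [show (Fin.succ 0 : Fin (k + 2)) = 1 from rfl, Equiv.swap_apply_right]
      rfl
    | succ i =>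
      have h : i.succ.succ ≠ (1 : Fin (k + 2)) := fun e =>
        Fin.succ_ne_zero i (Fin.succ_injective _ (e : i.succ.succ = Fin.succ 0))
      rw [Equiv.swap_apply_of_ne_of_ne (Fin.succ_ne_zero _) h]
      rfl

theorem contractAt_comp_contractAt {k : ℕ} (f g : U →ₗ[ℂ] ℂ) :
    contractAt 0 g ∘ₗ contractAt 0 f ∘ₗ
      (PiTensorProduct.reindex ℂ (fun _ : Fin (k + 2) => U) (Equiv.swap 0 1)).toLinearMap =
    contractAt 0 f ∘ₗ contractAt 0 g := by
  ext x
  simp only [LinearMap.compMultilinearMap_apply, LinearMap.comp_apply, LinearEquiv.coe_coe,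
    reindex_tprod_apply, contractAt_zero_tprod, map_smul, smul_smul, Equiv.symm_swap]
  rw [Equiv.swap_apply_left, show (Fin.succ 0 : Fin (k + 2)) = 1 from rfl,
    Equiv.swap_apply_right, mul_comm]
  congr 2

theorem diagAct_comp_insertAt {k : ℕ} (A : U →ₗ[ℂ] U) (u : U) :
    diagAct (k + 1) A ∘ₗ insertAt 0 u = insertAt 0 u ∘ₗ diagAct k A + insertAt 0 (A u) := by
  ext x
  simp only [LinearMap.compMultilinearMap_apply, LinearMap.comp_apply, LinearMap.add_apply,
    diagAct, LinearMap.sum_apply, map_sum, insertAt_zero_tprod, actAt_tprod, Fin.sum_univ_succ,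
    Fin.cons_zero, Fin.cons_succ, Fin.update_cons_zero, ← Fin.cons_update]
  exact add_comm _ _

theorem contractAt_comp_diagAct {k : ℕ} (A : U →ₗ[ℂ] U) (f : U →ₗ[ℂ] ℂ) :
    contractAt 0 f ∘ₗ diagAct (k + 1) A =
      diagAct k A ∘ₗ contractAt 0 f + contractAt 0 (f ∘ₗ A) := by
  ext x
  simp only [LinearMap.compMultilinearMap_apply, LinearMap.comp_apply, LinearMap.add_apply,
    diagAct, LinearMap.sum_apply, map_add, map_sum, contractAt_zero_tprod, actAt_tprod,
    Fin.sum_univ_succ, map_smul, Function.update_self]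
  rw [add_comm, Finset.smul_sum]
  have h0 : ∀ i : Fin k, Function.update x 0 (A (x 0)) i.succ = x i.succ := fun i =>
    Function.update_of_ne (Fin.succ_ne_zero i) _ _
  simp only [h0]
  congr 1
  refine Finset.sum_congr rfl fun i _ => ?_
  rw [Function.update_of_ne (Fin.succ_ne_zero i).symm]
  congr 2
  funext j
  by_cases h : j = i
  · subst h
    simp
  · rw [Function.update_of_ne h, Function.update_of_ne (fun e => h (Fin.succ_injective _ e))]

theorem contractAt_zero_comp_insertAt {k : ℕ} (u : U) (f : U →ₗ[ℂ] ℂ) :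
    contractAt 0 f ∘ₗ insertAt (0 : Fin (k + 1)) u = f u • LinearMap.id := by
  ext x
  simp only [LinearMap.compMultilinearMap_apply, LinearMap.comp_apply, LinearMap.smul_apply,
    insertAt_zero_tprod, contractAt_zero_tprod, Fin.cons_zero, Fin.cons_succ, LinearMap.id_apply]

theorem contractAt_succ_comp_insertAt {k : ℕ} (l : Fin (k + 1)) (u : U) (f : U →ₗ[ℂ] ℂ) :
    contractAt l.succ f ∘ₗ insertAt (0 : Fin (k + 2)) u = insertAt 0 u ∘ₗ contractAt l f := by
  ext x
  simp only [LinearMap.compMultilinearMap_apply, LinearMap.comp_apply, map_smul,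
    insertAt_zero_tprod, contractAt_tprod, Fin.cons_succ]
  congr 2
  funext i
  induction i using Fin.cases with
  | zero => simp
  | succ i => simp

/-- Replacing the l-th factor x by f(x)u in place, and then moving it to the front, has the same
effect as contracting it and inserting u at the front. The cycle is the permutation that appears in
`res_comp_resStar_zero`. -/
theorem insertAt_comp_contractAt {k : ℕ} (l : Fin (k + 1)) (u : U) (f : U →ₗ[ℂ] ℂ) :
    insertAt 0 u ∘ₗ contractAt l f =
      (PiTensorProduct.reindex ℂ (fun _ : Fin (k + 1) => U) l.cycleRange).toLinearMap ∘ₗ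
        actAt l (f.smulRight u) := by
  ext x
  simp only [LinearMap.compMultilinearMap_apply, LinearMap.comp_apply, LinearEquiv.coe_coe,
    contractAt_tprod, map_smul, insertAt_zero_tprod, actAt_tprod, LinearMap.smulRight_apply]
  rw [MultilinearMap.map_update_smul, map_smul, reindex_tprod_apply]
  congr 2
  funext i
  induction i using Fin.cases with
  | zero =>
    rw [show l.cycleRange.symm 0 = l by rw [Equiv.symm_apply_eq, Fin.cycleRange_self]]
    simp
  | succ i =>
    rw [show l.cycleRange.symm i.succ = l.succAbove i by
      rw [Equiv.symm_apply_eq, Fin.cycleRange_succAbove]]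
    simp

theorem diagAct_id (k : ℕ) : diagAct k (LinearMap.id : U →ₗ[ℂ] U) = (k : ℂ) • LinearMap.id := by
  rw [diagAct, Finset.sum_congr rfl fun i _ => actAt_id i, Finset.sum_const, Finset.card_univ,
    Fintype.card_fin, ← Nat.cast_smul_eq_nsmul ℂ]

theorem insertAt_add {k : ℕ} (l : Fin (k + 1)) (u v : U) :
    insertAt l (u + v) = insertAt l u + insertAt l v := by
  ext x
  simp [insertAt]

theorem insertAt_smul {k : ℕ} (l : Fin (k + 1)) (c : ℂ) (u : U) :
    insertAt l (c • u) = c • insertAt l u := by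
  ext x
  simp [insertAt]

theorem contractAt_add {k : ℕ} (l : Fin (k + 1)) (f g : U →ₗ[ℂ] ℂ) :
    contractAt l (f + g) = contractAt l f + contractAt l g := by
  ext x
  simp [contractAt_tprod, add_smul]

theorem contractAt_smul {k : ℕ} (l : Fin (k + 1)) (c : ℂ) (f : U →ₗ[ℂ] ℂ) :
    contractAt l (c • f) = c • contractAt l f := by
  ext x
  simp [contractAt_tprod, mul_smul]

theorem diagAct_add (k : ℕ) (A B : U →ₗ[ℂ] U) : diagAct k (A + B) = diagAct k A + diagAct k B :=
  map_add (diagActHom U k) A B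

theorem diagAct_smul (k : ℕ) (c : ℂ) (A : U →ₗ[ℂ] U) : diagAct k (c • A) = c • diagAct k A :=
  map_smul (diagActHom U k) c A

end TensorRelations

/-! ### Relations between F, E and gl(U) on the invariants -/

section PieceRelations

variable {ν : ℂ} {U : Type u} [AddCommGroup U] [Module ℂ U] [FiniteDimensional ℂ U]

theorem opF_add (k : ℕ) (u v : U) : opF ν k (u + v) = opF ν k u + opF ν k v := by
  simp only [opF_eq, insertHom, insertAt_add, tensMap_add_left, pieceMap_add]

theorem opF_smul (k : ℕ) (c : ℂ) (u : U) : opF ν k (c • u) = c • opF ν k u := by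
  simp only [opF_eq, insertHom, insertAt_smul, tensMap_smul_left, pieceMap_smul]

theorem opE_add (k : ℕ) (f g : U →ₗ[ℂ] ℂ) : opE ν k (f + g) = opE ν k f + opE ν k g := by
  simp only [opE_eq, contractHom, contractAt_add, tensMap_add_left, pieceMap_add, smul_add]

theorem opE_smul (k : ℕ) (c : ℂ) (f : U →ₗ[ℂ] ℂ) : opE ν k (c • f) = c • opE ν k f := by
  simp only [opE_eq, contractHom, contractAt_smul, tensMap_smul_left, pieceMap_smul,
    smul_comm c]

theorem opA_add (k : ℕ) (A B : U →ₗ[ℂ] U) : opA ν k (A + B) = opA ν k A + opA ν k B := by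
  simp only [opA_eq, diagAct_add, tensMap_add_left, pieceMap_add]

theorem opA_smul (k : ℕ) (c : ℂ) (A : U →ₗ[ℂ] U) : opA ν k (c • A) = c • opA ν k A := by
  simp only [opA_eq, diagAct_smul, tensMap_smul_left, pieceMap_smul]

theorem opA_id (k : ℕ) : opA ν k (LinearMap.id : U →ₗ[ℂ] U) = (k : ℂ) • 𝟙 (piece ν U k) := by
  rw [opA_eq, diagAct_id, tensMap_smul_left, pieceMap_smul, tensMap_id, pieceMap_id]

/-- The two orders of insertion differ by the swap of the first two factors, which is invisible on
invariants. -/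
theorem opF_comp_opF (k : ℕ) (u v : U) :
    opF ν k u ≫ opF ν (k + 1) v = opF ν k v ≫ opF ν (k + 1) u := by
  simp only [opF_eq]
  rw [pieceMap_comp_of_right _ _ (symProj_comp_insertHom_comp_symProj ν _ _),
    pieceMap_comp_of_right _ _ (symProj_comp_insertHom_comp_symProj ν _ _),
    ← pieceMap_comp_permAct _ (Equiv.swap 0 1)]
  congr 1
  simp only [insertHom, permAct, tensMap_comp]
  rw [insertAt_comp_insertAt, Category.assoc]
  congr 1
  have h := resStarHom_comp_resStarHom ν (Fin.succAboveEmb (0 : Fin (k + 1)))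
    (Fin.succAboveEmb (0 : Fin (k + 2)))
  have h2 := resStarHom_comp_permHom ν _ ((Fin.succAboveEmb (0 : Fin (k + 1))).trans
    (Fin.succAboveEmb (0 : Fin (k + 2)))) (Equiv.swap 0 1) fun j =>
      Equiv.swap_apply_of_ne_of_ne (Fin.succ_ne_zero _)
        (fun e => Fin.succ_ne_zero j (Fin.succ_injective _ e))
  rw [← h, Category.assoc] at h2
  exact h2

theorem pieceMap_contractHom_comp {U' : Type*} [AddCommGroup U'] [Module ℂ U']
    [FiniteDimensional ℂ U'] {k n : ℕ} (l : Fin (k + 1)) (f : U →ₗ[ℂ] ℂ)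
    (m : tensObj ν U k ⟶ tensObj ν U' n) :
    pieceMap ν (contractHom ν l f) ≫ pieceMap ν m = pieceMap ν (contractHom ν l f ≫ m) :=
  pieceMap_comp_of_left _ _ (symProj_comp_contractHom_comp_symProj ν _ _)

theorem opE_comp_opE (k : ℕ) (f g : U →ₗ[ℂ] ℂ) :
    opE ν (k + 1) f ≫ opE ν k g = opE ν (k + 1) g ≫ opE ν k f := by
  have key : pieceMap ν (contractHom ν (0 : Fin (k + 2)) f) ≫ pieceMap ν (contractHom ν 0 g) =
      pieceMap ν (contractHom ν (0 : Fin (k + 2)) g) ≫ pieceMap ν (contractHom ν 0 f) := by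
    rw [pieceMap_contractHom_comp, pieceMap_contractHom_comp,
      ← pieceMap_permAct_comp (Equiv.swap 0 1)]
    congr 1
    simp only [contractHom, permAct, tensMap_comp]
    rw [LinearMap.comp_assoc, contractAt_comp_contractAt]
    congr 1
    have h := resHom_comp_resHom ν (Fin.succAboveEmb (0 : Fin (k + 2)))
      (Fin.succAboveEmb (0 : Fin (k + 1)))
    have h2 := permHom_comp_resHom ν (Equiv.swap 0 1) ((Fin.succAboveEmb (0 : Fin (k + 1))).trans
      (Fin.succAboveEmb (0 : Fin (k + 2)))) _ fun j =>
        Equiv.swap_apply_of_ne_of_ne (Fin.succ_ne_zero _)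
          (fun e => Fin.succ_ne_zero j (Fin.succ_injective _ e))
    rw [← h] at h2
    exact h2
  simp only [opE_eq, Linear.smul_comp, Linear.comp_smul, key]

/-- Composition in diagrammatic order reverses products of operators, whence the order of the
bracket on the right. -/
theorem opA_comp_opA (k : ℕ) (A B : Module.End ℂ U) :
    opA ν k A ≫ opA ν k B - opA ν k B ≫ opA ν k A = opA ν k ⁅B, A⁆ := by
  simp only [opA_eq]
  rw [pieceMap_comp_tensMap _ _ fun σ => reindex_comp_diagAct σ B,
    pieceMap_comp_tensMap _ _ fun σ => reindex_comp_diagAct σ A, tensMap_comp, tensMap_comp,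
    ← pieceMap_sub, Category.comp_id, ← tensBilin_apply, ← tensBilin_apply, ← LinearMap.map_sub₂,
    tensBilin_apply]
  congr 2
  exact ((diagActHom U k).map_lie B A).symm

theorem opF_comp_opA (k : ℕ) (u : U) (A : U →ₗ[ℂ] U) :
    opF ν k u ≫ opA ν (k + 1) A = opA ν k A ≫ opF ν k u + opF ν k (A u) := by
  simp only [opF_eq, opA_eq]
  rw [pieceMap_comp_tensMap _ _ fun σ => reindex_comp_diagAct σ A,
    tensMap_comp_pieceMap _ _ fun σ => reindex_comp_diagAct σ A, ← pieceMap_add]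
  congr 1
  simp only [insertHom, tensMap_comp, diagAct_comp_insertAt, tensMap_add_left, Category.id_comp,
    Category.comp_id]

theorem opA_comp_opE (k : ℕ) (f : U →ₗ[ℂ] ℂ) (A : U →ₗ[ℂ] U) :
    opA ν (k + 1) A ≫ opE ν k f = opE ν k f ≫ opA ν k A + opE ν k (f ∘ₗ A) := by
  simp only [opE_eq, opA_eq]
  rw [Linear.comp_smul, Linear.smul_comp,
    pieceMap_comp_tensMap _ _ fun σ => reindex_comp_diagAct σ A,
    tensMap_comp_pieceMap _ _ fun σ => reindex_comp_diagAct σ A, ← smul_add, ← pieceMap_add]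
  congr 2
  simp only [contractHom, tensMap_comp, contractAt_comp_diagAct, tensMap_add_left,
    Category.id_comp, Category.comp_id]

theorem insertHom_comp_contractHom_zero (k : ℕ) (u : U) (f : U →ₗ[ℂ] ℂ) :
    insertHom ν (0 : Fin (k + 1)) u ≫ contractHom ν 0 f =
      (f u * (ν - k)) • 𝟙 (tensObj ν U k) := by
  rw [insertHom, contractHom, tensMap_comp, contractAt_zero_comp_insertAt, resStar_comp_res_self,
    tensMap_smul_left, tensMap_smul_right, tensMap_id, smul_smul]

theorem opF_comp_opE_zero (u : U) (f : U →ₗ[ℂ] ℂ) :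
    opF ν 0 u ≫ opE ν 0 f = (f u * ν) • 𝟙 (piece ν U 0) := by
  rw [opF_eq, opE_eq_sum, pieceMap_comp_of_right _ _ (symProj_comp_sum_contractHom ν f),
    Fin.sum_univ_one, insertHom_comp_contractHom_zero, pieceMap_smul, pieceMap_id, Nat.cast_zero,
    sub_zero]

/-- The contraction of the slot 0 meets the inserted vector and gives the scalar. Each other slot
l+1 gives a contraction followed by an insertion, minus the term with the cycle; on invariants the
cycles disappear, and the remaining rank one operators add up to the action of `f.smulRight u`. -/
theorem opF_comp_opE_succ (k : ℕ) (u : U) (f : U →ₗ[ℂ] ℂ) :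
    opF ν (k + 1) u ≫ opE ν (k + 1) f = opE ν k f ≫ opF ν k u +
      (f u * (ν - (k + 1 : ℕ))) • 𝟙 (piece ν U (k + 1)) - opA ν (k + 1) (f.smulRight u) := by
  have key : insertHom ν (0 : Fin (k + 2)) u ≫ (∑ l : Fin (k + 2), contractHom ν l f) =
      (f u * (ν - (k + 1 : ℕ))) • 𝟙 (tensObj ν U (k + 1)) +
        ∑ l : Fin (k + 1), (contractHom ν l f ≫ insertHom ν 0 u -
          tensMap (actAt l (f.smulRight u)) (𝟙 _) ≫ permAct ν U (k + 1) l.cycleRange) := by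
    rw [Fin.sum_univ_succ, Preadditive.comp_add, insertHom_comp_contractHom_zero,
      Preadditive.comp_sum]
    congr 1
    refine Finset.sum_congr rfl fun l _ => ?_
    rw [insertHom, contractHom, contractHom, insertHom, permAct, tensMap_comp, tensMap_comp,
      tensMap_comp, contractAt_succ_comp_insertAt, res_comp_resStar_zero, tensMap_add_right,
      ← insertAt_comp_contractAt, Category.id_comp, add_sub_cancel_right]
  have h2 : opE ν k f ≫ opF ν k u =
      pieceMap ν (∑ l : Fin (k + 1), contractHom ν l f ≫ insertHom ν 0 u) := by
    rw [opF_eq, opE_eq_sum,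
      pieceMap_comp_of_right _ _ (symProj_comp_insertHom_comp_symProj ν _ _),
      Preadditive.sum_comp]
  -- One insertion represents F_u, but E_f is kept as the full sum over slots: only that sum absorbs
  -- the middle projection.
  rw [h2, opF_eq, opE_eq_sum, pieceMap_comp_of_right _ _ (symProj_comp_sum_contractHom ν f), key,
    Finset.sum_sub_distrib, pieceMap_add, pieceMap_sub, pieceMap_smul, pieceMap_id,
    pieceMap_sum _ fun l : Fin (k + 1) => tensMap (actAt l (f.smulRight u)) (𝟙 _) ≫ _,
    Finset.sum_congr rfl fun l _ => pieceMap_comp_permAct _ _, ← pieceMap_sum]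
  change _ + (_ - opA ν (k + 1) _) = _
  abel

end PieceRelations

/-! ### Morphisms of ind-objects on sections -/

section Sections

universe w

variable {C : Type w} [Category.{0} C] [Preadditive C] [Linear ℂ C]

theorem IndLin.secMap_comp {X X' X'' : IndLin C} (f : X ⟶ X') (g : X' ⟶ X'') (Y : C) :
    IndLin.secMap (f ≫ g) Y = IndLin.secMap g Y ∘ₗ IndLin.secMap f Y := rfl

theorem IndLin.secMap_id (X : IndLin C) (Y : C) :
    IndLin.secMap (𝟙 X) Y = LinearMap.id := rfl

theorem IndLin.secMap_map {X X' : IndLin C} (f : X ⟶ X') {Y Z : C} (e : Z ⟶ Y) (x : X.sec Y) :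
    IndLin.secMap f Z ((X.obj.map e.op).hom x) = (X'.obj.map e.op).hom (IndLin.secMap f Y x) :=
  LinearMap.congr_fun (congrArg ModuleCat.Hom.hom (f.hom.naturality e.op)) x

theorem IndLin.hom_ext_sec {X X' : IndLin C} {f g : X ⟶ X'}
    (h : ∀ Y, IndLin.secMap f Y = IndLin.secMap g Y) : f = g := by
  apply ObjectProperty.hom_ext
  ext Y x
  exact LinearMap.congr_fun (h Y.unop) x

/-- The action of the endomorphisms of an ind-object on its sections. -/
noncomputable def IndLin.secHom (X : IndLin C) (Y : C) : End X →ₐ[ℂ] Module.End ℂ (X.sec Y) :=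
  AlgHom.ofLinearMap
    { toFun := fun f => IndLin.secMap (X := X) (X' := X) f Y
      map_add' := fun _ _ => rfl
      map_smul' := fun _ _ => rfl } rfl fun _ _ => rfl

end Sections

/-! ### Sections of the tensor power and operators on them -/

section Summands

variable {ν : ℂ} {S T : SplitUnital.{u}}

variable (ν S) in
/-- The inclusion of the sections of the `k`-th summand. -/
noncomputable def toSummandLin (k : ℕ) (Y : RepS ν) :
    (Y ⟶ piece ν S.U k) →ₗ[ℂ] (tensorPowerObj ν S).sec Y :=
  DirectSum.lof ℂ ℕ (fun k => (Y ⟶ piece ν S.U k)) k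

theorem toSummand_add {Y : RepS ν} (k : ℕ) (m m' : Y ⟶ piece ν S.U k) :
    toSummand ν S k (m + m') = toSummand ν S k m + toSummand ν S k m' :=
  map_add (toSummandLin ν S k Y) m m'

theorem toSummand_sub {Y : RepS ν} (k : ℕ) (m m' : Y ⟶ piece ν S.U k) :
    toSummand ν S k (m - m') = toSummand ν S k m - toSummand ν S k m' :=
  map_sub (toSummandLin ν S k Y) m m'

theorem toSummand_smul {Y : RepS ν} (k : ℕ) (c : ℂ) (m : Y ⟶ piece ν S.U k) :
    toSummand ν S k (c • m) = c • toSummand ν S k m :=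
  map_smul (toSummandLin ν S k Y) c m

theorem toSummand_zero {Y : RepS ν} (k : ℕ) :
    toSummand ν S k (0 : Y ⟶ piece ν S.U k) = 0 :=
  map_zero (toSummandLin ν S k Y)

theorem map_toSummand {Y Z : RepS ν} (e : Z ⟶ Y) (k : ℕ) (m : Y ⟶ piece ν S.U k) :
    ((tensorPowerObj ν S).obj.map e.op).hom (toSummand ν S k m) = toSummand ν S k (e ≫ m) := by
  change DirectSum.lmap (fun k => Linear.leftComp ℂ (piece ν S.U k) e)
    (DirectSum.of (fun k => (Y ⟶ piece ν S.U k)) k m) = _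
  rw [DirectSum.lmap_of]
  rfl

theorem secMap_indSumDesc (X : IndLin (RepS ν)) (c : ∀ k, X.sec (piece ν S.U k)) {Y : RepS ν}
    (k : ℕ) (m : Y ⟶ piece ν S.U k) :
    IndLin.secMap (X := tensorPowerObj ν S) (indSumDesc (piece ν S.U) X c) Y (toSummand ν S k m) =
      (X.obj.map m.op).hom (c k) :=
  indSumDescApp_of (piece ν S.U) X c Y k m

/-- Sections of the tensor power are sums of sections of the summands. -/
theorem sec_induction {Y : RepS ν} {p : (tensorPowerObj ν S).sec Y → Prop}
    (x : (tensorPowerObj ν S).sec Y) (h0 : p 0) (hs : ∀ k m, p (toSummand ν S k m))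
    (ha : ∀ x y, p x → p y → p (x + y)) : p x :=
  DirectSum.induction_on (motive := p) (β := fun k => (Y ⟶ piece ν S.U k)) x h0 hs ha

/-- Yoneda: a section m of the k-th summand is the pullback along m of the universal section given
by the identity, and morphisms commute with pullbacks. -/
theorem tensorPower_hom_ext {X : IndLin (RepS ν)} {f g : tensorPowerObj ν S ⟶ X}
    (h : ∀ k, IndLin.secMap f _ (toSummand ν S k (𝟙 _)) =
      IndLin.secMap g _ (toSummand ν S k (𝟙 _))) : f = g := by
  refine IndLin.hom_ext_sec fun Y => LinearMap.ext fun x => ?_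
  induction x using sec_induction with
  | h0 => rw [map_zero, map_zero]
  | hs k m =>
    have e : toSummand ν S k m =
        ((tensorPowerObj ν S).obj.map m.op).hom (toSummand ν S k (𝟙 _)) := by
      rw [map_toSummand, Category.comp_id]
    rw [e, IndLin.secMap_map, IndLin.secMap_map, h]
  | ha x y hx hy => rw [map_add, map_add, hx, hy]

/-! ### The components of the action -/

variable (ν S)

/-- The action of `u ∈ U`. -/
noncomputable def rhoF (u : S.U) : End (tensorPowerObj ν S) :=
  indSumDesc (piece ν S.U) (tensorPowerObj ν S) fun k => toSummand ν S (k + 1) (opF ν k u)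

/-- The action of `f ∈ U^*`. -/
noncomputable def rhoE (f : S.U →ₗ[ℂ] ℂ) : End (tensorPowerObj ν S) :=
  indSumDesc (piece ν S.U) (tensorPowerObj ν S) (lowerPart ν S f)

/-- The action of `A ∈ gl(U)`. -/
noncomputable def rhoA (A : S.U →ₗ[ℂ] S.U) : End (tensorPowerObj ν S) :=
  indSumDesc (piece ν S.U) (tensorPowerObj ν S) fun k => toSummand ν S k (opA ν k A)

variable {ν S} {Y : RepS ν}

theorem rhoF_toSummand (u : S.U) (k : ℕ) (m : Y ⟶ piece ν S.U k) :
    (tensorPowerObj ν S).secHom Y (rhoF ν S u) (toSummand ν S k m) =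
      toSummand ν S (k + 1) (m ≫ opF ν k u) :=
  (secMap_indSumDesc _ _ _ _).trans (map_toSummand _ _ _)

theorem rhoA_toSummand (A : S.U →ₗ[ℂ] S.U) (k : ℕ) (m : Y ⟶ piece ν S.U k) :
    (tensorPowerObj ν S).secHom Y (rhoA ν S A) (toSummand ν S k m) =
      toSummand ν S k (m ≫ opA ν k A) :=
  (secMap_indSumDesc _ _ _ _).trans (map_toSummand _ _ _)

theorem rhoE_toSummand_succ (f : S.U →ₗ[ℂ] ℂ) (k : ℕ) (m : Y ⟶ piece ν S.U (k + 1)) :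
    (tensorPowerObj ν S).secHom Y (rhoE ν S f) (toSummand ν S (k + 1) m) =
      toSummand ν S k (m ≫ opE ν k f) :=
  (secMap_indSumDesc _ _ _ _).trans (map_toSummand _ _ _)

theorem rhoE_toSummand_zero (f : S.U →ₗ[ℂ] ℂ) (m : Y ⟶ piece ν S.U 0) :
    (tensorPowerObj ν S).secHom Y (rhoE ν S f) (toSummand ν S 0 m) = 0 :=
  (secMap_indSumDesc _ _ _ _).trans (map_zero _)

theorem end_ext {f g : End (tensorPowerObj ν S)}
    (h : ∀ k, (tensorPowerObj ν S).secHom _ f (toSummand ν S k (𝟙 _)) =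
      (tensorPowerObj ν S).secHom _ g (toSummand ν S k (𝟙 _))) : f = g :=
  tensorPower_hom_ext h

theorem glAct_eq (A : Module.End ℂ S.V) :
    glAct ν S A = (glScalar S A * ν) • (1 : End (tensorPowerObj ν S)) + rhoF ν S (glVec S A) +
      rhoE ν S (glCovec S A) + rhoA ν S (glEndU S A) := by
  refine end_ext fun k => ?_
  have h1 : ∀ c : ∀ k, (tensorPowerObj ν S).sec (piece ν S.U k),
      (tensorPowerObj ν S).secHom _ (indSumDesc (piece ν S.U) (tensorPowerObj ν S) c)
        (toSummand ν S k (𝟙 _)) = c k := fun c => by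
    refine (secMap_indSumDesc _ _ _ _).trans ?_
    rw [op_id, (tensorPowerObj ν S).obj.map_id]
    rfl
  rw [map_add, map_add, map_add, map_smul, map_one, rhoF, rhoE, rhoA, glAct, h1]
  simp only [LinearMap.add_apply, h1]
  rfl

theorem rhoF_add (u v : S.U) : rhoF ν S (u + v) = rhoF ν S u + rhoF ν S v := by
  refine end_ext fun k => ?_
  simp only [map_add, LinearMap.add_apply, rhoF_toSummand, opF_add, Preadditive.comp_add,
    toSummand_add]

theorem rhoF_smul (c : ℂ) (u : S.U) : rhoF ν S (c • u) = c • rhoF ν S u := by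
  refine end_ext fun k => ?_
  simp only [map_smul, LinearMap.smul_apply, rhoF_toSummand, opF_smul, Linear.comp_smul,
    toSummand_smul]

theorem rhoA_add (A B : S.U →ₗ[ℂ] S.U) : rhoA ν S (A + B) = rhoA ν S A + rhoA ν S B := by
  refine end_ext fun k => ?_
  simp only [map_add, LinearMap.add_apply, rhoA_toSummand, opA_add, Preadditive.comp_add,
    toSummand_add]

theorem rhoA_smul (c : ℂ) (A : S.U →ₗ[ℂ] S.U) : rhoA ν S (c • A) = c • rhoA ν S A := by
  refine end_ext fun k => ?_
  simp only [map_smul, LinearMap.smul_apply, rhoA_toSummand, opA_smul, Linear.comp_smul,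
    toSummand_smul]

theorem rhoE_add (f g : S.U →ₗ[ℂ] ℂ) : rhoE ν S (f + g) = rhoE ν S f + rhoE ν S g := by
  refine end_ext fun k => ?_
  cases k with
  | zero => simp only [map_add, LinearMap.add_apply, rhoE_toSummand_zero, add_zero]
  | succ k =>
    simp only [map_add, LinearMap.add_apply, rhoE_toSummand_succ, opE_add, Preadditive.comp_add,
      toSummand_add]

theorem rhoE_smul (c : ℂ) (f : S.U →ₗ[ℂ] ℂ) : rhoE ν S (c • f) = c • rhoE ν S f := by
  refine end_ext fun k => ?_
  cases k with
  | zero => simp only [map_smul, LinearMap.smul_apply, rhoE_toSummand_zero, smul_zero]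
  | succ k =>
    simp only [map_smul, LinearMap.smul_apply, rhoE_toSummand_succ, opE_smul, Linear.comp_smul,
      toSummand_smul]

theorem lie_rhoF_rhoF (u v : S.U) : ⁅rhoF ν S u, rhoF ν S v⁆ = 0 := by
  refine sub_eq_zero.2 (end_ext fun k => ?_)
  simp only [map_mul, Module.End.mul_apply, rhoF_toSummand, Category.id_comp, opF_comp_opF k v u]

theorem lie_rhoE_rhoE (f g : S.U →ₗ[ℂ] ℂ) : ⁅rhoE ν S f, rhoE ν S g⁆ = 0 := by
  refine sub_eq_zero.2 (end_ext fun k => ?_)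
  rcases k with _ | _ | k
  · simp only [map_mul, Module.End.mul_apply, rhoE_toSummand_zero, map_zero]
  · simp only [map_mul, Module.End.mul_apply, rhoE_toSummand_succ, rhoE_toSummand_zero]
  · simp only [map_mul, Module.End.mul_apply, rhoE_toSummand_succ, Category.id_comp,
      opE_comp_opE k g f]

theorem lie_rhoA_rhoA (A B : Module.End ℂ S.U) :
    ⁅rhoA ν S A, rhoA ν S B⁆ = rhoA ν S ⁅A, B⁆ := by
  refine sub_eq_iff_eq_add.2 (end_ext fun k => ?_)
  simp only [map_add, LinearMap.add_apply, map_mul, Module.End.mul_apply, rhoA_toSummand,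
    Category.id_comp, ← opA_comp_opA, toSummand_sub, sub_add_cancel]

theorem lie_rhoA_rhoF (A : S.U →ₗ[ℂ] S.U) (u : S.U) :
    ⁅rhoA ν S A, rhoF ν S u⁆ = rhoF ν S (A u) := by
  refine sub_eq_iff_eq_add'.2 (end_ext fun k => ?_)
  simp only [map_add, LinearMap.add_apply, map_mul, Module.End.mul_apply, rhoA_toSummand,
    rhoF_toSummand, Category.id_comp, opF_comp_opA, toSummand_add]

theorem lie_rhoE_rhoA (f : S.U →ₗ[ℂ] ℂ) (A : S.U →ₗ[ℂ] S.U) :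
    ⁅rhoE ν S f, rhoA ν S A⁆ = rhoE ν S (f ∘ₗ A) := by
  refine sub_eq_iff_eq_add'.2 (end_ext fun k => ?_)
  cases k with
  | zero => simp only [map_add, LinearMap.add_apply, map_mul, Module.End.mul_apply,
      rhoA_toSummand, rhoE_toSummand_zero, map_zero, add_zero]
  | succ k => simp only [map_add, LinearMap.add_apply, map_mul, Module.End.mul_apply,
      rhoA_toSummand, rhoE_toSummand_succ, Category.id_comp, opA_comp_opE, toSummand_add]

/-- Since id_U acts by k on the k-th summand, the scalar f(u)(ν-k) takes the form f(u)ν - f(u) id_U,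
which no longer depends on the summand. The summand k = 0 is separate, as E vanishes there. -/
theorem lie_rhoE_rhoF (f : S.U →ₗ[ℂ] ℂ) (u : S.U) :
    ⁅rhoE ν S f, rhoF ν S u⁆ = (f u * ν) • (1 : End (tensorPowerObj ν S)) -
      rhoA ν S (f.smulRight u + f u • LinearMap.id) := by
  refine sub_eq_iff_eq_add'.2 (end_ext fun k => ?_)
  rw [rhoA_add, rhoA_smul]
  cases k with
  | zero =>
    simp only [map_add, map_sub, map_smul, map_one, LinearMap.add_apply, LinearMap.sub_apply,
      LinearMap.smul_apply, map_mul, Module.End.mul_apply, rhoA_toSummand, rhoF_toSummand,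
      rhoE_toSummand_zero, rhoE_toSummand_succ, map_zero, Category.id_comp, opF_comp_opE_zero,
      opA_id, toSummand_smul, Module.End.one_apply, Nat.cast_zero, zero_smul]
    have h : opA ν 0 (f.smulRight u) = 0 := by
      rw [opA_eq, diagAct, Finset.univ_eq_empty, Finset.sum_empty, ← tensBilin_apply,
        LinearMap.map_zero₂]
      exact map_zero (pieceMapLin ν 0 0)
    rw [h, toSummand_zero, smul_zero, add_zero, sub_zero, zero_add]
  | succ k =>
    simp only [map_add, map_sub, map_smul, map_one, LinearMap.add_apply, LinearMap.sub_apply,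
      LinearMap.smul_apply, map_mul, Module.End.mul_apply, rhoA_toSummand, rhoF_toSummand,
      rhoE_toSummand_succ, Category.id_comp, opF_comp_opE_succ,
      opA_id, toSummand_add, toSummand_sub, toSummand_smul, Module.End.one_apply]
    module

end Summands

/-! ### The action of the Lie algebra -/

section LieAction

namespace SplitUnital

variable (S : SplitUnital.{u})

theorem projU_coe (x : S.U) : S.projU (x : S.V) = x := by
  simp [projU]

theorem projU_one : S.projU S.one = 0 := by
  rw [projU, Submodule.projectionOnto_apply_eq_zero_iff]
  exact Submodule.mem_span_singleton_self _

theorem coordOne_one : S.coordOne S.one = 1 := by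
  have h := S.coordOne_smul_add_projU S.one
  rw [projU_one, ZeroMemClass.coe_zero, add_zero] at h
  have h2 : (S.coordOne S.one - 1) • S.one = 0 := by rw [sub_smul, h, one_smul, sub_self]
  exact sub_eq_zero.1 ((smul_eq_zero.1 h2).resolve_right S.one_ne_zero)

theorem coordOne_coe (x : S.U) : S.coordOne (x : S.V) = 0 := by
  have h := S.coordOne_smul_add_projU (x : S.V)
  rw [projU_coe, add_eq_right] at h
  exact (smul_eq_zero.1 h).resolve_right S.one_ne_zero

end SplitUnital

variable {ν : ℂ} {S : SplitUnital.{u}}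

theorem apply_one_eq (A : Module.End ℂ S.V) :
    A S.one = glScalar S A • S.one + (glVec S A : S.V) :=
  (S.coordOne_smul_add_projU (A S.one)).symm

theorem apply_coe_eq (A : Module.End ℂ S.V) (x : S.U) :
    A x = glCovec S A x • S.one + ((glEndU S A x + glScalar S A • x : S.U) : S.V) := by
  rw [glEndU, LinearMap.sub_apply, LinearMap.smul_apply, LinearMap.id_apply, sub_add_cancel]
  exact (S.coordOne_smul_add_projU (A x)).symm

theorem glScalar_mul (A B : Module.End ℂ S.V) :
    glScalar S (A * B) = glScalar S A * glScalar S B + glCovec S A (glVec S B) := by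
  rw [glScalar, Module.End.mul_apply, apply_one_eq B, map_add, map_smul, apply_one_eq A,
    apply_coe_eq A]
  simp only [map_add, map_smul, S.coordOne_one, S.coordOne_coe, smul_eq_mul]
  ring

theorem glVec_mul (A B : Module.End ℂ S.V) :
    glVec S (A * B) = glScalar S B • glVec S A + glScalar S A • glVec S B +
      glEndU S A (glVec S B) := by
  rw [glVec, Module.End.mul_apply, apply_one_eq B, map_add, map_smul, apply_one_eq A,
    apply_coe_eq A]
  simp only [map_add, map_smul, S.projU_one, S.projU_coe, smul_zero]
  module

theorem glCovec_mul (A B : Module.End ℂ S.V) :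
    glCovec S (A * B) = glScalar S A • glCovec S B + glScalar S B • glCovec S A +
      glCovec S A ∘ₗ glEndU S B := by
  ext x
  change S.coordOne (A (B x)) = _
  rw [apply_coe_eq B, map_add, map_smul, apply_one_eq A, apply_coe_eq A]
  simp only [map_add, map_smul, S.coordOne_one, S.coordOne_coe, smul_eq_mul, LinearMap.add_apply,
    LinearMap.smul_apply, LinearMap.comp_apply]
  ring

/-- Block multiplication, with the correction that the component in gl(U) is the diagonal block
minus the scalar at 𝟙. The scalar of a product contains `glCovec S A (glVec S B)`, which must
therefore be subtracted. -/
theorem glEndU_mul (A B : Module.End ℂ S.V) :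
    glEndU S (A * B) = glScalar S B • glEndU S A + glScalar S A • glEndU S B +
      (glCovec S B).smulRight (glVec S A) + glEndU S A * glEndU S B -
      glCovec S A (glVec S B) • LinearMap.id := by
  ext1 x
  change S.projU (A (B x)) - glScalar S (A * B) • x = _
  rw [glScalar_mul, apply_coe_eq B, map_add, map_smul, apply_one_eq A, apply_coe_eq A]
  simp only [map_add, map_smul, S.projU_one, S.projU_coe, LinearMap.add_apply,
    LinearMap.smul_apply, Module.End.mul_apply, LinearMap.smulRight_apply, LinearMap.id_apply,
    LinearMap.sub_apply]
  module

theorem glScalar_add (A B : Module.End ℂ S.V) :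
    glScalar S (A + B) = glScalar S A + glScalar S B := map_add S.coordOne _ _

theorem glScalar_smul (c : ℂ) (A : Module.End ℂ S.V) :
    glScalar S (c • A) = c * glScalar S A := map_smul S.coordOne _ _

theorem glVec_add (A B : Module.End ℂ S.V) :
    glVec S (A + B) = glVec S A + glVec S B := map_add S.projU _ _

theorem glVec_smul (c : ℂ) (A : Module.End ℂ S.V) :
    glVec S (c • A) = c • glVec S A := map_smul S.projU _ _

theorem glCovec_add (A B : Module.End ℂ S.V) :
    glCovec S (A + B) = glCovec S A + glCovec S B := by
  ext x
  exact map_add S.coordOne _ _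

theorem glCovec_smul (c : ℂ) (A : Module.End ℂ S.V) :
    glCovec S (c • A) = c • glCovec S A := by
  ext x
  exact map_smul S.coordOne _ _

theorem glEndU_add (A B : Module.End ℂ S.V) :
    glEndU S (A + B) = glEndU S A + glEndU S B := by
  ext1 x
  change S.projU (A x + B x) - glScalar S (A + B) • x =
    S.projU (A x) - glScalar S A • x + (S.projU (B x) - glScalar S B • x)
  rw [map_add, glScalar_add]
  module

theorem glEndU_smul (c : ℂ) (A : Module.End ℂ S.V) :
    glEndU S (c • A) = c • glEndU S A := by
  ext1 x
  change S.projU (c • A x) - glScalar S (c • A) • x = c • (S.projU (A x) - glScalar S A • x)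
  rw [map_smul, glScalar_smul]
  module

variable (ν S) in
/-- The action of `gl(V)` on the tensor power. -/
noncomputable def glActHom : Module.End ℂ S.V →ₗ⁅ℂ⁆ End (tensorPowerObj ν S) where
  toFun := glAct ν S
  map_add' A B := by
    simp only [glAct_eq, glScalar_add, glVec_add, glCovec_add, glEndU_add, rhoF_add, rhoE_add,
      rhoA_add, add_mul, add_smul]
    abel
  map_smul' c A := by
    simp only [glAct_eq, glScalar_smul, glVec_smul, glCovec_smul, glEndU_smul, rhoF_smul,
      rhoE_smul, rhoA_smul, RingHom.id_apply, smul_add, mul_assoc, mul_smul]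
  map_lie' {A B} := by
    -- With the commutator written as a linear combination, linearity of the components and of the
    -- operators expands both sides into the same elements.
    have hs : glAct ν S ⁅A, B⁆ = glAct ν S (A * B + (-1 : ℂ) • (B * A)) := by
      rw [neg_one_smul, ← sub_eq_add_neg]
      rfl
    have hF : ∀ u f, ⁅rhoF ν S u, rhoE ν S f⁆ = -((f u * ν) • (1 : End (tensorPowerObj ν S)) -
        rhoA ν S (f.smulRight u + f u • LinearMap.id)) := fun u f => by
      rw [← lie_skew, lie_rhoE_rhoF]
    have hA : ∀ A f, ⁅rhoA ν S A, rhoE ν S f⁆ = -rhoE ν S (f ∘ₗ A) := fun A f => by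
      rw [← lie_skew, lie_rhoE_rhoA]
    have hA' : ∀ A u, ⁅rhoF ν S u, rhoA ν S A⁆ = -rhoF ν S (A u) := fun A u => by
      rw [← lie_skew, lie_rhoA_rhoF]
    have h1 : ∀ x : End (tensorPowerObj ν S), ⁅(1 : End (tensorPowerObj ν S)), x⁆ = 0 := fun x => by
      rw [Ring.lie_def, one_mul, mul_one, sub_self]
    have h1' : ∀ x : End (tensorPowerObj ν S), ⁅x, (1 : End (tensorPowerObj ν S))⁆ = 0 := fun x => by
      rw [Ring.lie_def, one_mul, mul_one, sub_self]
    have hAA : ∀ A B : Module.End ℂ S.U, ⁅rhoA ν S A, rhoA ν S B⁆ =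
        rhoA ν S (A * B) + (-1 : ℂ) • rhoA ν S (B * A) := fun A B => by
      rw [lie_rhoA_rhoA, Ring.lie_def, sub_eq_add_neg, ← neg_one_smul ℂ (B * A), rhoA_add,
        rhoA_smul]
    rw [hs]
    simp only [glAct_eq, glScalar_add, glVec_add, glCovec_add, glEndU_add, glScalar_smul,
      glVec_smul, glCovec_smul, glEndU_smul, glScalar_mul, glVec_mul, glCovec_mul, glEndU_mul,
      lie_add, add_lie, smul_lie, lie_smul, lie_rhoF_rhoF, lie_rhoE_rhoE, hAA, lie_rhoA_rhoF,
      lie_rhoE_rhoA, lie_rhoE_rhoF, hF, hA, hA', h1, h1', sub_eq_add_neg, rhoA_add, rhoA_smul,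
      rhoE_add, rhoE_smul, rhoF_add, rhoF_smul, ← neg_one_smul ℂ (_ : Module.End ℂ S.U)]
    module

theorem glActHom_apply (A : Module.End ℂ S.V) : glActHom ν S A = glAct ν S A := rfl

end LieAction

/-! ### The components of the morphisms of tensor powers -/

section Orbits

/-- The symmetric group is transitive on injections of a given source: the bijection between the two
images extends over the complements. -/
theorem exists_perm_extending {l k : ℕ} (ι ι' : Fin l ↪ Fin k) :
    ∃ σ : Equiv.Perm (Fin k), ∀ j, σ (ι j) = ι' j := by
  classical
  let e : {x // x ∈ Set.range ι} ≃ {x // x ∈ Set.range ι'} :=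
    (Equiv.ofInjective ι ι.injective).symm.trans (Equiv.ofInjective ι' ι'.injective)
  refine ⟨e.extendSubtype, fun j => ?_⟩
  rw [Equiv.extendSubtype_apply_of_mem e (ι j) ⟨j, rfl⟩]
  have h : (Equiv.ofInjective ι ι.injective).symm ⟨ι j, ⟨j, rfl⟩⟩ = j := by
    rw [Equiv.symm_apply_eq]
    rfl
  simp only [e, Equiv.trans_apply, h]
  rfl

theorem card_fin_orderEmbedding (l k : ℕ) [Fintype (Fin l ↪o Fin k)] :
    Fintype.card (Fin l ↪o Fin k) = k.choose l := by
  have h : (Finset.powersetCard l (Finset.univ : Finset (Fin k))).card = k.choose l := by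
    rw [Finset.card_powersetCard, Finset.card_univ, Fintype.card_fin]
  rw [← h, ← Finset.card_univ]
  refine Finset.card_bij' (fun ι _ => Finset.univ.map ι.toEmbedding)
    (fun s hs => s.orderEmbOfFin (Finset.mem_powersetCard.1 hs).2) (fun ι _ => ?_)
    (fun _ _ => Finset.mem_univ _) (fun ι _ => ?_) (fun s hs => ?_)
  · simp [Finset.mem_powersetCard]
  · exact (Finset.orderEmbOfFin_unique' _ fun x => by simp).symm
  · simp

variable {U U' : Type*} [AddCommGroup U] [Module ℂ U] [AddCommGroup U'] [Module ℂ U']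

theorem mixedAct_tprod {k l : ℕ} (ι : Fin l ↪o Fin k) [DecidablePred fun i => i ∉ Set.range ι]
    (b : U →ₗ[ℂ] U') (a : U →ₗ[ℂ] ℂ) (x : Fin k → U) :
    mixedAct ι b a (PiTensorProduct.tprod ℂ x) =
      (∏ i with i ∉ Set.range ι, a (x i)) • PiTensorProduct.tprod ℂ fun j => b (x (ι j)) := by
  rw [mixedAct, PiTensorProduct.lift.tprod]
  have h : mixedMulti ι b a x = (haveI := Classical.decPred fun i => i ∉ Set.range ι
      ∏ i with i ∉ Set.range ι, a (x i)) • PiTensorProduct.tprod ℂ fun j => b (x (ι j)) := rfl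
  refine h.trans ?_
  congr!

theorem mixedAct_comp_reindex {k l : ℕ} {ι ι' : Fin l ↪o Fin k} {σ : Equiv.Perm (Fin k)}
    (h : ∀ j, σ (ι j) = ι' j) (b : U →ₗ[ℂ] U') (a : U →ₗ[ℂ] ℂ) :
    mixedAct ι' b a ∘ₗ (PiTensorProduct.reindex ℂ (fun _ : Fin k => U) σ).toLinearMap =
      mixedAct ι b a := by
  classical
  ext x
  simp only [LinearMap.compMultilinearMap_apply, LinearMap.comp_apply, LinearEquiv.coe_coe,
    reindex_tprod_apply, mixedAct_tprod]
  congr 1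
  · refine Finset.prod_equiv σ.symm (fun i => ?_) fun i _ => rfl
    simp only [Finset.mem_filter, Finset.mem_univ, true_and, Set.mem_range, ← h,
      Equiv.eq_symm_apply]
  · congr 1
    funext j
    rw [← h, Equiv.symm_apply_apply]

/-- The increasing map `i ↦ j + i`. -/
def shiftEmb (l : ℕ) : ∀ j : ℕ, Fin l ↪o Fin (l + j)
  | 0 => RelEmbedding.refl _
  | j + 1 => (shiftEmb l j).trans (Fin.succOrderEmb (l + j))

theorem mixedAct_shiftEmb_zero (l : ℕ) (b : U →ₗ[ℂ] U') (a : U →ₗ[ℂ] ℂ) :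
    mixedAct (shiftEmb l 0) b a = PiTensorProduct.map fun _ => b := by
  classical
  ext x
  simp only [LinearMap.compMultilinearMap_apply, mixedAct_tprod, PiTensorProduct.map_tprod]
  rw [Finset.prod_eq_one, one_smul]
  · rfl
  · intro i hi
    exact absurd ⟨i, rfl⟩ (Finset.mem_filter.1 hi).2

/-- The first position lies outside the image of the shifted map, so its factor is consumed by a;
what remains is the previous shift on the other factors. -/
theorem mixedAct_shiftEmb_succ (l j : ℕ) (b : U →ₗ[ℂ] U') (a : U →ₗ[ℂ] ℂ) :
    mixedAct (shiftEmb l (j + 1)) b a =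
      mixedAct (shiftEmb l j) b a ∘ₗ contractAt (0 : Fin (l + j + 1)) a := by
  classical
  ext x
  simp only [LinearMap.compMultilinearMap_apply, LinearMap.comp_apply, mixedAct_tprod,
    contractAt_zero_tprod, map_smul, smul_smul]
  congr 1
  have h0 : (0 : Fin (l + j + 1)) ∉ Set.range (shiftEmb l (j + 1)) := by
    rintro ⟨i, hi⟩
    exact Fin.succ_ne_zero _ hi
  have h1 : ∀ i : Fin (l + j), i.succ ∈ Set.range (shiftEmb l (j + 1)) ↔
      i ∈ Set.range (shiftEmb l j) := fun i =>
    ⟨fun ⟨m, hm⟩ => ⟨m, Fin.succ_injective _ hm⟩, fun ⟨m, hm⟩ => ⟨m, congrArg Fin.succ hm⟩⟩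
  rw [Finset.prod_filter, Finset.prod_filter]
  refine (Fin.prod_univ_succ (n := l + j) _).trans ?_
  rw [if_pos h0]
  simp only [h1]

end Orbits

/-! ### Matrix coefficients as iterated contractions -/

section Coefficients

variable {ν : ℂ} {U U' : Type u} [AddCommGroup U] [Module ℂ U] [FiniteDimensional ℂ U]
  [AddCommGroup U'] [Module ℂ U'] [FiniteDimensional ℂ U']

variable (ν) in
/-- The contraction of the first `j` factors with `a`. -/
noncomputable def contractIter (a : U →ₗ[ℂ] ℂ) (l : ℕ) :
    ∀ j : ℕ, tensObj ν U (l + j) ⟶ tensObj ν U l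
  | 0 => 𝟙 _
  | j + 1 => contractHom ν (0 : Fin (l + j + 1)) a ≫ contractIter a l j

theorem tensMap_mixedAct_shiftEmb (b : U →ₗ[ℂ] U') (a : U →ₗ[ℂ] ℂ) (l j : ℕ) :
    tensMap (mixedAct (shiftEmb l j) b a) (resHom ν (shiftEmb l j).toEmbedding) =
      contractIter ν a l j ≫ tensMap (PiTensorProduct.map fun _ => b) (𝟙 (Delta ν l)) := by
  induction j with
  | zero =>
    rw [mixedAct_shiftEmb_zero, contractIter, Category.id_comp]
    congr 1
    exact resHom_refl ν l
  | succ j ih =>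
    rw [contractIter, Category.assoc, ← ih, contractHom, tensMap_comp, mixedAct_shiftEmb_succ]
    congr 1
    refine Eq.trans ?_ (resHom_comp_resHom ν (Fin.succAboveEmb (0 : Fin (l + j + 1)))
      (shiftEmb l j).toEmbedding).symm
    congr 1

/-- A permutation carries the standard increasing map onto ι, and the invariants absorb it. Hence
the morphism does not depend on ι and may be computed by contracting the first j factors. -/
theorem pieceMap_mixedAct (b : U →ₗ[ℂ] U') (a : U →ₗ[ℂ] ℂ) (l j : ℕ) (ι : Fin l ↪o Fin (l + j)) :
    pieceMap ν (tensMap (mixedAct ι b a) (resHom ν ι.toEmbedding)) =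
      pieceMap ν (contractIter ν a l j) ≫
        pieceMap ν (tensMap (PiTensorProduct.map fun _ => b) (𝟙 (Delta ν l))) := by
  obtain ⟨σ, h⟩ := exists_perm_extending (shiftEmb l j).toEmbedding ι.toEmbedding
  rw [pieceMap_comp_tensMap, ← tensMap_mixedAct_shiftEmb, ← pieceMap_permAct_comp σ, permAct,
    tensMap_comp, mixedAct_comp_reindex h, permHom_comp_resHom ν σ _ _ h]
  intro σ
  ext x
  simp only [LinearMap.compMultilinearMap_apply, LinearMap.comp_apply, LinearEquiv.coe_coe,
    reindex_tprod_apply, PiTensorProduct.map_tprod]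

theorem pieceMap_sum_mixedAct (b : U →ₗ[ℂ] U') (a : U →ₗ[ℂ] ℂ) (l j : ℕ)
    [Fintype (Fin l ↪o Fin (l + j))] :
    pieceMap ν (∑ ι : Fin l ↪o Fin (l + j),
      tensMap (mixedAct ι b a) (resHom ν ι.toEmbedding)) =
      ((l + j).choose l : ℂ) • (pieceMap ν (contractIter ν a l j) ≫
        pieceMap ν (tensMap (PiTensorProduct.map fun _ => b) (𝟙 (Delta ν l)))) := by
  rw [pieceMap_sum, Finset.sum_congr rfl fun ι _ => pieceMap_mixedAct b a l j ι, Finset.sum_const,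
    Finset.card_univ, card_fin_orderEmbedding, ← Nat.cast_smul_eq_nsmul ℂ]

end Coefficients

/-! ### Exponentials of locally nilpotent operators -/

section LocallyNilpotent

variable {M M' : Type*} [AddCommGroup M] [Module ℂ M] [AddCommGroup M'] [Module ℂ M']

/-- `E` is locally nilpotent with exponential `G`. -/
def IsLocallyNilpotentExp (E G : Module.End ℂ M) : Prop :=
  ∀ x, ∃ N : ℕ, (E ^ N) x = 0 ∧ G x = ∑ i ∈ Finset.range N, (i.factorial : ℂ)⁻¹ • (E ^ i) x

theorem pow_apply_eq_zero_of_le {E : Module.End ℂ M} {x : M} {N n : ℕ} (h : (E ^ N) x = 0)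
    (hn : N ≤ n) : (E ^ n) x = 0 := by
  obtain ⟨k, rfl⟩ := Nat.exists_eq_add_of_le hn
  rw [add_comm, pow_add, Module.End.mul_apply, h, map_zero]

theorem sum_range_pow_eq {E : Module.End ℂ M} {x : M} {N n : ℕ} (h : (E ^ N) x = 0)
    (hn : N ≤ n) : ∑ i ∈ Finset.range n, (i.factorial : ℂ)⁻¹ • (E ^ i) x =
      ∑ i ∈ Finset.range N, (i.factorial : ℂ)⁻¹ • (E ^ i) x := by
  refine (Finset.sum_subset (Finset.range_mono hn) fun i _ hi => ?_).symm
  rw [pow_apply_eq_zero_of_le h (by simpa using hi), smul_zero]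

namespace IsLocallyNilpotentExp

variable {E G : Module.End ℂ M}

theorem apply_eq (h : IsLocallyNilpotentExp E G) {x : M} {N : ℕ} (hN : (E ^ N) x = 0) :
    G x = ∑ i ∈ Finset.range N, (i.factorial : ℂ)⁻¹ • (E ^ i) x := by
  obtain ⟨n, hn, hG⟩ := h x
  rw [hG]
  rcases le_total N n with hle | hle
  · exact sum_range_pow_eq hN hle
  · exact (sum_range_pow_eq hn hle).symm

theorem unique (h : IsLocallyNilpotentExp E G) {G' : Module.End ℂ M}
    (h' : IsLocallyNilpotentExp E G') : G = G' := by
  ext x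
  obtain ⟨N, hN, hG⟩ := h x
  rw [hG, h'.apply_eq hN]

theorem comp_eq (h : IsLocallyNilpotentExp E G) {E' G' : Module.End ℂ M'}
    (h' : IsLocallyNilpotentExp E' G') (L : M →ₗ[ℂ] M') (hL : ∀ x, L (E x) = E' (L x)) (x : M) :
    L (G x) = G' (L x) := by
  have hp : ∀ i, L ((E ^ i) x) = (E' ^ i) (L x) := by
    intro i
    induction i with
    | zero => rfl
    | succ i ih => rw [pow_succ', pow_succ', Module.End.mul_apply, Module.End.mul_apply, hL, ih]
  obtain ⟨N, hN, hG⟩ := h x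
  rw [hG, h'.apply_eq (N := N) (by rw [← hp, hN, map_zero]), map_sum]
  simp only [map_smul, hp]

/-- Vanishing of a power and the exponential formula pass to sums once a common exponent is taken,
so generators suffice. The hypothesis `hind` is the corresponding additive induction principle. -/
theorem of_span {s : M → Prop} (hs : ∀ x, s x → ∃ N : ℕ, (E ^ N) x = 0 ∧
      G x = ∑ i ∈ Finset.range N, (i.factorial : ℂ)⁻¹ • (E ^ i) x)
    (hind : ∀ p : M → Prop, p 0 → (∀ x, s x → p x) → (∀ x y, p x → p y → p (x + y)) → ∀ x, p x) :
    IsLocallyNilpotentExp E G := by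
  refine hind _ ⟨0, by simp, by simp⟩ hs ?_
  rintro x y ⟨N, hN, hx⟩ ⟨N', hN', hy⟩
  have h1 := pow_apply_eq_zero_of_le hN (le_max_left N N')
  have h2 := pow_apply_eq_zero_of_le hN' (le_max_right N N')
  refine ⟨max N N', by rw [map_add, h1, h2, add_zero], ?_⟩
  rw [map_add, hx, hy, ← sum_range_pow_eq hN (le_max_left N N'),
    ← sum_range_pow_eq hN' (le_max_right N N'), ← Finset.sum_add_distrib]
  simp only [map_add, smul_add]

theorem add (h : IsLocallyNilpotentExp E G) {E' G' : Module.End ℂ M}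
    (h' : IsLocallyNilpotentExp E' G') (hc : Commute E E') :
    IsLocallyNilpotentExp (E + E') (G * G') := by
  intro x
  obtain ⟨N, hN, -⟩ := h x
  obtain ⟨N', hN', hG'⟩ := h' x
  have hz : ∀ i j, N ≤ i ∨ N' ≤ j → (E ^ i) ((E' ^ j) x) = 0 := by
    rintro i j (hi | hj)
    · rw [← Module.End.mul_apply, (hc.pow_pow i j).eq, Module.End.mul_apply,
        pow_apply_eq_zero_of_le hN hi, map_zero]
    · rw [pow_apply_eq_zero_of_le hN' hj, map_zero]
  -- In total degree N + N' one of the two exponents reaches its bound, so every binomial term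
  -- vanishes.
  refine ⟨N + N', ?_, ?_⟩
  · rw [hc.add_pow', LinearMap.sum_apply]
    refine Finset.sum_eq_zero fun p hp => ?_
    rw [LinearMap.smul_apply, Module.End.mul_apply, hz, smul_zero]
    have := Finset.HasAntidiagonal.mem_antidiagonal.1 hp
    omega
  · let g : ℕ × ℕ → M := fun p =>
      ((p.1.factorial : ℂ)⁻¹ * (p.2.factorial : ℂ)⁻¹) • (E ^ p.1) ((E' ^ p.2) x)
    have hL : (G * G') x = ∑ p ∈ Finset.range N ×ˢ Finset.range N', g p := by
      rw [Module.End.mul_apply, hG', map_sum, Finset.sum_product_right]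
      refine Finset.sum_congr rfl fun j _ => ?_
      rw [map_smul, h.apply_eq (N := N) (hz N j (Or.inl le_rfl)), Finset.smul_sum]
      refine Finset.sum_congr rfl fun i _ => ?_
      rw [smul_smul, mul_comm]
    have hR : ∀ n, (n.factorial : ℂ)⁻¹ • ((E + E') ^ n) x =
        ∑ p ∈ Finset.HasAntidiagonal.antidiagonal n, g p := by
      intro n
      rw [hc.add_pow', LinearMap.sum_apply, Finset.smul_sum]
      refine Finset.sum_congr rfl fun p hp => ?_
      rw [LinearMap.smul_apply, Module.End.mul_apply, ← Nat.cast_smul_eq_nsmul ℂ, smul_smul]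
      congr 1
      obtain rfl := Finset.HasAntidiagonal.mem_antidiagonal.1 hp
      have h0 : ((p.1 + p.2).choose p.1 : ℂ) * (p.1.factorial : ℂ) * (p.2.factorial : ℂ) =
          ((p.1 + p.2).factorial : ℂ) := by
        have := Nat.add_choose_mul_factorial_mul_factorial p.1 p.2
        rw [← Nat.choose_symm_add] at this
        exact_mod_cast this
      have h1 : ((p.1 + p.2).factorial : ℂ) ≠ 0 := Nat.cast_ne_zero.2 (Nat.factorial_ne_zero _)
      have h2 : (p.1.factorial : ℂ) ≠ 0 := Nat.cast_ne_zero.2 (Nat.factorial_ne_zero _)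
      have h3 : (p.2.factorial : ℂ) ≠ 0 := Nat.cast_ne_zero.2 (Nat.factorial_ne_zero _)
      field_simp
      rw [← h0]
    -- The rectangle of exponents is fibred over their sum; the pairs of each antidiagonal outside
    -- the rectangle contribute zero by `hz`.
    rw [hL, Finset.sum_congr rfl fun n _ => hR n,
      ← Finset.sum_fiberwise_of_maps_to (t := Finset.range (N + N')) (g := fun p => p.1 + p.2)]
    · refine Finset.sum_congr rfl fun n _ => Finset.sum_subset (fun p hp => ?_) fun p hp hp' => ?_
      · exact Finset.HasAntidiagonal.mem_antidiagonal.2 (Finset.mem_filter.1 hp).2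
      · have hn : N ≤ p.1 ∨ N' ≤ p.2 := by
          by_contra hcon
          push Not at hcon
          exact hp' (Finset.mem_filter.2 ⟨Finset.mem_product.2 ⟨Finset.mem_range.2 hcon.1,
            Finset.mem_range.2 hcon.2⟩, Finset.HasAntidiagonal.mem_antidiagonal.1 hp⟩)
        change _ • (E ^ p.1) ((E' ^ p.2) x) = 0
        rw [hz _ _ hn, smul_zero]
    · intro p hp
      have h1 := Finset.mem_product.1 hp
      have h2 := Finset.mem_range.1 h1.1
      have h3 := Finset.mem_range.1 h1.2
      exact Finset.mem_range.2 (by omega)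

/-- This is exp(E) x exp(-E) = exp(ad E)(x), where D₁ and D₂ are the first two iterated commutators
and the third vanishes. Only E need be locally nilpotent. -/
theorem mul_eq (h : IsLocallyNilpotentExp E G) {x D₁ D₂ : Module.End ℂ M}
    (h1 : E * x = x * E + D₁) (h2 : E * D₁ = D₁ * E + D₂) (h3 : E * D₂ = D₂ * E) :
    G * x = (x + D₁ + (2 : ℂ)⁻¹ • D₂) * G := by
  -- The Leibniz expansion of E^{n+2} x by iterated commutators, stopped after the second. The shift
  -- by two avoids subtraction in the exponents.
  have hpow : ∀ n : ℕ, E ^ (n + 2) * x = x * E ^ (n + 2) + ((n : ℂ) + 2) • (D₁ * E ^ (n + 1)) +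
      (((n : ℂ) + 2) * ((n : ℂ) + 1) * 2⁻¹) • (D₂ * E ^ n) := by
    intro n
    induction n with
    | zero =>
      have e : E ^ 2 * x = x * E ^ 2 + (2 : ℂ) • (D₁ * E) + D₂ := by
        rw [pow_two, mul_assoc, h1, mul_add, ← mul_assoc, h1, h2, add_mul, two_smul, mul_assoc]
        abel
      simpa using e
    | succ n ih =>
      have e1 : E ^ (n + 1 + 2) * x = E * (E ^ (n + 2) * x) := by
        rw [← mul_assoc, ← pow_succ']
      have c1 : x * E * E ^ (n + 2) = x * E ^ (n + 1 + 2) := by rw [mul_assoc, ← pow_succ']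
      have c2 : D₁ * E * E ^ (n + 1) = D₁ * E ^ (n + 2) := by rw [mul_assoc, ← pow_succ']
      have c3 : D₂ * E * E ^ n = D₂ * E ^ (n + 1) := by rw [mul_assoc, ← pow_succ']
      rw [e1, ih, mul_add, mul_add, mul_smul_comm, mul_smul_comm, ← mul_assoc, ← mul_assoc,
        ← mul_assoc, h1, h2, h3, add_mul, add_mul, c1, c2, c3]
      push_cast
      module
  ext y
  obtain ⟨N, hN, hG⟩ := h y
  have hpz : ∀ n, N ≤ n → (E ^ n) y = 0 := fun n hn => pow_apply_eq_zero_of_le hN hn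
  have hNx : (E ^ (N + 2)) (x y) = 0 := by
    rw [← Module.End.mul_apply, hpow]
    simp only [LinearMap.add_apply, LinearMap.smul_apply, Module.End.mul_apply,
      hpz (N + 2) (by omega), hpz (N + 1) (by omega), hN, map_zero, smul_zero, add_zero]
  have hterm : ∀ n : ℕ, ((n + 2).factorial : ℂ)⁻¹ • (E ^ (n + 2)) (x y) =
      x (((n + 2).factorial : ℂ)⁻¹ • (E ^ (n + 2)) y) +
      D₁ (((n + 1).factorial : ℂ)⁻¹ • (E ^ (n + 1)) y) +
      (2 : ℂ)⁻¹ • D₂ ((n.factorial : ℂ)⁻¹ • (E ^ n) y) := by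
    intro n
    rw [← Module.End.mul_apply, hpow]
    simp only [LinearMap.add_apply, LinearMap.smul_apply, Module.End.mul_apply, smul_add,
      smul_smul, map_smul]
    have hn : (n.factorial : ℂ) ≠ 0 := Nat.cast_ne_zero.2 (Nat.factorial_ne_zero _)
    have hn1 : (n : ℂ) + 1 ≠ 0 := Nat.cast_add_one_ne_zero n
    have hn2 : (n : ℂ) + 2 ≠ 0 := by exact_mod_cast (Nat.succ_ne_zero (n + 1))
    have f1 : ((n + 1).factorial : ℂ) = ((n : ℂ) + 1) * n.factorial := by
      rw [Nat.factorial_succ]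
      push_cast
      ring
    have f2 : ((n + 2).factorial : ℂ) = ((n : ℂ) + 2) * (((n : ℂ) + 1) * n.factorial) := by
      rw [Nat.factorial_succ, Nat.cast_mul, f1]
      push_cast
      ring
    have c1 : ((n + 2).factorial : ℂ)⁻¹ * ((n : ℂ) + 2) = ((n + 1).factorial : ℂ)⁻¹ := by
      rw [f1, f2]
      field_simp
    have c2 : ((n + 2).factorial : ℂ)⁻¹ * (((n : ℂ) + 2) * ((n : ℂ) + 1) * 2⁻¹) =
        2⁻¹ * (n.factorial : ℂ)⁻¹ := by
      rw [f2]
      field_simp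
    rw [c1, c2]
  rw [Module.End.mul_apply, Module.End.mul_apply, h.apply_eq hNx, Finset.sum_range_succ',
    Finset.sum_range_succ', Finset.sum_congr rfl fun n _ => hterm n, Finset.sum_add_distrib,
    Finset.sum_add_distrib, ← Finset.smul_sum, ← map_sum, ← map_sum, ← map_sum, ← hG]
  -- The three sums are exponential series with zero, one or two initial terms missing; `g1` and
  -- `g2` restore the missing terms.
  have g1 : G y = ∑ n ∈ Finset.range N, ((n + 1).factorial : ℂ)⁻¹ • (E ^ (n + 1)) y + y := by
    rw [h.apply_eq (hpz (N + 1) (by omega)), Finset.sum_range_succ']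
    simp
  have g2 : G y = ∑ n ∈ Finset.range N, ((n + 2).factorial : ℂ)⁻¹ • (E ^ (n + 2)) y + E y + y := by
    rw [h.apply_eq (hpz (N + 2) (by omega)), Finset.sum_range_succ', Finset.sum_range_succ']
    simp
  have e1 : E (x y) = x (E y) + D₁ y := LinearMap.congr_fun h1 y
  have t1 := congrArg D₁ g1
  have t2 := congrArg x g2
  rw [map_add] at t1
  rw [map_add, map_add] at t2
  simp only [LinearMap.add_apply, LinearMap.smul_apply]
  rw [t1, t2]
  simp only [zero_add, pow_one, pow_zero, Nat.factorial_zero, Nat.factorial_one, Nat.cast_one,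
    inv_one, one_smul, Module.End.one_apply, e1]
  abel

end IsLocallyNilpotentExp

end LocallyNilpotent

/-! ### Morphisms that respect the splittings -/

section Strict

variable {ν : ℂ} {U U' U'' : Type u} [AddCommGroup U] [Module ℂ U] [FiniteDimensional ℂ U]
  [AddCommGroup U'] [Module ℂ U'] [FiniteDimensional ℂ U']
  [AddCommGroup U''] [Module ℂ U''] [FiniteDimensional ℂ U'']

omit [FiniteDimensional ℂ U] [FiniteDimensional ℂ U'] in
theorem reindex_comp_map {k : ℕ} (b : U →ₗ[ℂ] U') (σ : Equiv.Perm (Fin k)) :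
    (PiTensorProduct.reindex ℂ (fun _ : Fin k => U') σ).toLinearMap ∘ₗ
        (PiTensorProduct.map fun _ => b) =
      (PiTensorProduct.map fun _ => b) ∘ₗ
        (PiTensorProduct.reindex ℂ (fun _ : Fin k => U) σ).toLinearMap := by
  ext x
  simp only [LinearMap.compMultilinearMap_apply, LinearMap.comp_apply, LinearEquiv.coe_coe,
    reindex_tprod_apply, PiTensorProduct.map_tprod]

variable (ν) in
/-- The morphism of the `k`-th summands given by `b`. -/
noncomputable def mapPiece (b : U →ₗ[ℂ] U') (k : ℕ) : piece ν U k ⟶ piece ν U' k :=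
  pieceMap ν (tensMap (PiTensorProduct.map fun _ => b) (𝟙 (Delta ν k)))

theorem mapPiece_id (k : ℕ) : mapPiece ν (LinearMap.id : U →ₗ[ℂ] U) k = 𝟙 _ := by
  rw [mapPiece, PiTensorProduct.map_id, tensMap_id, pieceMap_id]

theorem mapPiece_comp (b : U →ₗ[ℂ] U') (b' : U' →ₗ[ℂ] U'') (k : ℕ) :
    mapPiece ν b k ≫ mapPiece ν b' k = mapPiece ν (b' ∘ₗ b) k := by
  rw [mapPiece, mapPiece, pieceMap_comp_tensMap _ _ (reindex_comp_map b'), tensMap_comp,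
    Category.id_comp, ← PiTensorProduct.map_comp]
  rfl

theorem opF_comp_mapPiece (b : U →ₗ[ℂ] U') (k : ℕ) (u : U) :
    opF ν k u ≫ mapPiece ν b (k + 1) = mapPiece ν b k ≫ opF ν k (b u) := by
  rw [opF_eq, opF_eq, mapPiece, mapPiece, pieceMap_comp_tensMap _ _ (reindex_comp_map b),
    tensMap_comp_pieceMap _ _ (reindex_comp_map b), insertHom, insertHom, tensMap_comp,
    tensMap_comp, Category.id_comp, Category.comp_id]
  congr 2
  ext x
  simp only [LinearMap.compMultilinearMap_apply, LinearMap.comp_apply, insertAt_zero_tprod,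
    PiTensorProduct.map_tprod]
  congr 1
  funext i
  induction i using Fin.cases <;> simp

theorem opE_comp_mapPiece (b : U →ₗ[ℂ] U') (k : ℕ) (f : U' →ₗ[ℂ] ℂ) :
    opE ν k (f ∘ₗ b) ≫ mapPiece ν b k = mapPiece ν b (k + 1) ≫ opE ν k f := by
  rw [opE_eq, opE_eq, mapPiece, mapPiece, Linear.smul_comp, Linear.comp_smul,
    pieceMap_comp_tensMap _ _ (reindex_comp_map b),
    tensMap_comp_pieceMap _ _ (reindex_comp_map b), contractHom, contractHom, tensMap_comp,
    tensMap_comp, Category.id_comp, Category.comp_id]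
  congr 3
  ext x
  simp only [LinearMap.compMultilinearMap_apply, LinearMap.comp_apply, contractAt_zero_tprod,
    PiTensorProduct.map_tprod, map_smul]

theorem opA_comp_mapPiece (b : U →ₗ[ℂ] U') (k : ℕ) (A : U →ₗ[ℂ] U) (A' : U' →ₗ[ℂ] U')
    (h : b ∘ₗ A = A' ∘ₗ b) :
    opA ν k A ≫ mapPiece ν b k = mapPiece ν b k ≫ opA ν k A' := by
  rw [opA_eq, opA_eq, mapPiece, pieceMap_comp_tensMap _ _ (reindex_comp_map b),
    tensMap_comp_pieceMap _ _ (reindex_comp_map b), tensMap_comp, tensMap_comp]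
  congr 2
  ext x
  simp only [LinearMap.compMultilinearMap_apply, LinearMap.comp_apply, diagAct,
    LinearMap.sum_apply, map_sum, actAt_tprod, PiTensorProduct.map_tprod]
  refine Finset.sum_congr rfl fun i _ => ?_
  congr 1
  funext j
  by_cases hj : j = i
  · subst hj
    rw [Function.update_self, Function.update_self]
    exact LinearMap.congr_fun h (x j)
  · rw [Function.update_of_ne hj, Function.update_of_ne hj]

variable {S T W : SplitUnital.{u}} {Y : RepS ν}

variable (ν) in
/-- The morphism of tensor powers given by a linear map of the complements. -/
noncomputable def strictMap (b : S.U →ₗ[ℂ] T.U) : tensorPowerObj ν S ⟶ tensorPowerObj ν T :=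
  indSumDesc (piece ν S.U) (tensorPowerObj ν T) fun k => toSummand ν T k (mapPiece ν b k)

theorem strictMap_toSummand (b : S.U →ₗ[ℂ] T.U) (k : ℕ) (m : Y ⟶ piece ν S.U k) :
    IndLin.secMap (strictMap ν b) Y (toSummand ν S k m) =
      toSummand ν T k (m ≫ mapPiece ν b k) :=
  (secMap_indSumDesc _ _ _ _).trans (map_toSummand _ _ _)

theorem strictMap_id : strictMap ν (LinearMap.id : S.U →ₗ[ℂ] S.U) = 𝟙 _ := by
  refine tensorPower_hom_ext fun k => ?_
  rw [strictMap_toSummand, mapPiece_id, Category.comp_id]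
  rfl

theorem strictMap_comp (b : S.U →ₗ[ℂ] T.U) (b' : T.U →ₗ[ℂ] W.U) :
    strictMap ν b ≫ strictMap ν b' = strictMap ν (b' ∘ₗ b) := by
  refine tensorPower_hom_ext fun k => ?_
  rw [IndLin.secMap_comp, LinearMap.comp_apply, strictMap_toSummand, strictMap_toSummand,
    strictMap_toSummand, Category.assoc, mapPiece_comp]

theorem strictMap_rhoF (b : S.U →ₗ[ℂ] T.U) (u : S.U) (x : (tensorPowerObj ν S).sec Y) :
    IndLin.secMap (strictMap ν b) Y ((tensorPowerObj ν S).secHom Y (rhoF ν S u) x) =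
      (tensorPowerObj ν T).secHom Y (rhoF ν T (b u)) (IndLin.secMap (strictMap ν b) Y x) := by
  induction x using sec_induction with
  | h0 => simp only [map_zero]
  | hs k m => rw [rhoF_toSummand, strictMap_toSummand, strictMap_toSummand, rhoF_toSummand,
      Category.assoc, opF_comp_mapPiece, Category.assoc]
  | ha x y hx hy => simp only [map_add, hx, hy]

theorem strictMap_rhoE (b : S.U →ₗ[ℂ] T.U) (f : T.U →ₗ[ℂ] ℂ) (x : (tensorPowerObj ν S).sec Y) :
    IndLin.secMap (strictMap ν b) Y ((tensorPowerObj ν S).secHom Y (rhoE ν S (f ∘ₗ b)) x) =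
      (tensorPowerObj ν T).secHom Y (rhoE ν T f) (IndLin.secMap (strictMap ν b) Y x) := by
  induction x using sec_induction with
  | h0 => simp only [map_zero]
  | hs k m =>
    cases k with
    | zero => rw [rhoE_toSummand_zero, strictMap_toSummand, rhoE_toSummand_zero, map_zero]
    | succ k => rw [rhoE_toSummand_succ, strictMap_toSummand, strictMap_toSummand,
        rhoE_toSummand_succ, Category.assoc, opE_comp_mapPiece, Category.assoc]
  | ha x y hx hy => simp only [map_add, hx, hy]

theorem strictMap_rhoA (b : S.U →ₗ[ℂ] T.U) (A : S.U →ₗ[ℂ] S.U) (A' : T.U →ₗ[ℂ] T.U)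
    (h : b ∘ₗ A = A' ∘ₗ b) (x : (tensorPowerObj ν S).sec Y) :
    IndLin.secMap (strictMap ν b) Y ((tensorPowerObj ν S).secHom Y (rhoA ν S A) x) =
      (tensorPowerObj ν T).secHom Y (rhoA ν T A') (IndLin.secMap (strictMap ν b) Y x) := by
  induction x using sec_induction with
  | h0 => simp only [map_zero]
  | hs k m => rw [rhoA_toSummand, strictMap_toSummand, strictMap_toSummand, rhoA_toSummand,
      Category.assoc, opA_comp_mapPiece b k A A' h, Category.assoc]
  | ha x y hx hy => simp only [map_add, hx, hy]

theorem strictMap_glAct (b : S.U →ₗ[ℂ] T.U) (A : Module.End ℂ S.V) (B : Module.End ℂ T.V)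
    (hs : glScalar S A = glScalar T B) (hv : b (glVec S A) = glVec T B)
    (hc : glCovec S A = glCovec T B ∘ₗ b) (hu : b ∘ₗ glEndU S A = glEndU T B ∘ₗ b)
    (x : (tensorPowerObj ν S).sec Y) :
    IndLin.secMap (strictMap ν b) Y ((tensorPowerObj ν S).secHom Y (glAct ν S A) x) =
      (tensorPowerObj ν T).secHom Y (glAct ν T B) (IndLin.secMap (strictMap ν b) Y x) := by
  rw [glAct_eq, glAct_eq]
  simp only [map_add, LinearMap.add_apply, map_smul, LinearMap.smul_apply, map_one,
    Module.End.one_apply, hc, strictMap_rhoE, strictMap_rhoF, hv, strictMap_rhoA b _ _ hu, hs]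

end Strict

/-! ### Factorization of the morphisms of tensor powers -/

section Factorization

variable {ν : ℂ} {S T W : SplitUnital.{u}} {Y : RepS ν}

/-- Passing from degree i+1 to degree i contributes the factor i+1, so j steps down from l+j
accumulate the falling factorial. -/
theorem rhoE_pow_toSummand (a : S.U →ₗ[ℂ] ℂ) (l j : ℕ) (m : Y ⟶ piece ν S.U (l + j)) :
    ((tensorPowerObj ν S).secHom Y (rhoE ν S a) ^ j) (toSummand ν S (l + j) m) =
      ((l + j).descFactorial j : ℂ) • toSummand ν S l (m ≫ pieceMap ν (contractIter ν a l j)) := by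
  induction j with
  | zero =>
    rw [pow_zero, Module.End.one_apply, contractIter, pieceMap_id]
    simp
  | succ j ih =>
    have e : contractIter ν a l (j + 1) = contractHom ν 0 a ≫ contractIter ν a l j := rfl
    rw [pow_succ, Module.End.mul_apply, e, ← pieceMap_contractHom_comp]
    refine (congrArg _ (rhoE_toSummand_succ a (l + j) m)).trans ?_
    have hd : ((l + (j + 1)).descFactorial (j + 1) : ℂ) =
        ((l + j).descFactorial j : ℂ) * (((l + j : ℕ) : ℂ) + 1) := by
      rw [← add_assoc, Nat.succ_descFactorial_succ, Nat.cast_mul, mul_comm]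
      push_cast
      rfl
    rw [ih, opE_eq, Linear.comp_smul, Linear.smul_comp, toSummand_smul, smul_smul, hd,
      Category.assoc]

theorem rhoE_pow_toSummand_eq_zero (a : S.U →ₗ[ℂ] ℂ) (k : ℕ) (m : Y ⟶ piece ν S.U k) :
    ((tensorPowerObj ν S).secHom Y (rhoE ν S a) ^ (k + 1)) (toSummand ν S k m) = 0 := by
  induction k with
  | zero => rw [zero_add, pow_one, rhoE_toSummand_zero]
  | succ k ih => rw [pow_succ, Module.End.mul_apply, rhoE_toSummand_succ, ih]

namespace SplitUnital.Hom

/-- The component `U ⟶ U'` of a morphism. -/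
noncomputable def linPart (φ : S ⟶ T) : S.U →ₗ[ℂ] T.U := T.projU ∘ₗ φ.lin ∘ₗ S.U.subtype

/-- The component `U ⟶ ℂ` of a morphism. -/
noncomputable def covecPart (φ : S ⟶ T) : S.U →ₗ[ℂ] ℂ := T.coordOne ∘ₗ φ.lin ∘ₗ S.U.subtype

theorem lin_coe (φ : S ⟶ T) (x : S.U) :
    φ.lin x = covecPart φ x • T.one + (linPart φ x : T.V) :=
  (T.coordOne_smul_add_projU (φ.lin x)).symm

end SplitUnital.Hom

open SplitUnital.Hom

theorem tensorPowerCoeff_eq (φ : S ⟶ T) (l j : ℕ) :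
    tensorPowerCoeff ν φ l (l + j) = ((l + j).choose l : ℂ) •
      (pieceMap ν (contractIter ν (covecPart φ) l j) ≫ mapPiece ν (linPart φ) l) := by
  rw [tensorPowerCoeff, mapPiece, linPart, covecPart]
  rw [pieceMap_sum_mixedAct]

/-- The number binom(l+j, l) of increasing maps is the falling factorial of `rhoE_pow_toSummand`
divided by j!. This turns the combinatorial coefficient into a term of an exponential series. -/
theorem toSummand_tensorPowerCoeff (φ : S ⟶ T) (l j : ℕ) (m : Y ⟶ piece ν S.U (l + j)) :
    toSummand ν T l (m ≫ tensorPowerCoeff ν φ l (l + j)) =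
      IndLin.secMap (strictMap ν (linPart φ)) Y ((j.factorial : ℂ)⁻¹ •
        ((tensorPowerObj ν S).secHom Y (rhoE ν S (covecPart φ)) ^ j)
          (toSummand ν S (l + j) m)) := by
  rw [tensorPowerCoeff_eq, rhoE_pow_toSummand, map_smul, map_smul, strictMap_toSummand, Linear.comp_smul,
    toSummand_smul, smul_smul, Category.assoc]
  congr 1
  have hj : (j.factorial : ℂ) ≠ 0 := Nat.cast_ne_zero.2 (Nat.factorial_ne_zero _)
  rw [Nat.choose_symm_add, Nat.descFactorial_eq_factorial_mul_choose, Nat.cast_mul,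
    inv_mul_cancel_left₀ hj]

theorem tensorPowerMap_toSummand (φ : S ⟶ T) (k : ℕ) (m : Y ⟶ piece ν S.U k) :
    IndLin.secMap (tensorPowerMap ν φ) Y (toSummand ν S k m) =
      IndLin.secMap (strictMap ν (linPart φ)) Y (∑ j ∈ Finset.range (k + 1), (j.factorial : ℂ)⁻¹ •
        ((tensorPowerObj ν S).secHom Y (rhoE ν S (covecPart φ)) ^ j) (toSummand ν S k m)) := by
  have h1 : IndLin.secMap (tensorPowerMap ν φ) Y (toSummand ν S k m) =
      ∑ l ∈ Finset.range (k + 1), toSummand ν T l (m ≫ tensorPowerCoeff ν φ l k) := by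
    refine (secMap_indSumDesc _ _ _ _).trans ?_
    rw [map_sum]
    exact Finset.sum_congr rfl fun l _ => map_toSummand _ _ _
  -- The sum over the target degree l is reindexed by the number j = k - l of contractions.
  rw [h1, map_sum, ← Finset.sum_range_reflect]
  refine Finset.sum_congr rfl fun j hj => ?_
  obtain ⟨l, rfl⟩ := Nat.exists_eq_add_of_le' (Nat.lt_succ_iff.1 (Finset.mem_range.1 hj))
  rw [show l + j + 1 - 1 - j = l by omega, toSummand_tensorPowerCoeff]

/-- The endomorphism of `V` which is `x ↦ x + a(x) 𝟙` on `U`. -/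
noncomputable def shear (a : S.U →ₗ[ℂ] ℂ) : S ⟶ S :=
  SplitUnital.Hom.mk (LinearMap.id + (a ∘ₗ S.projU).smulRight S.one) (by
    simp [S.projU_one])

theorem shear_lin (a : S.U →ₗ[ℂ] ℂ) (v : S.V) :
    (shear a).lin v = v + a (S.projU v) • S.one := rfl

theorem linPart_shear (a : S.U →ₗ[ℂ] ℂ) : linPart (shear a) = LinearMap.id := by
  ext1 x
  change S.projU ((shear a).lin x) = x
  rw [shear_lin, map_add, map_smul, S.projU_one, smul_zero, add_zero, S.projU_coe]

theorem covecPart_shear (a : S.U →ₗ[ℂ] ℂ) : covecPart (shear a) = a := by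
  ext1 x
  change S.coordOne ((shear a).lin x) = a x
  rw [shear_lin, map_add, map_smul, S.coordOne_one, S.coordOne_coe, S.projU_coe, zero_add,
    smul_eq_mul, mul_one]

/-- A shear has identity linear part, so its tensor power is the bare exponential series. On the
k-th summand k+1 terms suffice, as E lowers the degree. -/
theorem isLocallyNilpotentExp_shear (a : S.U →ₗ[ℂ] ℂ) (Y : RepS ν) :
    IsLocallyNilpotentExp ((tensorPowerObj ν S).secHom Y (rhoE ν S a))
      ((tensorPowerObj ν S).secHom Y (tensorPowerMap ν (shear a))) := by
  refine IsLocallyNilpotentExp.of_span (s := fun x => ∃ k m, x = toSummand ν S k m) ?_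
    fun p h0 hs ha x => sec_induction x h0 (fun k m => hs _ ⟨k, m, rfl⟩) ha
  rintro _ ⟨k, m, rfl⟩
  refine ⟨k + 1, rhoE_pow_toSummand_eq_zero a k m, ?_⟩
  refine (tensorPowerMap_toSummand (shear a) k m).trans ?_
  rw [linPart_shear, covecPart_shear, strictMap_id]
  rfl

theorem tensorPowerMap_eq (φ : S ⟶ T) :
    tensorPowerMap ν φ = tensorPowerMap ν (shear (covecPart φ)) ≫ strictMap ν (linPart φ) := by
  refine tensorPower_hom_ext fun k => ?_
  rw [IndLin.secMap_comp, LinearMap.comp_apply, tensorPowerMap_toSummand,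
    tensorPowerMap_toSummand (shear _), linPart_shear, covecPart_shear, strictMap_id]
  rfl

/-- `strictMap` intertwines E_{a∘b} with E_a, hence also their exponentials. -/
theorem strictMap_comp_shear (b : S.U →ₗ[ℂ] T.U) (a : T.U →ₗ[ℂ] ℂ) :
    strictMap ν b ≫ tensorPowerMap ν (shear a) =
      tensorPowerMap ν (shear (a ∘ₗ b)) ≫ strictMap ν b := by
  refine IndLin.hom_ext_sec fun Y => LinearMap.ext fun x => ?_
  exact ((isLocallyNilpotentExp_shear (a ∘ₗ b) Y).comp_eq (isLocallyNilpotentExp_shear a Y)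
    (IndLin.secMap (strictMap ν b) Y) (strictMap_rhoE b a) x).symm

theorem shear_comp_shear (a a' : S.U →ₗ[ℂ] ℂ) :
    tensorPowerMap ν (shear a) ≫ tensorPowerMap ν (shear a') =
      tensorPowerMap ν (shear (a + a')) := by
  refine IndLin.hom_ext_sec fun Y => ?_
  have hc : Commute ((tensorPowerObj ν S).secHom Y (rhoE ν S a'))
      ((tensorPowerObj ν S).secHom Y (rhoE ν S a)) := by
    rw [commute_iff_lie_eq]
    exact (((tensorPowerObj ν S).secHom Y).toLieHom.map_lie (rhoE ν S a') (rhoE ν S a)).symm.trans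
      ((congrArg _ (lie_rhoE_rhoE a' a)).trans (map_zero ((tensorPowerObj ν S).secHom Y)))
  have h := (isLocallyNilpotentExp_shear a' Y).add (isLocallyNilpotentExp_shear (ν := ν) a Y) hc
  rw [← map_add, ← rhoE_add, add_comm] at h
  exact h.unique (isLocallyNilpotentExp_shear (a + a') Y)

theorem linPart_comp (φ : S ⟶ T) (ψ : T ⟶ W) : linPart (φ ≫ ψ) = linPart ψ ∘ₗ linPart φ := by
  ext1 x
  change W.projU (ψ.lin (φ.lin x)) = W.projU (ψ.lin (linPart φ x))
  rw [lin_coe φ, map_add, map_smul, ψ.map_one, map_add, map_smul, W.projU_one, smul_zero, zero_add]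

theorem covecPart_comp (φ : S ⟶ T) (ψ : T ⟶ W) :
    covecPart (φ ≫ ψ) = covecPart φ + covecPart ψ ∘ₗ linPart φ := by
  ext1 x
  change W.coordOne (ψ.lin (φ.lin x)) = covecPart φ x + W.coordOne (ψ.lin (linPart φ x))
  rw [lin_coe φ, map_add, map_smul, ψ.map_one, map_add, map_smul, W.coordOne_one, smul_eq_mul,
    mul_one]

/-- After factoring both morphisms, the shear of ψ is moved past the strict part of φ, where its
functional is pulled back. The two shears then merge, in accordance with `covecPart_comp`. -/
theorem tensorPowerMap_comp (φ : S ⟶ T) (ψ : T ⟶ W) :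
    tensorPowerMap ν (φ ≫ ψ) = tensorPowerMap ν φ ≫ tensorPowerMap ν ψ := by
  rw [tensorPowerMap_eq (φ ≫ ψ), tensorPowerMap_eq φ, tensorPowerMap_eq ψ, linPart_comp,
    covecPart_comp, ← shear_comp_shear, ← strictMap_comp, Category.assoc, Category.assoc,
    ← Category.assoc (strictMap ν (linPart φ)), strictMap_comp_shear, Category.assoc]

theorem tensorPowerMap_id : tensorPowerMap ν (𝟙 S) = 𝟙 (tensorPowerObj ν S) := by
  have hl : linPart (𝟙 S) = LinearMap.id := by
    ext1 x
    exact S.projU_coe x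
  have hc : covecPart (𝟙 S) = 0 := by
    ext1 x
    exact S.coordOne_coe x
  rw [tensorPowerMap_eq, hl, hc, strictMap_id, Category.comp_id]
  have h0 : rhoE ν S 0 = 0 := by
    have := rhoE_smul (ν := ν) (S := S) 0 0
    rwa [zero_smul, zero_smul] at this
  refine IndLin.hom_ext_sec fun Y => ?_
  refine (isLocallyNilpotentExp_shear (ν := ν) (S := S) 0 Y).unique (G' := 1) fun x => ⟨1, ?_, ?_⟩
  · rw [h0, map_zero, pow_one]
    rfl
  · simp

/-! ### Compatibility with the action -/

/-- The nilpotent endomorphism of `V` given by a functional on `U`. -/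
noncomputable def covecEnd (a : S.U →ₗ[ℂ] ℂ) : Module.End ℂ S.V :=
  (a ∘ₗ S.projU).smulRight S.one

theorem covecEnd_apply (a : S.U →ₗ[ℂ] ℂ) (v : S.V) :
    covecEnd a v = a (S.projU v) • S.one := rfl

theorem covecEnd_mul_self (a : S.U →ₗ[ℂ] ℂ) : covecEnd a * covecEnd a = 0 := by
  ext v
  rw [Module.End.mul_apply, covecEnd_apply, covecEnd_apply, map_smul, S.projU_one]
  simp

theorem glAct_covecEnd (a : S.U →ₗ[ℂ] ℂ) : glAct ν S (covecEnd a) = rhoE ν S a := by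
  have h1 : glScalar S (covecEnd a) = 0 := by
    simp [glScalar, covecEnd_apply, S.projU_one]
  have h2 : glVec S (covecEnd a) = 0 := by
    simp [glVec, covecEnd_apply, S.projU_one]
  have h3 : glCovec S (covecEnd a) = a := by
    ext x
    simp [glCovec, covecEnd_apply, S.projU_coe, S.coordOne_one]
  have h4 : glEndU S (covecEnd a) = 0 := by
    ext x
    simp [glEndU, h1, covecEnd_apply, S.projU_one]
  have h5 : rhoF ν S 0 = 0 := by
    have := rhoF_smul (ν := ν) (S := S) 0 0
    rwa [zero_smul, zero_smul] at this
  have h6 : rhoA ν S 0 = 0 := by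
    have := rhoA_smul (ν := ν) (S := S) 0 0
    rwa [zero_smul, zero_smul] at this
  rw [glAct_eq, h1, h2, h3, h4, h5, h6, zero_mul, zero_smul, zero_add, zero_add, add_zero]

/-- `A'` is the conjugate of A by 1 + n = exp(n). The truncated series for it is valid both in gl(V)
and on the tensor power, because the action is a Lie homomorphism that sends n to E_a. -/
theorem shear_glAct (a : S.U →ₗ[ℂ] ℂ) (A : Module.End ℂ S.V) :
    ∃ A' : Module.End ℂ S.V, (shear a).lin ∘ₗ A = A' ∘ₗ (shear a).lin ∧
      glAct ν S A ≫ tensorPowerMap ν (shear a) = tensorPowerMap ν (shear a) ≫ glAct ν S A' := by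
  have hn := covecEnd_mul_self a
  set n := covecEnd a with hn_def
  have hs : (shear a).lin = 1 + n := rfl
  set D₁ := ⁅n, A⁆ with hD1
  set D₂ := ⁅n, D₁⁆ with hD2
  -- Every term of the triple commutator contains n² = 0.
  have hD3 : ⁅n, D₂⁆ = 0 := by
    rw [hD2, hD1, Ring.lie_def, Ring.lie_def, Ring.lie_def]
    have e1 : ∀ x, n * (n * x) = 0 := fun x => by rw [← mul_assoc, hn, zero_mul]
    simp only [mul_sub, sub_mul, mul_assoc, e1, hn, mul_zero, zero_mul]
    abel
  refine ⟨A + D₁ + (2 : ℂ)⁻¹ • D₂, ?_, IndLin.hom_ext_sec fun Y => ?_⟩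
  · rw [hs]
    change (1 + n) * A = (A + D₁ + (2 : ℂ)⁻¹ • D₂) * (1 + n)
    have e1 : ∀ x, n * (n * x) = 0 := fun x => by rw [← mul_assoc, hn, zero_mul]
    have e2 : D₂ = (-2 : ℂ) • (n * (A * n)) := by
      rw [hD2, hD1, Ring.lie_def, Ring.lie_def]
      simp only [mul_sub, sub_mul, mul_assoc, e1, hn, mul_zero]
      module
    rw [e2, hD1, Ring.lie_def]
    simp only [mul_add, add_mul, sub_mul, smul_mul_assoc, mul_assoc, hn, mul_zero, one_mul, mul_one]
    module
  -- Commutators with n in gl(V) become commutators with E_a on sections, which gives the three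
  -- hypotheses of `IsLocallyNilpotentExp.mul_eq`.
  · have key : ∀ B C : Module.End ℂ S.V, ⁅n, B⁆ = C →
        (tensorPowerObj ν S).secHom Y (rhoE ν S a) * (tensorPowerObj ν S).secHom Y (glAct ν S B) =
        (tensorPowerObj ν S).secHom Y (glAct ν S B) * (tensorPowerObj ν S).secHom Y (rhoE ν S a) +
          (tensorPowerObj ν S).secHom Y (glAct ν S C) := by
      rintro B _ rfl
      have h : glAct ν S ⁅n, B⁆ = rhoE ν S a * glAct ν S B - glAct ν S B * rhoE ν S a := by
        rw [← glAct_covecEnd]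
        exact (glActHom ν S).map_lie n B
      rw [← map_mul, ← map_mul, ← map_add, h, add_sub_cancel]
    have h3 := key D₂ 0 hD3
    have h0 : glAct ν S 0 = 0 := map_zero (glActHom ν S)
    rw [h0, map_zero, add_zero] at h3
    have h := (isLocallyNilpotentExp_shear (ν := ν) a Y).mul_eq (key A D₁ rfl) (key D₁ D₂ rfl) h3
    rw [← map_smul, ← map_add, ← map_add] at h
    have e : glAct ν S (A + D₁ + (2 : ℂ)⁻¹ • D₂) =
        glAct ν S A + glAct ν S D₁ + (2 : ℂ)⁻¹ • glAct ν S D₂ := by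
      rw [← glActHom_apply, map_add, map_add, map_smul]
      rfl
    rw [e]
    exact h

/-- The linear map `V ⟶ V'` which respects the splittings and is `b` on `U`. -/
noncomputable def extendLin (b : S.U →ₗ[ℂ] T.U) : S.V →ₗ[ℂ] T.V :=
  S.coordOne.smulRight T.one + T.U.subtype ∘ₗ b ∘ₗ S.projU

theorem extendLin_one (b : S.U →ₗ[ℂ] T.U) : extendLin b S.one = T.one := by
  simp [extendLin, S.coordOne_one, S.projU_one]

theorem extendLin_coe (b : S.U →ₗ[ℂ] T.U) (x : S.U) : extendLin b (x : S.V) = (b x : T.V) := by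
  simp [extendLin, S.coordOne_coe, S.projU_coe]

theorem lin_eq_extendLin_shear (φ : S ⟶ T) (v : S.V) :
    φ.lin v = extendLin (linPart φ) ((shear (covecPart φ)).lin v) := by
  rw [shear_lin, map_add, map_smul, extendLin_one]
  conv_lhs => rw [← S.coordOne_smul_add_projU v]
  have e : extendLin (linPart φ) v = S.coordOne v • T.one + (linPart φ (S.projU v) : T.V) := by
    conv_lhs => rw [← S.coordOne_smul_add_projU v]
    rw [map_add, map_smul, extendLin_one, extendLin_coe]
  rw [e, map_add, map_smul, φ.map_one, lin_coe, add_assoc]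
  congr 1
  exact add_comm _ _

/-- The inverse of 1 + n is 1 - n, since n² = 0. -/
theorem shear_lin_surjective (a : S.U →ₗ[ℂ] ℂ) : Function.Surjective (shear a).lin := fun v =>
  ⟨v - covecEnd a v, by
    rw [map_sub, shear_lin, shear_lin, covecEnd_apply, map_smul, S.projU_one, smul_zero, map_zero,
      zero_smul, add_zero, add_sub_cancel_right]⟩

/-- Evaluating the intertwining relation at 𝟙 and on U, and taking coordinates, matches the four
components of A and B one by one. -/
theorem glAct_comp_strictMap (b : S.U →ₗ[ℂ] T.U) (A : Module.End ℂ S.V) (B : Module.End ℂ T.V)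
    (h : ∀ v, extendLin b (A v) = B (extendLin b v)) :
    glAct ν S A ≫ strictMap ν b = strictMap ν b ≫ glAct ν T B := by
  have h1 : glScalar T B • T.one + (glVec T B : T.V) =
      glScalar S A • T.one + (b (glVec S A) : T.V) := by
    rw [← apply_one_eq B, ← extendLin_one b, ← h, apply_one_eq A, map_add, map_smul, extendLin_coe]
  have h2 : ∀ x, glCovec T B (b x) • T.one +
      ((glEndU T B (b x) + glScalar T B • b x : T.U) : T.V) =
      glCovec S A x • T.one + (b (glEndU S A x + glScalar S A • x) : T.V) := by
    intro x
    rw [← apply_coe_eq B, ← extendLin_coe b, ← h, apply_coe_eq A, map_add, map_smul,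
      extendLin_coe, extendLin_one]
  have hs : glScalar S A = glScalar T B := by
    have := congrArg T.coordOne h1
    simp only [map_add, map_smul, T.coordOne_one, T.coordOne_coe, smul_eq_mul, mul_one,
      add_zero] at this
    exact this.symm
  have hv : b (glVec S A) = glVec T B := by
    have := congrArg T.projU h1
    simp only [map_add, map_smul, T.projU_one, T.projU_coe, smul_zero, zero_add] at this
    exact this.symm
  have hc : glCovec S A = glCovec T B ∘ₗ b := by
    ext1 x
    have := congrArg T.coordOne (h2 x)
    rw [map_add, map_add, map_smul, map_smul, T.coordOne_one, T.coordOne_coe, T.coordOne_coe,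
      smul_eq_mul, smul_eq_mul, mul_one, mul_one, add_zero, add_zero] at this
    exact this.symm
  have hu : b ∘ₗ glEndU S A = glEndU T B ∘ₗ b := by
    ext1 x
    have := congrArg T.projU (h2 x)
    rw [map_add, map_add, map_smul, map_smul, T.projU_one, T.projU_coe, T.projU_coe, smul_zero,
      smul_zero, zero_add, zero_add, hs, map_add, map_smul] at this
    exact (add_right_cancel this).symm
  exact IndLin.hom_ext_sec fun Y => LinearMap.ext fun x => strictMap_glAct b A B hs hv hc hu x

/-- A morphism which intertwines `A` and `B` intertwines their actions on the tensor powers. -/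
theorem glAct_comp_tensorPowerMap (φ : S ⟶ T) (A : Module.End ℂ S.V) (B : Module.End ℂ T.V)
    (h : φ.lin ∘ₗ A = B ∘ₗ φ.lin) :
    glAct ν S A ≫ tensorPowerMap ν φ = tensorPowerMap ν φ ≫ glAct ν T B := by
  obtain ⟨A', hA', hcomm⟩ := shear_glAct (ν := ν) (covecPart φ) A
  have hβ : ∀ v, extendLin (linPart φ) (A' v) = B (extendLin (linPart φ) v) := by
    intro v
    -- The strict part of φ intertwines A' and B on the image of the shear, which is all of V.
    obtain ⟨w, rfl⟩ := shear_lin_surjective (covecPart φ) v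
    have e1 := LinearMap.congr_fun hA' w
    rw [LinearMap.comp_apply, LinearMap.comp_apply] at e1
    rw [← e1, ← lin_eq_extendLin_shear, ← lin_eq_extendLin_shear]
    exact LinearMap.congr_fun h w
  rw [tensorPowerMap_eq φ, ← Category.assoc, hcomm, Category.assoc,
    glAct_comp_strictMap (linPart φ) A' B hβ, Category.assoc]

end Factorization

/-! ### Exponentials in finite-dimensional algebras -/

section AlgExp

variable {B B' : Type*} [Ring B] [Algebra ℂ B] [Ring B'] [Algebra ℂ B']

/-- `g = exp(a)`, with convergence tested by linear functionals. -/
def IsAlgExp (a g : B) : Prop :=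
  ∀ l : B →ₗ[ℂ] ℂ, HasSum (fun n : ℕ => (n.factorial : ℂ)⁻¹ * l (a ^ n)) (l g)

theorem IsAlgExp.map {a g : B} (h : IsAlgExp a g) (F : B →ₐ[ℂ] B') : IsAlgExp (F a) (F g) := by
  intro l
  simpa using h (l ∘ₗ F.toLinearMap)

theorem IsAlgExp.zero : IsAlgExp (0 : B) 1 := by
  intro l
  convert hasSum_single (f := fun n : ℕ => (n.factorial : ℂ)⁻¹ * l ((0 : B) ^ n)) 0
    (fun n hn => by simp [hn]) using 1
  simp

theorem IsAlgExp.unique {a g g' : B} (h : IsAlgExp a g) (h' : IsAlgExp a g') : g = g' := by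
  rw [← sub_eq_zero, ← Module.forall_dual_apply_eq_zero_iff ℂ]
  intro l
  rw [map_sub, sub_eq_zero]
  exact (h l).unique (h' l)

section Matrix

open scoped Matrix.Norms.Operator

variable {n : Type*} [Fintype n] [DecidableEq n]

theorem isAlgExp_matrix (a : Matrix n n ℂ) : IsAlgExp a (NormedSpace.exp a) := by
  intro l
  have h := NormedSpace.exp_series_hasSum_exp' (𝕂 := ℂ) a
  convert h.map l (LinearMap.continuous_of_finiteDimensional l) using 1
  · funext k
    rw [Function.comp_apply, map_smul, smul_eq_mul]
  · rfl

end Matrix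

section EndAlg

variable {W : Type*} [AddCommGroup W] [Module ℂ W] [FiniteDimensional ℂ W]

theorem exists_isAlgExp (a : Module.End ℂ W) : ∃ g, IsAlgExp a g := by
  let e := LinearMap.toMatrixAlgEquiv (Module.finBasis ℂ W)
  refine ⟨e.symm (NormedSpace.exp (e a)), ?_⟩
  simpa using (isAlgExp_matrix (e a)).map e.symm.toAlgHom

theorem IsAlgExp.add {a b g h : Module.End ℂ W} (hg : IsAlgExp a g) (hh : IsAlgExp b h)
    (hab : Commute a b) : IsAlgExp (a + b) (g * h) := by
  let e := LinearMap.toMatrixAlgEquiv (Module.finBasis ℂ W)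
  have h1 : e g = NormedSpace.exp (e a) := (hg.map e.toAlgHom).unique (isAlgExp_matrix _)
  have h2 : e h = NormedSpace.exp (e b) := (hh.map e.toAlgHom).unique (isAlgExp_matrix _)
  have h3 := isAlgExp_matrix (e (a + b))
  rw [map_add, Matrix.exp_add_of_commute _ _ (hab.map e), ← h1, ← h2, ← map_mul, ← map_add] at h3
  simpa using h3.map e.symm.toAlgHom

theorem IsAlgExp.isLocallyFiniteExp {a g : Module.End ℂ W} (h : IsAlgExp a g) :
    IsLocallyFiniteExp a g := fun x =>
  ⟨⟨⊤, inferInstance, trivial, fun _ _ => trivial⟩, fun l => h (l ∘ₗ LinearMap.applyₗ x)⟩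

theorem IsAlgExp.apply_eq_self {a g : Module.End ℂ W} (h : IsAlgExp a g) {x : W} (hx : a x = 0) :
    g x = x := by
  rw [← sub_eq_zero, ← Module.forall_dual_apply_eq_zero_iff ℂ]
  intro l
  rw [map_sub, sub_eq_zero]
  refine (h (l ∘ₗ LinearMap.applyₗ x)).unique ?_
  convert hasSum_single (f := fun n : ℕ => (n.factorial : ℂ)⁻¹ * (l ∘ₗ LinearMap.applyₗ x) (a ^ n))
    0 (fun n hn => ?_) using 1
  · simp
  · obtain ⟨n, rfl⟩ := Nat.exists_eq_succ_of_ne_zero hn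
    simp [pow_succ, hx]

end EndAlg

end AlgExp

/-! ### Exponential of the diagonal action on a tensor power -/

section DiagExp

variable {U : Type*} [AddCommGroup U] [Module ℂ U] [FiniteDimensional ℂ U]

/-- Operators at different positions commute, so the exponential of their sum is the product of the
exponentials; positions are added one at a time. -/
theorem isAlgExp_sum_actAt {a g : Module.End ℂ U} (h : IsAlgExp a g) {k : ℕ} (s : Finset (Fin k)) :
    IsAlgExp (∑ i ∈ s, actAt i a : Module.End ℂ (TPow U k))
      (PiTensorProduct.map fun i => if i ∈ s then g else LinearMap.id) := by
  induction s using Finset.induction_on with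
  | empty =>
    simp only [Finset.sum_empty, Finset.notMem_empty, if_false]
    rw [PiTensorProduct.map_id]
    exact IsAlgExp.zero
  | insert i s hi ih =>
    rw [Finset.sum_insert hi]
    have h1 := (h.map (actAtHom U (k := k) i)).add ih (Commute.sum_right s _ _ fun j hj =>
      actAt_comm (fun e => hi (by rw [e]; exact hj)) a a)
    refine (congrArg (IsAlgExp _) ?_).mp h1
    change actAt i g ∘ₗ _ = _
    rw [actAt, ← PiTensorProduct.map_comp]
    congr 1
    funext j
    by_cases hj : j = i
    · subst hj
      simp [hi]
    · simp [hj]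

theorem isAlgExp_diagAct {a g : Module.End ℂ U} (h : IsAlgExp a g) (k : ℕ) :
    IsAlgExp (diagAct k a : Module.End ℂ (TPow U k)) (PiTensorProduct.map fun _ => g) := by
  have := isAlgExp_sum_actAt h (Finset.univ : Finset (Fin k))
  simp only [Finset.mem_univ, if_true] at this
  exact this

end DiagExp

/-! ### Permanence of locally finite exponentials -/

namespace IsLocallyFiniteExp

variable {M M' : Type*} [AddCommGroup M] [Module ℂ M] [AddCommGroup M'] [Module ℂ M']

/-- The image of a stable finite-dimensional subspace is one again, and functionals on the quotient
pull back. This lets the integration statement descend from V ⊕ ℂ to V. -/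
theorem of_surjective {T g : M →ₗ[ℂ] M} {T' g' : M' →ₗ[ℂ] M'} (h : IsLocallyFiniteExp T g)
    (p : M →ₗ[ℂ] M') (hp : Function.Surjective p) (hT : ∀ x, p (T x) = T' (p x))
    (hg : ∀ x, p (g x) = g' (p x)) : IsLocallyFiniteExp T' g' := by
  intro x'
  obtain ⟨x, rfl⟩ := hp x'
  obtain ⟨⟨N, hN, hx, hs⟩, hl⟩ := h x
  refine ⟨⟨N.map p, inferInstance, Submodule.mem_map_of_mem hx, ?_⟩, fun l => ?_⟩
  · rintro _ ⟨y, hy, rfl⟩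
    exact ⟨T y, hs y hy, hT y⟩
  · have hn : ∀ n : ℕ, p ((T ^ n) x) = (T' ^ n) (p x) := by
      intro n
      induction n with
      | zero => rfl
      | succ n ih => rw [pow_succ', pow_succ', Module.End.mul_apply, Module.End.mul_apply, hT, ih]
    simpa [hn, hg] using hl (l ∘ₗ p)

theorem of_span {T g : M →ₗ[ℂ] M} {s : M → Prop}
    (hs : ∀ x, s x → (∃ N : Submodule ℂ M, FiniteDimensional ℂ N ∧ x ∈ N ∧ ∀ y ∈ N, T y ∈ N) ∧
      ∀ l : M →ₗ[ℂ] ℂ, HasSum (fun n : ℕ => (n.factorial : ℂ)⁻¹ * l ((T ^ n) x)) (l (g x)))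
    (hspan : ∀ p : M → Prop, p 0 → (∀ x, s x → p x) → (∀ x y, p x → p y → p (x + y)) → ∀ x, p x) :
    IsLocallyFiniteExp T g := by
  refine hspan _ ⟨⟨⊥, inferInstance, zero_mem _, ?_⟩, fun l => ?_⟩ hs ?_
  · intro y hy
    rw [(Submodule.mem_bot ℂ).1 hy, map_zero]
    exact zero_mem _
  · simp
  · rintro x y ⟨⟨N, hN, hx, hT⟩, hl⟩ ⟨⟨N', hN', hy, hT'⟩, hl'⟩
    refine ⟨⟨N ⊔ N', inferInstance, Submodule.add_mem_sup hx hy, fun z hz => ?_⟩, fun l => ?_⟩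
    · obtain ⟨a, ha, b, hb, rfl⟩ := Submodule.mem_sup.1 hz
      rw [map_add]
      exact Submodule.add_mem_sup (hT a ha) (hT' b hb)
    · simpa [mul_add] using (hl l).add (hl' l)

end IsLocallyFiniteExp

/-! ### Integration of the mirabolic action -/

section Integration

open SplitUnital SplitUnital.Hom

variable {ν : ℂ} {S : SplitUnital.{u}}

/-- `f ↦ m ≫ (f ⊗ id)`, into the `k`-th summand. -/
noncomputable def orbitMap {Y : RepS ν} {k : ℕ} (m : Y ⟶ piece ν S.U k) :
    Module.End ℂ (TPow S.U k) →ₗ[ℂ] (tensorPowerObj ν S).sec Y where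
  toFun f := toSummand ν S k (m ≫ pieceMap ν (tensMap f (𝟙 (Delta ν k))))
  map_add' f g := by
    rw [tensMap_add_left, pieceMap_add, Preadditive.comp_add, toSummand_add]
  map_smul' c f := by
    rw [tensMap_smul_left, pieceMap_smul, Linear.comp_smul, toSummand_smul, RingHom.id_apply]

theorem orbitMap_apply {Y : RepS ν} {k : ℕ} (m : Y ⟶ piece ν S.U k)
    (f : Module.End ℂ (TPow S.U k)) :
    orbitMap m f = toSummand ν S k (m ≫ pieceMap ν (tensMap f (𝟙 (Delta ν k)))) := rfl

theorem orbitMap_one {Y : RepS ν} {k : ℕ} (m : Y ⟶ piece ν S.U k) :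
    orbitMap m 1 = toSummand ν S k m := by
  rw [orbitMap_apply, Module.End.one_eq_id, tensMap_id, pieceMap_id, Category.comp_id]

theorem rhoA_orbitMap {Y : RepS ν} {k : ℕ} (m : Y ⟶ piece ν S.U k) (A : S.U →ₗ[ℂ] S.U)
    (f : Module.End ℂ (TPow S.U k)) :
    IndLin.secMap (rhoA ν S A) Y (orbitMap m f) = orbitMap m (diagAct k A * f) := by
  refine (rhoA_toSummand A k _).trans ?_
  rw [Category.assoc, opA_eq, pieceMap_comp_tensMap _ _ fun σ => reindex_comp_diagAct σ A, tensMap_comp, Category.comp_id]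
  rfl

/-- A section m of a summand lies in the range of `orbitMap m`, an image of the finite-dimensional
algebra End(U^{⊗k}). There A acts by left multiplication with its diagonal action, so the
exponential may be taken in that algebra. -/
theorem isLocallyFiniteExp_rhoA {A g : Module.End ℂ S.U} (h : IsAlgExp A g) (Y : RepS ν) :
    IsLocallyFiniteExp (IndLin.secMap (rhoA ν S A) Y) (IndLin.secMap (strictMap ν g) Y) := by
  refine IsLocallyFiniteExp.of_span (s := fun x => ∃ k m, x = toSummand ν S k m) ?_
    fun p h0 hs ha x => sec_induction x h0 (fun k m => hs _ ⟨k, m, rfl⟩) ha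
  rintro _ ⟨k, m, rfl⟩
  refine ⟨⟨LinearMap.range (orbitMap m), inferInstance, ⟨1, orbitMap_one m⟩, ?_⟩, fun l => ?_⟩
  · rintro _ ⟨f, rfl⟩
    exact ⟨_, (rhoA_orbitMap m A f).symm⟩
  · have hn : ∀ n : ℕ, (IndLin.secMap (rhoA ν S A) Y ^ n) (toSummand ν S k m) =
        orbitMap m ((diagAct k A : Module.End ℂ (TPow S.U k)) ^ n) := by
      intro n
      induction n with
      | zero => exact (orbitMap_one m).symm
      | succ n ih => rw [pow_succ', Module.End.mul_apply, ih, rhoA_orbitMap, ← pow_succ']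
    simp only [hn]
    rw [strictMap_toSummand]
    exact isAlgExp_diagAct h k (l ∘ₗ orbitMap m)

theorem shear_zero : shear (0 : S.U →ₗ[ℂ] ℂ) = 𝟙 S := by
  refine SplitUnital.Hom.ext (LinearMap.ext fun v => ?_)
  rw [shear_lin, LinearMap.zero_apply, zero_smul, add_zero]
  rfl

theorem tensorPowerMap_of_covecPart_eq_zero {T : SplitUnital.{u}} (φ : S ⟶ T)
    (h : covecPart φ = 0) : tensorPowerMap ν φ = strictMap ν (linPart φ) := by
  rw [tensorPowerMap_eq, h, shear_zero, tensorPowerMap_id, Category.id_comp]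

/-- The split unital vector space `V ⊕ ℂ`. -/
noncomputable def adjoinOne (S : SplitUnital.{u}) : SplitUnital.{u} where
  V := S.V × ℂ
  one := (0, 1)
  one_ne_zero h := one_ne_zero (congrArg Prod.snd h)
  U := LinearMap.ker (LinearMap.snd ℂ S.V ℂ)
  isCompl := by
    refine IsCompl.of_eq ?_ ?_
    · rw [eq_bot_iff]
      rintro x ⟨hx, hx2⟩
      obtain ⟨c, rfl⟩ := Submodule.mem_span_singleton.1 hx
      have : c * 1 = 0 := hx2
      rw [mul_one] at this
      rw [this, zero_smul]
      exact zero_mem _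
    · rw [eq_top_iff]
      rintro ⟨v, c⟩ -
      refine Submodule.mem_sup.2 ⟨(0, c), Submodule.mem_span_singleton.2 ⟨c, by simp⟩, (v, 0), ?_,
        by simp⟩
      exact LinearMap.mem_ker.2 rfl

/-- `V` as the distinguished complement in `V ⊕ ℂ`. -/
noncomputable def adjoinOneEquiv (S : SplitUnital.{u}) : S.V ≃ₗ[ℂ] (adjoinOne S).U where
  toFun v := ⟨(v, 0), (LinearMap.mem_ker (f := LinearMap.snd ℂ S.V ℂ)).2 rfl⟩
  map_add' _ _ := Subtype.ext (Prod.ext rfl (add_zero (0 : ℂ)).symm)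
  map_smul' c _ := Subtype.ext (Prod.ext rfl (mul_zero c).symm)
  invFun x := x.1.1
  left_inv _ := rfl
  right_inv x := Subtype.ext (Prod.ext rfl ((LinearMap.mem_ker (f := LinearMap.snd ℂ S.V ℂ)).1 x.2).symm)

/-- The morphism `V ⊕ ℂ ⟶ V` which is the identity on `V`. -/
noncomputable def foldOne (S : SplitUnital.{u}) : adjoinOne S ⟶ S :=
  SplitUnital.Hom.mk (S := adjoinOne S)
    (LinearMap.coprod LinearMap.id (LinearMap.toSpanSingleton ℂ S.V S.one) :
      S.V × ℂ →ₗ[ℂ] S.V) (by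
      change (0 : S.V) + (1 : ℂ) • S.one = S.one
      rw [one_smul, zero_add])

/-- A section of the morphism `V ⊕ ℂ ⟶ V`. -/
noncomputable def sectionOne (S : SplitUnital.{u}) : S ⟶ adjoinOne S :=
  SplitUnital.Hom.mk (T := adjoinOne S) (LinearMap.prod (S.U.subtype ∘ₗ S.projU) S.coordOne :
      S.V →ₗ[ℂ] S.V × ℂ) (by
    change ((S.projU S.one : S.V), S.coordOne S.one) = (0, 1)
    rw [S.projU_one, S.coordOne_one]
    rfl)

theorem sectionOne_comp_foldOne : sectionOne S ≫ foldOne S = 𝟙 S := by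
  refine SplitUnital.Hom.ext (LinearMap.ext fun v => ?_)
  change (S.projU v : S.V) + S.coordOne v • S.one = v
  rw [add_comm, S.coordOne_smul_add_projU]

/-- The endomorphism `G ⊕ id` of `V ⊕ ℂ`. -/
noncomputable def adjoinOneMap (G : Module.End ℂ S.V) : adjoinOne S ⟶ adjoinOne S :=
  SplitUnital.Hom.mk (S := adjoinOne S) (T := adjoinOne S) (LinearMap.prodMap G LinearMap.id :
      S.V × ℂ →ₗ[ℂ] S.V × ℂ) (by
    change (G 0, (1 : ℂ)) = (0, 1)
    rw [map_zero])

/-- The endomorphism `φ ⊕ 0` of `V ⊕ ℂ`. -/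
noncomputable def adjoinOneEnd (φ : Module.End ℂ S.V) : Module.End ℂ (adjoinOne S).V :=
  (LinearMap.prodMap φ 0 : S.V × ℂ →ₗ[ℂ] S.V × ℂ)

/-- The endomorphism φ ⊕ 0 kills the new unit and preserves the complement V, so only its
gl(V)-component acts; likewise G ⊕ id has no component towards the unit. The claim is thus the
diagonal case. -/
theorem isLocallyFiniteExp_adjoinOne {φ G : Module.End ℂ S.V} (h : IsAlgExp φ G) (Y : RepS ν) :
    IsLocallyFiniteExp
      (IndLin.secMap (glAct ν (adjoinOne S) (adjoinOneEnd φ)) Y)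
      (IndLin.secMap (tensorPowerMap ν (adjoinOneMap G)) Y) := by
  let e := adjoinOneEquiv S
  let A : Module.End ℂ (adjoinOne S).V := adjoinOneEnd φ
  have hA1 : A (adjoinOne S).one = 0 := Prod.ext (map_zero φ) rfl
  have hA : ∀ x : (adjoinOne S).U, A x = (e.conjAlgEquiv ℂ φ x : (adjoinOne S).V) := fun x => rfl
  have hG : ∀ x : (adjoinOne S).U, (adjoinOneMap G).lin x =
      (e.conjAlgEquiv ℂ G x : (adjoinOne S).V) := fun x => by
    refine Prod.ext rfl ?_
    exact LinearMap.mem_ker.1 x.2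
  have h1 : glAct ν (adjoinOne S) A = rhoA ν (adjoinOne S) (e.conjAlgEquiv ℂ φ) := by
    have e1 : glScalar (adjoinOne S) A = 0 := by rw [glScalar, hA1, map_zero]
    have e2 : glVec (adjoinOne S) A = 0 := by rw [glVec, hA1, map_zero]
    have e3 : glCovec (adjoinOne S) A = 0 := by
      ext x
      change (adjoinOne S).coordOne (A x) = 0
      rw [hA, coordOne_coe]
    have e4 : glEndU (adjoinOne S) A = e.conjAlgEquiv ℂ φ := by
      rw [glEndU, e1, zero_smul, sub_zero]
      ext1 x
      change (adjoinOne S).projU (A x) = _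
      rw [hA, projU_coe]
    have z1 : rhoF ν (adjoinOne S) 0 = 0 := by
      simpa using rhoF_smul (ν := ν) (S := adjoinOne S) 0 0
    have z2 : rhoE ν (adjoinOne S) 0 = 0 := by
      simpa using rhoE_smul (ν := ν) (S := adjoinOne S) 0 0
    rw [glAct_eq, e1, e2, e3, e4, z1, z2]
    simp
  have h2 : tensorPowerMap ν (adjoinOneMap G) =
      strictMap ν (S := adjoinOne S) (T := adjoinOne S) (e.conjAlgEquiv ℂ G) := by
    rw [tensorPowerMap_of_covecPart_eq_zero]
    · congr 1
      ext1 x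
      change (adjoinOne S).projU ((adjoinOneMap G).lin x) = _
      rw [hG, projU_coe]
    · ext1 x
      change (adjoinOne S).coordOne ((adjoinOneMap G).lin x) = _
      rw [hG, coordOne_coe]
      rfl
  change IsLocallyFiniteExp (IndLin.secMap (glAct ν (adjoinOne S) A) Y) _
  rw [h1, h2]
  exact isLocallyFiniteExp_rhoA (h.map (e.conjAlgEquiv ℂ).toAlgHom) Y

/-- In V itself φ mixes E_f with the action of gl(U). Over V ⊕ ℂ the two merge into a diagonal
action, and the split surjection `foldOne` brings the result back. -/
theorem exists_isLocallyFiniteExp_tensorPowerMap (φ : Module.End ℂ S.V) (hφ : φ S.one = 0) :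
    ∃ g : S ⟶ S, IsLocallyFiniteExp φ g.lin ∧ ∀ Y : RepS ν,
      IsLocallyFiniteExp (IndLin.secMap (glAct ν S φ) Y)
        (IndLin.secMap (tensorPowerMap ν g) Y) := by
  obtain ⟨G, hG⟩ := exists_isAlgExp φ
  have hG1 : G S.one = S.one := hG.apply_eq_self hφ
  let g : S ⟶ S := SplitUnital.Hom.mk G hG1
  refine ⟨g, hG.isLocallyFiniteExp, fun Y => ?_⟩
  refine (isLocallyFiniteExp_adjoinOne hG Y).of_surjective
    (IndLin.secMap (tensorPowerMap ν (foldOne S)) Y) (fun x => ?_) (fun x => ?_) (fun x => ?_)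
  · refine ⟨IndLin.secMap (tensorPowerMap ν (sectionOne S)) Y x, ?_⟩
    rw [← LinearMap.comp_apply, ← IndLin.secMap_comp, ← tensorPowerMap_comp,
      sectionOne_comp_foldOne, tensorPowerMap_id, IndLin.secMap_id, LinearMap.id_apply]
  · rw [← LinearMap.comp_apply, ← IndLin.secMap_comp, ← LinearMap.comp_apply, ← IndLin.secMap_comp]
    -- The fold sends the new unit to 𝟙, so it intertwines φ ⊕ 0 with φ exactly because φ(𝟙) = 0.
    rw [glAct_comp_tensorPowerMap (foldOne S) (adjoinOneEnd φ) φ]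
    refine LinearMap.ext fun v => ?_
    change φ v.1 + (0 : ℂ) • S.one = φ (v.1 + v.2 • S.one)
    rw [map_add, map_smul, hφ, zero_smul, smul_zero]
  · rw [← LinearMap.comp_apply, ← IndLin.secMap_comp, ← LinearMap.comp_apply, ← IndLin.secMap_comp,
      ← tensorPowerMap_comp, ← tensorPowerMap_comp]
    congr 3
    refine SplitUnital.Hom.ext (LinearMap.ext fun v => ?_)
    change G v.1 + v.2 • S.one = G (v.1 + v.2 • S.one)
    rw [map_add, map_smul, hG1]

end Integration

/-! ### The action on the tensor power is of parabolic type -/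

section FiniteHom

variable {ν : ℂ}

instance finiteDimensional_deltaHom (X Y : DeltaCat ν) : FiniteDimensional ℂ (X ⟶ Y) :=
  inferInstanceAs (FiniteDimensional ℂ (Diag X.k Y.k → ℂ))

instance finiteDimensional_matHom (X Y : Mat_ (DeltaCat ν)) : FiniteDimensional ℂ (X ⟶ Y) :=
  inferInstanceAs (FiniteDimensional ℂ (∀ (i : X.ι) (j : Y.ι), X.X i ⟶ Y.X j))

instance finiteDimensional_repSHom (X Y : RepS ν) : FiniteDimensional ℂ (X ⟶ Y) :=
  FiniteDimensional.of_injective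
    ({ toFun := fun f => f.f, map_add' := fun _ _ => rfl, map_smul' := fun _ _ => rfl } :
      (X ⟶ Y) →ₗ[ℂ] (X.X ⟶ Y.X))
    fun _ _ h => Idempotents.Karoubi.Hom.ext h

end FiniteHom

/-! ### Local finiteness and the degree -/

section LocallyFinite

open SplitUnital

variable {ν : ℂ} {S : SplitUnital.{u}}

variable (ν S) in
/-- The sections of the sum of the first `N` summands. -/
noncomputable def truncation (Y : RepS ν) (N : ℕ) : Submodule ℂ ((tensorPowerObj ν S).sec Y) :=
  ⨆ k : Fin N, LinearMap.range (toSummandLin ν S k Y)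

instance (Y : RepS ν) (N : ℕ) : FiniteDimensional ℂ (truncation ν S Y N) :=
  Submodule.finiteDimensional_iSup _

theorem toSummand_mem_truncation {Y : RepS ν} {N k : ℕ} (h : k < N) (m : Y ⟶ piece ν S.U k) :
    toSummand ν S k m ∈ truncation ν S Y N :=
  Submodule.mem_iSup_of_mem (⟨k, h⟩ : Fin N) ⟨m, rfl⟩

theorem truncation_mono {Y : RepS ν} {N N' : ℕ} (h : N ≤ N') :
    truncation ν S Y N ≤ truncation ν S Y N' :=
  iSup_le fun k => by
    rintro _ ⟨m, rfl⟩
    exact toSummand_mem_truncation (k.2.trans_le h) m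

theorem exists_mem_truncation {Y : RepS ν} (x : (tensorPowerObj ν S).sec Y) :
    ∃ N, x ∈ truncation ν S Y N := by
  induction x using sec_induction with
  | h0 => exact ⟨0, zero_mem _⟩
  | hs k m => exact ⟨k + 1, toSummand_mem_truncation k.lt_succ_self m⟩
  | ha x y hx hy =>
    obtain ⟨N, hN⟩ := hx
    obtain ⟨N', hN'⟩ := hy
    exact ⟨max N N', add_mem (truncation_mono (le_max_left _ _) hN)
      (truncation_mono (le_max_right _ _) hN')⟩

/-- E lowers the summand by one and kills the summand 0, so it never leaves the first N summands.
Their sections form a finite-dimensional space. -/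
theorem rhoE_mem_truncation {Y : RepS ν} {N : ℕ} (f : S.U →ₗ[ℂ] ℂ)
    {x : (tensorPowerObj ν S).sec Y} (hx : x ∈ truncation ν S Y N) :
    (tensorPowerObj ν S).secHom Y (rhoE ν S f) x ∈ truncation ν S Y N := by
  refine (iSup_le (a := (truncation ν S Y N).comap
    ((tensorPowerObj ν S).secHom Y (rhoE ν S f))) fun k => ?_ : truncation ν S Y N ≤ _) hx
  obtain ⟨k, hk⟩ := k
  rintro _ ⟨m, rfl⟩
  rw [Submodule.mem_comap]
  cases k with
  | zero =>
    refine (rhoE_toSummand_zero f m).symm ▸ zero_mem _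
  | succ k =>
    refine (rhoE_toSummand_succ f k m).symm ▸ toSummand_mem_truncation (by omega) _

theorem glAct_eq_rhoE {φ : Module.End ℂ S.V} (h1 : LinearMap.range φ ≤ ℂ ∙ S.one)
    (h2 : ℂ ∙ S.one ≤ LinearMap.ker φ) : glAct ν S φ = rhoE ν S (glCovec S φ) := by
  have h3 : φ S.one = 0 := h2 (Submodule.mem_span_singleton_self _)
  have h4 : ∀ v, S.projU (φ v) = 0 := fun v => by
    obtain ⟨c, hc⟩ := Submodule.mem_span_singleton.1 (h1 ⟨v, rfl⟩)
    rw [← hc, map_smul, S.projU_one, smul_zero]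
  have e1 : glScalar S φ = 0 := by rw [glScalar, h3, map_zero]
  have e2 : glVec S φ = 0 := h4 _
  have e3 : glEndU S φ = 0 := by
    rw [glEndU, e1, zero_smul, sub_zero]
    exact LinearMap.ext fun x => h4 x
  have z1 : rhoF ν S 0 = 0 := by simpa using rhoF_smul (ν := ν) (S := S) 0 0
  have z2 : rhoA ν S 0 = 0 := by simpa using rhoA_smul (ν := ν) (S := S) 0 0
  rw [glAct_eq, e1, e2, e3, z1, z2]
  simp

theorem glAct_one : glAct ν S 1 = ν • (1 : End (tensorPowerObj ν S)) := by
  have e1 : glScalar S 1 = 1 := S.coordOne_one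
  have e2 : glVec S 1 = 0 := S.projU_one
  have e3 : glCovec S 1 = 0 := LinearMap.ext fun x => S.coordOne_coe x
  have e4 : glEndU S 1 = 0 := by
    rw [glEndU, e1, one_smul, sub_eq_zero]
    exact LinearMap.ext fun x => S.projU_coe x
  have z1 : rhoF ν S 0 = 0 := by simpa using rhoF_smul (ν := ν) (S := S) 0 0
  have z2 : rhoE ν S 0 = 0 := by simpa using rhoE_smul (ν := ν) (S := S) 0 0
  have z3 : rhoA ν S 0 = 0 := by simpa using rhoA_smul (ν := ν) (S := S) 0 0
  rw [glAct_eq, e1, e2, e3, e4, z1, z2, z3]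
  simp

end LocallyFinite

/-! ### Comparison of two splittings -/

section Splittings

variable {ν : ℂ} {V : Type u} [AddCommGroup V] [Module ℂ V] {one : V}

theorem ActsPolynomially.of_iso {R : Splitting one} {X X' : IndLin (RepS ν)}
    {ρ : Module.End ℂ V →ₗ⁅ℂ⁆ End X} {ρ' : Module.End ℂ V →ₗ⁅ℂ⁆ End X'}
    (h : ActsPolynomially ν R X ρ) (e : X ≅ X') (he : ∀ A, ρ A ≫ e.hom = e.hom ≫ ρ' A) :
    ActsPolynomially ν R X' ρ' := by
  obtain ⟨I, Y, E, j, hj, hρ⟩ := h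
  refine ⟨I, Y, E, fun i => Linear.rightComp ℂ (Y i) e.hom ∘ₗ j i, fun Z => ?_, fun i A x => ?_⟩
  · have h1 : Function.Bijective fun f : X' ⟶ Z => e.hom ≫ f :=
      ⟨fun f g hfg => (cancel_epi e.hom).1 hfg, fun f => ⟨e.inv ≫ f, e.hom_inv_id_assoc f⟩⟩
    convert (hj Z).comp h1 using 1
    funext f i
    refine LinearMap.ext fun x => ?_
    exact (Category.assoc (j i x) e.hom f).symm
  · change j i ((E i).act A x) ≫ e.hom = (j i x ≫ e.hom) ≫ ρ' (R.extend A)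
    rw [hρ, Category.assoc, Category.assoc, he]

variable [FiniteDimensional ℂ V]

theorem actsLocallyFinitely_tensorPower (hne : one ≠ 0) (S : Splitting one) :
    ActsLocallyFinitely ν one (tensorPowerObj ν (S.toUnital hne))
      (glActHom ν (S.toUnital hne)) := by
  intro Y x
  obtain ⟨N, hN⟩ := exists_mem_truncation x
  refine ⟨truncation ν (S.toUnital hne) Y N, inferInstance, hN, fun φ h1 h2 y hy => ?_⟩
  have := glAct_eq_rhoE (ν := ν) (S := S.toUnital hne) h1 h2
  rw [glActHom_apply, this]
  exact rhoE_mem_truncation _ hy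

theorem Splitting.idHom_comp (hne : one ≠ 0) (S T W : Splitting one) :
    Splitting.idHom hne S T ≫ Splitting.idHom hne T W = Splitting.idHom hne S W := rfl

theorem Splitting.idHom_self (hne : one ≠ 0) (S : Splitting one) :
    Splitting.idHom hne S S = 𝟙 (S.toUnital hne) := rfl

/-- The isomorphism of the tensor powers for two splittings. -/
noncomputable def splittingIso (ν : ℂ) (hne : one ≠ 0) (S T : Splitting one) :
    tensorPowerObj ν (S.toUnital hne) ≅ tensorPowerObj ν (T.toUnital hne) where
  hom := tensorPowerMap ν (Splitting.idHom hne S T)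
  inv := tensorPowerMap ν (Splitting.idHom hne T S)
  hom_inv_id := by
    rw [← tensorPowerMap_comp, Splitting.idHom_comp, Splitting.idHom_self, tensorPowerMap_id]
  inv_hom_id := by
    rw [← tensorPowerMap_comp, Splitting.idHom_comp, Splitting.idHom_self, tensorPowerMap_id]

/-- The underlying linear map is the identity of V, which intertwines A with itself although its
block components change with the splitting. -/
theorem glActHom_comp_splittingIso (hne : one ≠ 0) (S T : Splitting one) (A : Module.End ℂ V) :
    glActHom ν (S.toUnital hne) A ≫ (splittingIso ν hne S T).hom =
      (splittingIso ν hne S T).hom ≫ glActHom ν (T.toUnital hne) A :=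
  glAct_comp_tensorPowerMap (Splitting.idHom hne S T) A A rfl

end Splittings

/-! ### Primitive idempotents of the group algebra -/

section GroupAlgebra

variable (G : Type) [Group G] [Fintype G]

/-- For each irreducible representation of `G` of dimension `d i`, an idempotent `e i` of the group
algebra of rank one in that representation. -/
structure UnitData where
  n : ℕ
  d : Fin n → ℂ
  e : Fin n → MonoidAlgebra ℂ G
  c : Fin n → G → ℂ
  e_mul_e : ∀ i, e i * e i = e i
  e_mul_of_mul_e_ne : ∀ i j σ, i ≠ j → e i * MonoidAlgebra.of ℂ G σ * e j = 0
  e_mul_of_mul_e : ∀ i σ, e i * MonoidAlgebra.of ℂ G σ * e i = c i σ • e i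
  sum_c : ∀ i, d i * ∑ σ, c i σ * c i σ⁻¹ = Fintype.card G
  sum_conj : ∑ i, d i • ∑ σ, MonoidAlgebra.of ℂ G σ * e i * MonoidAlgebra.of ℂ G σ⁻¹ =
    (Fintype.card G : ℂ) • 1

theorem matrix_eq_of_forall_commute {n : ℕ} [NeZero n] (M : Matrix (Fin n) (Fin n) ℂ)
    (h : ∀ N, N * M = M * N) : (n : ℂ) • M = M.trace • 1 := by
  obtain ⟨x, rfl⟩ := Matrix.mem_range_scalar_iff_commute_single'.mpr fun i j => h _
  rw [Matrix.scalar_apply, ← Matrix.smul_one_eq_diagonal, Matrix.trace_smul, Matrix.trace_one,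
    smul_smul, smul_eq_mul, mul_comm, Fintype.card_fin]

/-- By Wedderburn the group algebra is a product of matrix algebras; the idempotents are the corner
matrix units of the blocks. Averaging such a unit over G gives a scalar by Schur's lemma, and its
trace fixes the scalar; this yields both `sum_c` and `sum_conj`. -/
theorem nonempty_unitData : Nonempty (UnitData G) := by
  obtain ⟨n, d, hd, ⟨φ⟩⟩ :=
    IsSemisimpleRing.exists_algEquiv_pi_matrix_of_isAlgClosed ℂ (MonoidAlgebra ℂ G)
  let E : ∀ i, Matrix (Fin (d i)) (Fin (d i)) ℂ := fun i => Matrix.single 0 0 1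
  let m : G → ∀ i, Matrix (Fin (d i)) (Fin (d i)) ℂ := fun σ => φ (MonoidAlgebra.of ℂ G σ)
  let z : ∀ i, Matrix (Fin (d i)) (Fin (d i)) ℂ := fun i => ∑ σ, m σ i * E i * m σ⁻¹ i
  have hm : ∀ σ τ i, m (σ * τ) i = m σ i * m τ i := fun σ τ i => by
    simp only [m, map_mul, Pi.mul_apply]
  have hm1 : ∀ i, m 1 i = 1 := fun i => by simp only [m, map_one, Pi.one_apply]
  have hE : ∀ i (M : Matrix (Fin (d i)) (Fin (d i)) ℂ), E i * M * E i = M 0 0 • E i := by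
    intro i M
    simp only [E, Matrix.single_mul_mul_single, Matrix.smul_single, smul_eq_mul, one_mul, mul_one]
  have hz1 : ∀ τ i, m τ i * z i = z i * m τ i := by
    intro τ i
    simp only [z, Finset.mul_sum, Finset.sum_mul]
    refine Fintype.sum_equiv (Equiv.mulLeft τ) _ _ fun σ => ?_
    rw [Equiv.coe_mulLeft, hm, mul_inv_rev, hm]
    simp only [mul_assoc]
    rw [← hm τ⁻¹, inv_mul_cancel, hm1, mul_one]
  -- The group elements span the algebra and the projection to a block is onto, so commuting with G
  -- implies commuting with every matrix of the block.
  have hz2 : ∀ i (N : Matrix (Fin (d i)) (Fin (d i)) ℂ), N * z i = z i * N := by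
    intro i N
    have h : ∀ a : MonoidAlgebra ℂ G, φ a i * z i = z i * φ a i := by
      intro a
      induction a using MonoidAlgebra.induction_on with
      | of σ => exact hz1 σ i
      | add a b ha hb => rw [map_add, Pi.add_apply, add_mul, mul_add, ha, hb]
      | smul r a ha =>
        rw [map_smul, Pi.smul_apply, Matrix.smul_mul, Matrix.mul_smul, ha]
    simpa using h (φ.symm (Pi.single i N))
  have hz : ∀ i, (d i : ℂ) • z i = (Fintype.card G : ℂ) • 1 := by
    intro i
    rw [matrix_eq_of_forall_commute (z i) (hz2 i)]
    congr 1
    simp only [z, Matrix.trace_sum]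
    rw [Finset.sum_congr rfl fun σ _ => show Matrix.trace (m σ i * E i * m σ⁻¹ i) = 1 by
      rw [Matrix.trace_mul_comm, ← mul_assoc, ← hm, inv_mul_cancel, hm1, one_mul]
      exact Matrix.trace_single_eq_same _ _]
    simp
  -- The scalars `c` are the corner matrix coefficients: compressing σ by the corner unit leaves its
  -- (0,0) entry.
  refine ⟨⟨n, fun i => d i, fun i => φ.symm (Pi.single i (E i)), fun i σ => m σ i 0 0, ?_, ?_, ?_,
    ?_, ?_⟩⟩
  · intro i
    rw [← map_mul, ← Pi.single_mul]
    congr 2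
    simp [E]
  · intro i j σ hij
    apply φ.injective
    rw [map_mul, map_mul, φ.apply_symm_apply, φ.apply_symm_apply, map_zero]
    funext k
    rw [Pi.mul_apply, Pi.mul_apply, Pi.zero_apply]
    by_cases hk : k = i
    · subst hk
      rw [Pi.single_eq_of_ne hij, mul_zero]
    · rw [Pi.single_eq_of_ne hk, zero_mul, zero_mul]
  · intro i σ
    apply φ.injective
    rw [map_mul, map_mul, map_smul, φ.apply_symm_apply]
    funext k
    rw [Pi.mul_apply, Pi.mul_apply, Pi.smul_apply]
    by_cases hk : k = i
    · subst hk
      rw [Pi.single_eq_same]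
      exact hE k _
    · rw [Pi.single_eq_of_ne hk, mul_zero, smul_zero]
  · intro i
    have h := congrFun (congrFun (hz i) 0) 0
    simp only [z, Matrix.smul_apply, Matrix.sum_apply, Matrix.one_apply_eq, smul_eq_mul,
      mul_one] at h
    rw [← h]
    congr 1
    refine Finset.sum_congr rfl fun σ _ => ?_
    simp [E, Matrix.mul_apply, Matrix.single_apply, ite_and]
  · apply φ.injective
    funext k
    simp only [map_sum, map_smul, map_mul, φ.apply_symm_apply, map_one, Finset.sum_apply,
      Pi.smul_apply, Pi.mul_apply, Pi.one_apply]
    rw [Finset.sum_eq_single k, ← hz k]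
    · simp only [Pi.single_eq_same]
      rfl
    · intro i _ hi
      simp [Pi.single_eq_of_ne hi.symm]
    · simp

end GroupAlgebra

/-! ### Objects as ind-objects, and decompositions of sums of objects -/

section Represented

open Limits Opposite

universe v

variable {C : Type v} [Category.{0} C] [Preadditive C] [Linear ℂ C]

/-- An object of `C` as an ind-object. -/
noncomputable def indOf (Y : C) : IndLin C where
  obj := (linearYoneda ℂ C).obj Y
  property := by
    refine ⟨fun {A B} c f g => ?_, isIndObject_yoneda Y⟩
    apply ModuleCat.hom_ext
    apply LinearMap.ext
    intro (x : B ⟶ Y)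
    change (c • f + g) ≫ x = c • (f ≫ x) + g ≫ x
    rw [Preadditive.add_comp, Linear.smul_comp]

/-- The morphism from an object of `C` given by a section. -/
noncomputable def ofSec (X : IndLin C) (Y : C) : X.sec Y →ₗ[ℂ] (indOf Y ⟶ X) where
  toFun x := ObjectProperty.homMk
    { app := fun Z => ModuleCat.ofHom (X.evalAt x Z.unop)
      naturality := fun Z W e => by
        ext (f : Z.unop ⟶ Y)
        change (X.obj.map (e.unop ≫ f).op).hom x = (X.obj.map e).hom ((X.obj.map f.op).hom x)
        rw [op_comp, X.obj.map_comp]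
        rfl }
  map_add' x y := IndLin.hom_ext_sec fun Z => LinearMap.ext fun f =>
    map_add (X.obj.map f.op).hom x y
  map_smul' c x := IndLin.hom_ext_sec fun Z => LinearMap.ext fun f =>
    map_smul (X.obj.map f.op).hom c x

theorem secMap_ofSec (X : IndLin C) {Y Z : C} (x : X.sec Y) (f : Z ⟶ Y) :
    IndLin.secMap (ofSec X Y x) Z f = X.evalAt x Z f := rfl

theorem evalAt_id (X : IndLin C) {Y : C} (x : X.sec Y) : X.evalAt x Y (𝟙 Y) = x := by
  change (X.obj.map (𝟙 Y).op).hom x = x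
  rw [op_id, X.obj.map_id]
  rfl

theorem evalAt_comp (X : IndLin C) {Y Z W : C} (x : X.sec Y) (f : Z ⟶ Y) (g : W ⟶ Z) :
    X.evalAt x W (g ≫ f) = X.evalAt (X.evalAt x Z f) W g := by
  change (X.obj.map (g ≫ f).op).hom x = (X.obj.map g.op).hom ((X.obj.map f.op).hom x)
  rw [op_comp, X.obj.map_comp]
  rfl

theorem secMap_evalAt {X X' : IndLin C} (f : X ⟶ X') {Y Z : C} (x : X.sec Y) (g : Z ⟶ Y) :
    IndLin.secMap f Z (X.evalAt x Z g) = X'.evalAt (IndLin.secMap f Y x) Z g :=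
  IndLin.secMap_map f g x

theorem ofSec_comp {X X' : IndLin C} {Y : C} (x : X.sec Y) (f : X ⟶ X') :
    ofSec X Y x ≫ f = ofSec X' Y (IndLin.secMap f Y x) :=
  IndLin.hom_ext_sec fun _ => LinearMap.ext fun g => secMap_evalAt f x g

theorem ofSec_injective (X : IndLin C) (Y : C) : Function.Injective (ofSec X Y) := by
  intro x y h
  rw [← evalAt_id X x, ← evalAt_id X y, ← secMap_ofSec, ← secMap_ofSec, h]

/-- The section corresponding to a morphism from an object of `C`. -/
noncomputable def toSec (X : IndLin C) (Y : C) : (indOf Y ⟶ X) →ₗ[ℂ] X.sec Y where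
  toFun f := IndLin.secMap f Y (𝟙 Y)
  map_add' _ _ := rfl
  map_smul' _ _ := rfl

theorem ofSec_toSec (X : IndLin C) (Y : C) (f : indOf Y ⟶ X) : ofSec X Y (toSec X Y f) = f := by
  refine IndLin.hom_ext_sec fun Z => LinearMap.ext fun (g : Z ⟶ Y) => ?_
  refine (secMap_evalAt f (𝟙 Y : (indOf Y).sec Y) g).symm.trans ?_
  exact congrArg (IndLin.secMap f Z) (Category.comp_id g)

/-- A decomposition of the object `P` as a finite sum of objects `Y i ⊗ ℂ ^ m i`. -/
structure Decomposition (P : C) where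
  n : ℕ
  Y : Fin n → C
  m : Fin n → ℕ
  j : ∀ i, (Fin (m i) → ℂ) →ₗ[ℂ] (Y i ⟶ P)
  q : ∀ i, Fin (m i) → (P ⟶ Y i)
  sum_q_comp_j : ∑ i, ∑ b, q i b ≫ j i (Pi.single b 1) = 𝟙 P
  j_comp_q : ∀ i w b, j i w ≫ q i b = w b • 𝟙 (Y i)
  j_comp_q_ne : ∀ i i' w b, i ≠ i' → j i w ≫ q i' b = 0

theorem Decomposition.evalAt_sum {P : C} (D : Decomposition P) {Z : IndLin C} (z : Z.sec P) :
    ∑ i, ∑ b, Z.evalAt (Z.evalAt z _ (D.j i (Pi.single b 1))) _ (D.q i b) = z := by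
  conv_rhs => rw [← evalAt_id Z z, ← D.sum_q_comp_j, map_sum]
  refine Finset.sum_congr rfl fun i _ => ?_
  rw [map_sum]
  exact Finset.sum_congr rfl fun b _ => (evalAt_comp _ _ _ _).symm

/-- Orthogonality of the maps j and q kills the other indices, and for the same index it extracts
the coordinates of w. -/
theorem Decomposition.evalAt_j {P : C} (D : Decomposition P) {Z : IndLin C}
    (γ : ∀ i, (Fin (D.m i) → ℂ) →ₗ[ℂ] Z.sec (D.Y i)) (i : Fin D.n) (w : Fin (D.m i) → ℂ) :
    Z.evalAt (∑ i', ∑ b, Z.evalAt (γ i' (Pi.single b 1)) _ (D.q i' b)) _ (D.j i w) = γ i w := by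
  have h1 : ∀ {A B : C} (x y : Z.sec A) (f : B ⟶ A),
      Z.evalAt (x + y) B f = Z.evalAt x B f + Z.evalAt y B f :=
    fun x y f => map_add (Z.obj.map f.op).hom x y
  have h2 : ∀ {A B : C} {ι : Type} (s : Finset ι) (x : ι → Z.sec A) (f : B ⟶ A),
      Z.evalAt (∑ i ∈ s, x i) B f = ∑ i ∈ s, Z.evalAt (x i) B f :=
    fun s x f => map_sum (Z.obj.map f.op).hom x s
  simp only [h2, ← evalAt_comp]
  rw [Finset.sum_eq_single i]
  · simp only [D.j_comp_q, map_smul, evalAt_id]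
    conv_rhs => rw [← Finset.univ_sum_single w, map_sum]
    refine Finset.sum_congr rfl fun b _ => ?_
    rw [← map_smul, ← Pi.single_smul, smul_eq_mul, mul_one]
  · intro i' _ hi'
    refine Finset.sum_eq_zero fun b _ => ?_
    rw [D.j_comp_q_ne _ _ _ _ hi'.symm, map_zero]
  · simp

variable [HasFiniteBiproducts C]

variable {P : ℕ → C} (D : ∀ k, Decomposition (P k))

variable (P) in
/-- The section of `⨁ k, P k` given by a morphism to a summand. -/
noncomputable def ofSummand (k : ℕ) (Y : C) : (Y ⟶ P k) →ₗ[ℂ] (indSum P).sec Y :=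
  DirectSum.lof ℂ ℕ (fun k => (Y ⟶ P k)) k

/-- The inclusion of `Y i ⊗ ℂ ^ m i`. -/
noncomputable def decompIncl (i : Σ k, Fin (D k).n) :
    (Fin ((D i.1).m i.2) → ℂ) →ₗ[ℂ] (indOf ((D i.1).Y i.2) ⟶ indSum P) :=
  ofSec _ _ ∘ₗ ofSummand P i.1 _ ∘ₗ (D i.1).j i.2

theorem evalAt_ofSummand {k : ℕ} {Y Z : C} (g : Y ⟶ P k) (f : Z ⟶ Y) :
    (indSum P).evalAt (ofSummand P k Y g) Z f = ofSummand P k Z (f ≫ g) := by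
  change DirectSum.lmap (fun k => Linear.leftComp ℂ (P k) f)
    (DirectSum.of (fun k => (Y ⟶ P k)) k g) = _
  rw [DirectSum.lmap_of]
  rfl

theorem ofSummand_eq_evalAt {k : ℕ} {Y : C} (g : Y ⟶ P k) :
    ofSummand P k Y g = (indSum P).evalAt (ofSummand P k (P k) (𝟙 _)) Y g := by
  rw [evalAt_ofSummand, Category.comp_id]

theorem decompIncl_comp {Z : IndLin C} (f : indSum P ⟶ Z) (i : Σ k, Fin (D k).n)
    (w : Fin ((D i.1).m i.2) → ℂ) :
    decompIncl D i w ≫ f = ofSec Z _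
      (Z.evalAt (IndLin.secMap f _ (ofSummand P i.1 _ (𝟙 _))) _ ((D i.1).j i.2 w)) := by
  change ofSec _ _ (ofSummand P i.1 _ ((D i.1).j i.2 w)) ≫ f = _
  rw [ofSec_comp, ofSummand_eq_evalAt, secMap_evalAt]

theorem indSum_hom_ext {Z : IndLin C} {f g : indSum P ⟶ Z}
    (h : ∀ k, IndLin.secMap f _ (ofSummand P k _ (𝟙 _)) =
      IndLin.secMap g _ (ofSummand P k _ (𝟙 _))) : f = g := by
  refine IndLin.hom_ext_sec fun Y => LinearMap.ext fun x => ?_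
  refine DirectSum.induction_on (β := fun k => (Y ⟶ P k))
    (motive := fun x => IndLin.secMap f Y x = IndLin.secMap g Y x) x ?_ ?_ ?_
  · exact (map_zero (IndLin.secMap f Y)).trans (map_zero (IndLin.secMap g Y)).symm
  · intro k m
    change IndLin.secMap f Y (ofSummand P k Y m) = IndLin.secMap g Y (ofSummand P k Y m)
    rw [ofSummand_eq_evalAt, secMap_evalAt, secMap_evalAt, h]
  · intro x y hx hy
    exact ((map_add (IndLin.secMap f Y) x y).trans (congrArg₂ (· + ·) hx hy)).trans
      (map_add (IndLin.secMap g Y) x y).symm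

theorem secMap_indSumDesc_ofSummand {Z : IndLin C} (c : ∀ k, Z.sec (P k)) (k : ℕ) :
    IndLin.secMap (indSumDesc P Z c) _ (ofSummand P k _ (𝟙 _)) = c k := by
  refine (indSumDescApp_of P Z c _ k (𝟙 _)).trans ?_
  exact evalAt_id Z (c k)

/-- The universal property of the decomposition. -/
theorem bijective_decompIncl (Z : IndLin C) :
    Function.Bijective fun (f : indSum P ⟶ Z) (i : Σ k, Fin (D k).n) =>
      Linear.rightComp ℂ (indOf ((D i.1).Y i.2)) f ∘ₗ decompIncl D i := by
  constructor
  · intro f g h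
    refine indSum_hom_ext fun k => ?_
    rw [← (D k).evalAt_sum (IndLin.secMap f _ (ofSummand P k _ (𝟙 _))),
      ← (D k).evalAt_sum (IndLin.secMap g _ (ofSummand P k _ (𝟙 _)))]
    refine Finset.sum_congr rfl fun i _ => Finset.sum_congr rfl fun b _ => ?_
    have h1 : decompIncl D ⟨k, i⟩ (Pi.single b 1) ≫ f = decompIncl D ⟨k, i⟩ (Pi.single b 1) ≫ g :=
      LinearMap.congr_fun (congrFun h ⟨k, i⟩) (Pi.single b 1)
    rw [decompIncl_comp, decompIncl_comp] at h1
    exact congrArg (fun x => Z.evalAt x (P k) ((D k).q i b)) (ofSec_injective _ _ h1)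
  · intro γ
    -- The preimage of γ restricts to each summand as the projections q followed by γ on basis
    -- vectors; `Decomposition.evalAt_j` recovers γ.
    refine ⟨indSumDesc P Z fun k => ∑ i, ∑ b, Z.evalAt
      (toSec Z _ (γ ⟨k, i⟩ (Pi.single b 1))) _ ((D k).q i b), ?_⟩
    funext i
    refine LinearMap.ext fun w => ?_
    change decompIncl D i w ≫ _ = _
    rw [decompIncl_comp, secMap_indSumDesc_ofSummand]
    obtain ⟨k, i⟩ := i
    have := (D k).evalAt_j (fun i => toSec Z _ ∘ₗ γ ⟨k, i⟩) i w
    simp only [LinearMap.comp_apply] at this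
    rw [this, ofSec_toSec]

end Represented

/-! ### Decomposition of the invariants -/

theorem exists_split_idempotent {W : Type*} [AddCommGroup W] [Module ℂ W] [FiniteDimensional ℂ W]
    (E : Module.End ℂ W) (h : E * E = E) :
    ∃ (m : ℕ) (ι : (Fin m → ℂ) →ₗ[ℂ] W) (r : W →ₗ[ℂ] (Fin m → ℂ)),
      r ∘ₗ ι = LinearMap.id ∧ ι ∘ₗ r = E := by
  let b := (Module.finBasis ℂ (LinearMap.range E)).equivFun
  refine ⟨_, (LinearMap.range E).subtype ∘ₗ b.symm.toLinearMap,
    b.toLinearMap ∘ₗ E.rangeRestrict, ?_, ?_⟩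
  · refine LinearMap.ext fun w => ?_
    obtain ⟨⟨_, y, rfl⟩, rfl⟩ := b.surjective w
    change b (E.rangeRestrict (b.symm (b ⟨E y, _⟩) : W)) = _
    rw [b.symm_apply_apply]
    exact congrArg b (Subtype.ext (LinearMap.congr_fun h y))
  · refine LinearMap.ext fun w => ?_
    change ((b.symm (b (E.rangeRestrict w)) : LinearMap.range E) : W) = E w
    rw [b.symm_apply_apply]
    rfl

/-- The compression of a representation to the image of an idempotent that commutes with it. -/
def compressLie {L T W : Type*} [LieRing L] [LieAlgebra ℂ L] [AddCommGroup T] [Module ℂ T]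
    [AddCommGroup W] [Module ℂ W] (D : L →ₗ⁅ℂ⁆ Module.End ℂ T) (ι : W →ₗ[ℂ] T) (r : T →ₗ[ℂ] W)
    (h : r ∘ₗ ι = LinearMap.id) (hc : ∀ A x, ι (r (D A x)) = D A (ι (r x))) :
    L →ₗ⁅ℂ⁆ Module.End ℂ W where
  toFun A := r ∘ₗ D A ∘ₗ ι
  map_add' A B := by
    rw [map_add, LinearMap.add_comp, LinearMap.comp_add]
  map_smul' c A := by
    rw [map_smul, LinearMap.smul_comp, LinearMap.comp_smul, RingHom.id_apply]
  map_lie' {A B} := by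
    have hr : ∀ w, r (ι w) = w := LinearMap.congr_fun h
    refine LinearMap.ext fun w => ?_
    rw [LieHom.map_lie, LieRing.of_associative_ring_bracket, LieRing.of_associative_ring_bracket]
    change r (D A (D B (ι w)) - D B (D A (ι w))) =
      r (D A (ι (r (D B (ι w))))) - r (D B (ι (r (D A (ι w)))))
    rw [map_sub, hc, hc, hr]

/-! ### The two actions of the group algebra of S_k -/

section Rep

variable (ν : ℂ) (U : Type*) [AddCommGroup U] [Module ℂ U] (k : ℕ)

/-- The action of the group algebra of `S_k` on `U^{⊗ k}`. -/
noncomputable def repT :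
    MonoidAlgebra ℂ (Equiv.Perm (Fin k)) →ₐ[ℂ] Module.End ℂ (TPow U k) :=
  MonoidAlgebra.lift ℂ _ _
    { toFun := fun σ => (PiTensorProduct.reindex ℂ (fun _ : Fin k => U) σ).toLinearMap
      map_one' := by
        ext x
        simp
        rfl
      map_mul' := fun σ τ => by
        ext x
        simp [Equiv.Perm.mul_def]
        rfl }

/-- The action of the opposite of the group algebra of `S_k` on `Δ_k`, the permutation `σ` acting by
`σ⁻¹`. -/
noncomputable def repDOp :
    MonoidAlgebra ℂ (Equiv.Perm (Fin k)) →ₐ[ℂ] (End (Delta ν k))ᵐᵒᵖ :=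
  MonoidAlgebra.lift ℂ _ _
    { toFun := fun σ => MulOpposite.op (permHom ν σ⁻¹ : End (Delta ν k))
      map_one' := by
        rw [inv_one, permHom_one]
        rfl
      map_mul' := fun σ τ => by
        rw [mul_inv_rev, ← permHom_comp]
        rfl }

/-- The action of the group algebra of `S_k` on `Δ_k` from the other side. -/
noncomputable def repD : MonoidAlgebra ℂ (Equiv.Perm (Fin k)) →ₗ[ℂ] (Delta ν k ⟶ Delta ν k) where
  toFun a := (repDOp ν k a).unop
  map_add' a b := by rw [map_add]; rfl
  map_smul' c a := by rw [map_smul]; rfl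

variable {U k}

theorem repT_of (σ : Equiv.Perm (Fin k)) :
    repT U k (MonoidAlgebra.of ℂ _ σ) =
      (PiTensorProduct.reindex ℂ (fun _ : Fin k => U) σ).toLinearMap :=
  MonoidAlgebra.lift_of _ _

theorem repD_of (σ : Equiv.Perm (Fin k)) :
    repD ν k (MonoidAlgebra.of ℂ _ σ) = permHom ν σ⁻¹ := by
  change (repDOp ν k (MonoidAlgebra.of ℂ _ σ)).unop = _
  rw [repDOp, MonoidAlgebra.lift_of]
  rfl

theorem repD_one : repD ν k 1 = 𝟙 (Delta ν k) :=
  congrArg MulOpposite.unop (map_one (repDOp ν k))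

theorem repD_mul (a b : MonoidAlgebra ℂ (Equiv.Perm (Fin k))) :
    repD ν k (a * b) = repD ν k a ≫ repD ν k b :=
  congrArg MulOpposite.unop (map_mul (repDOp ν k) a b)

theorem repT_comp_diagAct (a : MonoidAlgebra ℂ (Equiv.Perm (Fin k))) (A : U →ₗ[ℂ] U) :
    repT U k a ∘ₗ diagAct k A = diagAct k A ∘ₗ repT U k a := by
  induction a using MonoidAlgebra.induction_on with
  | of σ => rw [repT_of, reindex_comp_diagAct]
  | add a b ha hb => rw [map_add, LinearMap.add_comp, LinearMap.comp_add, ha, hb]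
  | smul c a ha => rw [map_smul, LinearMap.smul_comp, LinearMap.comp_smul, ha]

variable [FiniteDimensional ℂ U]

/-- Applying σ to the tensor factor alone is the joint action of σ followed by σ⁻¹ on Δ_k, and
invariants absorb the joint action. So group algebra elements may be moved from U^{⊗k} to Δ_k. -/
theorem symProj_comp_repT (a : MonoidAlgebra ℂ (Equiv.Perm (Fin k))) :
    symProj ν U k ≫ tensMap (repT U k a) (𝟙 (Delta ν k)) =
      symProj ν U k ≫ tensMap LinearMap.id (repD ν k a) := by
  induction a using MonoidAlgebra.induction_on with
  | of σ =>
    rw [repT_of, repD_of]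
    have h : tensMap (PiTensorProduct.reindex ℂ (fun _ : Fin k => U) σ).toLinearMap
        (𝟙 (Delta ν k)) = permAct ν U k σ ≫ tensMap LinearMap.id (permHom ν σ⁻¹) := by
      rw [permAct, tensMap_comp, permHom_comp, inv_mul_cancel, permHom_one, LinearMap.id_comp]
    rw [h, ← Category.assoc, symProj_comp_permAct]
  | add a b ha hb =>
    rw [map_add, map_add, tensMap_add_left, tensMap_add_right, Preadditive.comp_add,
      Preadditive.comp_add, ha, hb]
  | smul c a ha =>
    rw [map_smul, map_smul, tensMap_smul_left, tensMap_smul_right, Linear.comp_smul,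
      Linear.comp_smul, ha]

theorem repT_comp_symProj (a : MonoidAlgebra ℂ (Equiv.Perm (Fin k))) :
    tensMap (repT U k a) (𝟙 (Delta ν k)) ≫ symProj ν U k =
      tensMap LinearMap.id (repD ν k a) ≫ symProj ν U k := by
  induction a using MonoidAlgebra.induction_on with
  | of σ =>
    rw [repT_of, repD_of]
    have h : tensMap (PiTensorProduct.reindex ℂ (fun _ : Fin k => U) σ).toLinearMap
        (𝟙 (Delta ν k)) = tensMap LinearMap.id (permHom ν σ⁻¹) ≫ permAct ν U k σ := by
      rw [permAct, tensMap_comp, permHom_comp, mul_inv_cancel, permHom_one, LinearMap.comp_id]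
    rw [h, Category.assoc, permAct_comp_symProj]
  | add a b ha hb =>
    rw [map_add, map_add, tensMap_add_left, tensMap_add_right, Preadditive.add_comp,
      Preadditive.add_comp, ha, hb]
  | smul c a ha =>
    rw [map_smul, map_smul, tensMap_smul_left, tensMap_smul_right, Linear.smul_comp,
      Linear.smul_comp, ha]

/-- Between the two projections the outer factors σ and σ⁻¹ move over to the tensor side, where
nothing separates them and they cancel. -/
theorem symProj_comp_conj_comp_symProj (a : MonoidAlgebra ℂ (Equiv.Perm (Fin k)))
    (σ : Equiv.Perm (Fin k)) :
    symProj ν U k ≫ tensMap LinearMap.id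
        (repD ν k (MonoidAlgebra.of ℂ _ σ * a * MonoidAlgebra.of ℂ _ σ⁻¹)) ≫ symProj ν U k =
      symProj ν U k ≫ tensMap LinearMap.id (repD ν k a) ≫ symProj ν U k := by
  have h1 : tensMap (LinearMap.id : TPow U k →ₗ[ℂ] TPow U k)
      (repD ν k (MonoidAlgebra.of ℂ _ σ * a * MonoidAlgebra.of ℂ _ σ⁻¹)) =
      tensMap LinearMap.id (repD ν k (MonoidAlgebra.of ℂ _ σ)) ≫
        tensMap LinearMap.id (repD ν k a) ≫
          tensMap LinearMap.id (repD ν k (MonoidAlgebra.of ℂ _ σ⁻¹)) := by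
    rw [tensMap_comp, tensMap_comp, repD_mul, repD_mul, Category.assoc]
    rfl
  have h2 : repT U k (MonoidAlgebra.of ℂ _ σ⁻¹) ∘ₗ repT U k (MonoidAlgebra.of ℂ _ σ) =
      LinearMap.id := by
    rw [← Module.End.mul_eq_comp, ← map_mul, ← map_mul, inv_mul_cancel, map_one, map_one]
    rfl
  rw [h1, Category.assoc, Category.assoc, ← repT_comp_symProj, ← Category.assoc,
    ← symProj_comp_repT, Category.assoc]
  congr 1
  simp only [← Category.assoc]
  congr 1
  rw [tensMap_comp, tensMap_comp, Category.id_comp, Category.comp_id, LinearMap.id_comp, h2]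

/-- Compression to the invariants is insensitive to conjugation. Applied to `sum_conj` it turns the
sum over conjugates into |S_k| times the sum over the idempotents themselves. -/
theorem sum_symProj_comp_repD (D : UnitData (Equiv.Perm (Fin k))) :
    ∑ i, D.d i • (symProj ν U k ≫ tensMap LinearMap.id (repD ν k (D.e i)) ≫ symProj ν U k) =
      symProj ν U k := by
  let Ψ : MonoidAlgebra ℂ (Equiv.Perm (Fin k)) →ₗ[ℂ] (tensObj ν U k ⟶ tensObj ν U k) :=
    { toFun := fun a => symProj ν U k ≫ tensMap LinearMap.id (repD ν k a) ≫ symProj ν U k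
      map_add' := fun a b => by
        rw [map_add, tensMap_add_right, Preadditive.add_comp, Preadditive.comp_add]
      map_smul' := fun c a => by
        rw [map_smul, tensMap_smul_right, Linear.smul_comp, Linear.comp_smul, RingHom.id_apply] }
  have h0 : ∀ a σ, Ψ (MonoidAlgebra.of ℂ _ σ * a * MonoidAlgebra.of ℂ _ σ⁻¹) = Ψ a :=
    fun a σ => symProj_comp_conj_comp_symProj ν a σ
  have h1 : Ψ 1 = symProj ν U k := by
    change symProj ν U k ≫ tensMap LinearMap.id (repD ν k 1) ≫ symProj ν U k = _
    rw [repD_one, tensMap_id, Category.id_comp, symProj_idem]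
  have h2 := congrArg Ψ D.sum_conj
  simp only [map_sum, map_smul, h0, h1, Finset.sum_const, Finset.card_univ] at h2
  have hG : (Fintype.card (Equiv.Perm (Fin k)) : ℂ) ≠ 0 := Nat.cast_ne_zero.2 Fintype.card_ne_zero
  refine smul_right_injective _ hG ?_
  change (Fintype.card (Equiv.Perm (Fin k)) : ℂ) • ∑ i, D.d i • Ψ (D.e i) =
    (Fintype.card (Equiv.Perm (Fin k)) : ℂ) • symProj ν U k
  rw [← h2, Finset.smul_sum]
  refine Finset.sum_congr rfl fun i _ => ?_
  rw [← Nat.cast_smul_eq_nsmul ℂ, smul_comm]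

end Rep

/-! ### Multiplicity objects and decomposition of the invariants -/

section PieceDecomposition

variable (ν : ℂ) {U : Type u} [AddCommGroup U] [Module ℂ U] [FiniteDimensional ℂ U] {k : ℕ}

/-- The multiplicity object of an idempotent of the group algebra. -/
noncomputable def multObj (e : MonoidAlgebra ℂ (Equiv.Perm (Fin k))) (he : e * e = e) : RepS ν where
  X := tens ℂ (Delta ν k)
  p := tensMap LinearMap.id (repD ν k e)
  idem := by rw [tensMap_comp, ← repD_mul, he, LinearMap.id_comp]

variable (e : MonoidAlgebra ℂ (Equiv.Perm (Fin k))) (he : e * e = e)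

/-- The inclusion of the multiplicity object given by a tensor. -/
noncomputable def multIncl (x : TPow U k) : multObj ν e he ⟶ piece ν U k where
  f := tensMap (LinearMap.toSpanSingleton ℂ _ x) (repD ν k e) ≫ symProj ν U k
  comm := by
    simp only [piece, multObj, Category.assoc, symProj_idem]
    rw [← Category.assoc, tensMap_comp, ← repD_mul, he, LinearMap.comp_id]

/-- The projection to the multiplicity object given by a functional. -/
noncomputable def multProj (l : TPow U k →ₗ[ℂ] ℂ) : piece ν U k ⟶ multObj ν e he where
  f := symProj ν U k ≫ tensMap l (repD ν k e)
  comm := by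
    simp only [piece, multObj, Category.assoc]
    rw [tensMap_comp, ← repD_mul, he, LinearMap.id_comp, ← Category.assoc (symProj ν U k),
      symProj_idem]

theorem multProj_comp_multIncl (l : TPow U k →ₗ[ℂ] ℂ) (x : TPow U k) :
    (multProj ν e he l ≫ multIncl ν e he x).f =
      symProj ν U k ≫ tensMap (l.smulRight x) (repD ν k e) ≫ symProj ν U k := by
  change (symProj ν U k ≫ tensMap l (repD ν k e)) ≫
    tensMap (LinearMap.toSpanSingleton ℂ _ x) (repD ν k e) ≫ symProj ν U k = _
  simp only [Category.assoc]
  congr 1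
  rw [← Category.assoc, tensMap_comp, ← repD_mul, he]
  rfl

/-- Expanding the averaging projection leaves, for each σ, a scalar from the tensor side and the
element e σ⁻¹ e' on Δ_k. The latter is zero or a multiple of e for the idempotents in use. -/
theorem multIncl_comp_multProj {e' : MonoidAlgebra ℂ (Equiv.Perm (Fin k))} (he' : e' * e' = e')
    (l : TPow U k →ₗ[ℂ] ℂ) (x : TPow U k) :
    (multIncl ν e he x ≫ multProj ν e' he' l).f =
      (k.factorial : ℂ)⁻¹ • ∑ σ : Equiv.Perm (Fin k),
        l (repT U k (MonoidAlgebra.of ℂ _ σ) x) •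
          tensMap LinearMap.id (repD ν k (e * MonoidAlgebra.of ℂ _ σ⁻¹ * e')) := by
  change (tensMap (LinearMap.toSpanSingleton ℂ _ x) (repD ν k e) ≫ symProj ν U k) ≫
    symProj ν U k ≫ tensMap l (repD ν k e') = _
  rw [Category.assoc, ← Category.assoc (symProj ν U k), symProj_idem, symProj, Linear.smul_comp,
    Linear.comp_smul, Preadditive.sum_comp, Preadditive.comp_sum]
  congr 1
  refine Finset.sum_congr rfl fun σ _ => ?_
  rw [permAct, tensMap_comp, tensMap_comp, ← tensMap_smul_left, repD_mul, repD_mul, repD_of,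
    inv_inv, Category.assoc, repT_of]
  congr 1
  refine LinearMap.ext_ring ?_
  simp

/-- The inclusion of a multiplicity object, linear in the tensor. -/
noncomputable def multInclLin : TPow U k →ₗ[ℂ] (multObj ν e he ⟶ piece ν U k) where
  toFun x := multIncl ν e he x
  map_add' x y := by
    refine Idempotents.Karoubi.Hom.ext ?_
    change tensMap (LinearMap.toSpanSingleton ℂ _ (x + y)) (repD ν k e) ≫ symProj ν U k =
      tensMap (LinearMap.toSpanSingleton ℂ _ x) (repD ν k e) ≫ symProj ν U k +
        tensMap (LinearMap.toSpanSingleton ℂ _ y) (repD ν k e) ≫ symProj ν U k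
    rw [LinearMap.toSpanSingleton_add, tensMap_add_left, Preadditive.add_comp]
  map_smul' c x := by
    refine Idempotents.Karoubi.Hom.ext ?_
    change tensMap (LinearMap.toSpanSingleton ℂ _ (c • x)) (repD ν k e) ≫ symProj ν U k =
      c • (tensMap (LinearMap.toSpanSingleton ℂ _ x) (repD ν k e) ≫ symProj ν U k)
    rw [LinearMap.toSpanSingleton_smul, tensMap_smul_left, Linear.smul_comp]

theorem multIncl_comp_opA (x : TPow U k) (A : U →ₗ[ℂ] U) :
    multIncl ν e he x ≫ opA ν k A = multIncl ν e he (diagAct k A x) := by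
  refine Idempotents.Karoubi.Hom.ext ?_
  rw [opA_eq]
  change (tensMap (LinearMap.toSpanSingleton ℂ _ x) (repD ν k e) ≫ symProj ν U k) ≫
    symProj ν U k ≫ tensMap (diagAct k A) (𝟙 (Delta ν k)) ≫ symProj ν U k =
      tensMap (LinearMap.toSpanSingleton ℂ _ (diagAct k A x)) (repD ν k e) ≫ symProj ν U k
  rw [Category.assoc, ← Category.assoc (symProj ν U k) (symProj ν U k), symProj_idem,
    ← Category.assoc (symProj ν U k), symProj_comp_tensMap_id _ fun σ => reindex_comp_diagAct σ A,
    Category.assoc, symProj_idem, ← Category.assoc, tensMap_comp, Category.comp_id]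
  congr 2
  refine LinearMap.ext_ring ?_
  simp

theorem symProj_comp_tensMap_repT (a b : MonoidAlgebra ℂ (Equiv.Perm (Fin k))) :
    symProj ν U k ≫ tensMap (repT U k a) (repD ν k b) =
      symProj ν U k ≫ tensMap LinearMap.id (repD ν k (a * b)) := by
  have h : tensMap (repT U k a) (repD ν k b) =
      tensMap (repT U k a) (𝟙 (Delta ν k)) ≫ tensMap LinearMap.id (repD ν k b) := by
    rw [tensMap_comp, Category.id_comp, LinearMap.id_comp]
  rw [h, ← Category.assoc, symProj_comp_repT, Category.assoc, tensMap_comp, repD_mul,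
    LinearMap.id_comp]

variable (U k)

/-- The invariants in `U^{⊗ k} ⊗ Δ_k` as a sum of objects `Y ⊗ E`, for polynomial representations
`E` of `gl(U)`. -/
theorem exists_decomposition_piece :
    ∃ (D : Decomposition (piece ν U k))
      (act : ∀ i, Module.End ℂ U →ₗ⁅ℂ⁆ Module.End ℂ (Fin (D.m i) → ℂ)),
      (∀ i, ∃ (ι : (Fin (D.m i) → ℂ) →ₗ[ℂ] TPow U k) (r : TPow U k →ₗ[ℂ] (Fin (D.m i) → ℂ)),
        r ∘ₗ ι = LinearMap.id ∧ (∀ A w, ι (act i A w) = diagAct k A (ι w)) ∧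
          ∀ A x, r (diagAct k A x) = act i A (r x)) ∧
      ∀ i A w, D.j i (act i A w) = D.j i w ≫ opA ν k A := by
  obtain ⟨D⟩ := nonempty_unitData (Equiv.Perm (Fin k))
  have hE : ∀ i, repT U k (D.e i) * repT U k (D.e i) = repT U k (D.e i) := fun i => by
    rw [← map_mul, D.e_mul_e]
  -- The representation E_i is the image of the i-th idempotent on U^{⊗k}, with coordinates chosen;
  -- the multiplicity object is its image on Δ_k.
  choose m ι r hrι hιr using fun i => exists_split_idempotent _ (hE i)
  have hrι' : ∀ i w, r i (ι i w) = w := fun i => LinearMap.congr_fun (hrι i)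
  have hιr' : ∀ i x, ι i (r i x) = repT U k (D.e i) x := fun i => LinearMap.congr_fun (hιr i)
  have hEι : ∀ i w, repT U k (D.e i) (ι i w) = ι i w := fun i w => by rw [← hιr', hrι']
  have hrE : ∀ i x, r i (repT U k (D.e i) x) = r i x := fun i x => by rw [← hιr', hrι']
  have hEA : ∀ i (A : U →ₗ[ℂ] U) x,
      repT U k (D.e i) (diagAct k A x) = diagAct k A (repT U k (D.e i) x) :=
    fun i A => LinearMap.congr_fun (repT_comp_diagAct (D.e i) A)
  have hc : ∀ i A x, ι i (r i (diagActHom U k A x)) = diagActHom U k A (ι i (r i x)) :=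
    fun i A x => by
      rw [hιr', hιr']
      exact hEA i A x
  let j : ∀ i, (Fin (m i) → ℂ) →ₗ[ℂ] (multObj ν (D.e i) (D.e_mul_e i) ⟶ piece ν U k) :=
    fun i => multInclLin ν (D.e i) (D.e_mul_e i) ∘ₗ ι i
  -- The dimension `D.d i` is the constant that makes q dual to j, by Schur orthogonality.
  let q : ∀ i, Fin (m i) → (piece ν U k ⟶ multObj ν (D.e i) (D.e_mul_e i)) :=
    fun i b => D.d i • multProj ν (D.e i) (D.e_mul_e i) (LinearMap.proj b ∘ₗ r i)
  have h1 : ∑ i, ∑ b, q i b ≫ j i (Pi.single b 1) = 𝟙 (piece ν U k) := by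
    refine Idempotents.Karoubi.Hom.ext ?_
    change _ = symProj ν U k
    rw [← sum_symProj_comp_repD ν D, Idempotents.Karoubi.sum_hom]
    refine Finset.sum_congr rfl fun i _ => ?_
    rw [Idempotents.Karoubi.sum_hom]
    have hb : ∀ b, (q i b ≫ j i (Pi.single b 1)).f = D.d i • (symProj ν U k ≫
        tensMap ((LinearMap.proj b ∘ₗ r i).smulRight (ι i (Pi.single b 1))) (repD ν k (D.e i)) ≫
          symProj ν U k) := fun b => by
      have hb0 : q i b ≫ j i (Pi.single b 1) =
          D.d i • (multProj ν (D.e i) (D.e_mul_e i) (LinearMap.proj b ∘ₗ r i) ≫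
            multIncl ν (D.e i) (D.e_mul_e i) (ι i (Pi.single b 1))) := Linear.smul_comp _ _ _ _ _ _
      exact (congrArg Idempotents.Karoubi.Hom.f hb0).trans
        (congrArg (fun x : tensObj ν U k ⟶ tensObj ν U k => D.d i • x)
          (multProj_comp_multIncl ν (D.e i) (D.e_mul_e i) _ _))
    have hs : ∑ b, (LinearMap.proj b ∘ₗ r i).smulRight (ι i (Pi.single b 1)) =
        repT U k (D.e i) := by
      refine LinearMap.ext fun x => ?_
      rw [← hιr', LinearMap.sum_apply]
      conv_rhs => rw [← Finset.univ_sum_single (r i x), map_sum]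
      refine Finset.sum_congr rfl fun b _ => ?_
      rw [LinearMap.smulRight_apply, ← map_smul, ← Pi.single_smul, smul_eq_mul, mul_one]
      rfl
    have hsum : ∑ b, D.d i • (symProj ν U k ≫
        tensMap ((LinearMap.proj b ∘ₗ r i).smulRight (ι i (Pi.single b 1))) (repD ν k (D.e i)) ≫
          symProj ν U k) =
        D.d i • (symProj ν U k ≫ tensMap LinearMap.id (repD ν k (D.e i)) ≫ symProj ν U k) := by
      rw [← Finset.smul_sum, ← Preadditive.comp_sum, ← Preadditive.sum_comp, ← tensMap_sum_left, hs, ← Category.assoc,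
        symProj_comp_tensMap_repT, D.e_mul_e, Category.assoc]
    exact (Finset.sum_congr rfl fun b _ => hb b).trans hsum
  have h23 : ∀ i i' w b, (j i w ≫ q i' b).f = D.d i' • (k.factorial : ℂ)⁻¹ •
      ∑ σ : Equiv.Perm (Fin k), r i' (repT U k (MonoidAlgebra.of ℂ _ σ) (ι i w)) b •
        tensMap LinearMap.id (repD ν k (D.e i * MonoidAlgebra.of ℂ _ σ⁻¹ * D.e i')) :=
    fun i i' w b => by
      have := multIncl_comp_multProj ν (D.e i) (D.e_mul_e i) (D.e_mul_e i')
        (LinearMap.proj b ∘ₗ r i') (ι i w)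
      have h0 : j i w ≫ q i' b =
          D.d i' • (multIncl ν (D.e i) (D.e_mul_e i) (ι i w) ≫
            multProj ν (D.e i') (D.e_mul_e i') (LinearMap.proj b ∘ₗ r i')) :=
        Linear.comp_smul _ _ _ _ _ _
      exact (congrArg Idempotents.Karoubi.Hom.f h0).trans
        (congrArg (fun x : tens ℂ (Delta ν k) ⟶ tens ℂ (Delta ν k) => D.d i' • x) this)
  have h2 : ∀ i w b, j i w ≫ q i b = w b • 𝟙 (multObj ν (D.e i) (D.e_mul_e i)) := by
    intro i w b
    refine Idempotents.Karoubi.Hom.ext ?_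
    change _ = w b • tensMap LinearMap.id (repD ν k (D.e i))
    -- On the image of the idempotent, σ compresses to the scalar c(σ), while Δ_k contributes
    -- c(σ⁻¹). Their products sum to k!/d by `sum_c`.
    have hr : ∀ σ, r i (repT U k (MonoidAlgebra.of ℂ _ σ) (ι i w)) = D.c i σ • w := fun σ => by
      rw [← hrE, ← hEι i w, ← Module.End.mul_apply, ← Module.End.mul_apply, ← map_mul, ← map_mul,
        D.e_mul_of_mul_e, map_smul, LinearMap.smul_apply, map_smul, hEι, hrι']
    rw [h23]
    simp only [hr, D.e_mul_of_mul_e, map_smul, tensMap_smul_right, smul_smul, Pi.smul_apply,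
      smul_eq_mul]
    rw [← Finset.sum_smul, smul_smul]
    congr 1
    have hc := D.sum_c i
    rw [Fintype.card_perm, Fintype.card_fin] at hc
    have hk : (k.factorial : ℂ) ≠ 0 := Nat.cast_ne_zero.2 k.factorial_ne_zero
    calc _ = (k.factorial : ℂ)⁻¹ * (D.d i * ∑ σ, D.c i σ * D.c i σ⁻¹) * w b := by
          simp only [Finset.mul_sum, Finset.sum_mul]
          exact Finset.sum_congr rfl fun σ _ => by ring
      _ = w b := by rw [hc, inv_mul_cancel₀ hk, one_mul]
  have h3 : ∀ i i' w b, i ≠ i' → j i w ≫ q i' b = 0 := by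
    intro i i' w b hi
    refine Idempotents.Karoubi.Hom.ext ?_
    rw [h23]
    simp only [D.e_mul_of_mul_e_ne _ _ _ hi, map_zero]
    have hz : tensMap (LinearMap.id : ℂ →ₗ[ℂ] ℂ) (0 : Delta ν k ⟶ Delta ν k) = 0 := by
      simpa using tensMap_smul_right 0 (LinearMap.id : ℂ →ₗ[ℂ] ℂ) (𝟙 (Delta ν k))
    simp only [hz, smul_zero, Finset.sum_const_zero]
    rfl
  let act : ∀ i, Module.End ℂ U →ₗ⁅ℂ⁆ Module.End ℂ (Fin (m i) → ℂ) := fun i =>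
    compressLie (diagActHom U k) (ι i) (r i) (hrι i) (hc i)
  have hact : ∀ i A w, ι i (act i A w) = diagAct k A (ι i w) := fun i A w => by
    change ι i (r i (diagAct k A (ι i w))) = _
    rw [hιr', hEA, hEι]
  refine ⟨⟨D.n, _, m, j, q, h1, h2, h3⟩, act, fun i => ⟨ι i, r i, hrι i, hact i, fun A x => ?_⟩,
    fun i A w => ?_⟩
  · change _ = r i (diagAct k A (ι i (r i x)))
    rw [hιr', ← hEA, hrE]
  · change multIncl ν _ _ (ι i (act i A w)) = multIncl ν _ _ (ι i w) ≫ opA ν k A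
    rw [hact, multIncl_comp_opA]

end PieceDecomposition

/-! ### Polynomiality for the reference splitting -/

section Polynomial

open SplitUnital

variable {ν : ℂ} {V : Type u} [AddCommGroup V] [Module ℂ V] [FiniteDimensional ℂ V] {one : V}

theorem glAct_extendU (S : SplitUnital.{u}) (A : S.U →ₗ[ℂ] S.U) :
    glAct ν S (extendU S A) = rhoA ν S A := by
  have h1 : extendU S A S.one = 0 := by
    rw [extendU, LinearMap.comp_apply, LinearMap.comp_apply, S.projU_one, map_zero, map_zero]
  have h2 : ∀ x : S.U, extendU S A x = (A x : S.V) := fun x => by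
    rw [extendU, LinearMap.comp_apply, LinearMap.comp_apply, S.projU_coe]
    rfl
  have e1 : glScalar S (extendU S A) = 0 := by rw [glScalar, h1, map_zero]
  have e2 : glVec S (extendU S A) = 0 := by rw [glVec, h1, map_zero]
  have e3 : glCovec S (extendU S A) = 0 := by
    ext1 x
    change S.coordOne (extendU S A x) = 0
    rw [h2, S.coordOne_coe]
  have e4 : glEndU S (extendU S A) = A := by
    rw [glEndU, e1, zero_smul, sub_zero]
    ext1 x
    change S.projU (extendU S A x) = A x
    rw [h2, S.projU_coe]
  have z1 : rhoF ν S 0 = 0 := by simpa using rhoF_smul (ν := ν) (S := S) 0 0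
  have z2 : rhoE ν S 0 = 0 := by simpa using rhoE_smul (ν := ν) (S := S) 0 0
  rw [glAct_eq, e1, e2, e3, e4, z1, z2]
  simp

theorem ofSec_toSummand_comp_rhoA {S : SplitUnital.{u}} {Y : RepS ν} (k : ℕ)
    (m : Y ⟶ piece ν S.U k) (A : S.U →ₗ[ℂ] S.U) :
    ofSec (tensorPowerObj ν S) Y (toSummand ν S k m) ≫ rhoA ν S A =
      ofSec (tensorPowerObj ν S) Y (toSummand ν S k (m ≫ opA ν k A)) :=
  (ofSec_comp _ _).trans (congrArg (ofSec (tensorPowerObj ν S) Y) (rhoA_toSummand A k m))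

theorem decompIncl_comp_glAct {S : SplitUnital.{u}} (D : ∀ k, Decomposition (piece ν S.U k))
    (i : Σ k, Fin (D k).n) (w w' : Fin ((D i.1).m i.2) → ℂ) (A : S.U →ₗ[ℂ] S.U)
    (h : (D i.1).j i.2 w' = (D i.1).j i.2 w ≫ opA ν i.1 A) :
    decompIncl D i w' =
      (decompIncl D i w : _ ⟶ tensorPowerObj ν S) ≫ glAct ν S (extendU S A) := by
  rw [glAct_extendU]
  refine Eq.trans ?_ (ofSec_toSummand_comp_rhoA i.1 ((D i.1).j i.2 w) A).symm
  rw [← h]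
  rfl

theorem actsPolynomially_self (hne : one ≠ 0) (R : Splitting one) :
    ActsPolynomially ν R (tensorPowerObj ν (R.toUnital hne)) (glActHom ν (R.toUnital hne)) := by
  choose D act hpoly hj using fun k => exists_decomposition_piece ν R.U k
  refine ⟨Σ k, Fin (D k).n, fun i => indOf ((D i.1).Y i.2), fun i =>
    { E := Fin ((D i.1).m i.2) → ℂ
      act := act i.1 i.2
      polynomial := ?_ }, decompIncl D, bijective_decompIncl D, fun i A w => ?_⟩
  · obtain ⟨ι, r, h1, h2, h3⟩ := hpoly i.1 i.2
    -- A single tensor power U^{⊗k} is enough to contain this representation as a direct summand.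
    exact ⟨1, fun _ => i.1, LinearMap.pi fun _ => ι, r ∘ₗ LinearMap.proj 0, h1,
      fun A e _ => h2 A e, fun A x => h3 A (x 0)⟩
  · exact decompIncl_comp_glAct (S := R.toUnital hne) D i w (act i.1 i.2 A w) A (hj i.1 i.2 A w)

end Polynomial
-- Parabolic type for every splitting, and the isomorphisms
section Polynomial
variable {ν : ℂ} {V : Type u} [AddCommGroup V] [Module ℂ V] [FiniteDimensional ℂ V] {one : V}
-- The algebra gl(R) is not the gl(U) of the splitting S, and need not act diagonally on its tensor
-- power. Polynomiality is therefore transported from R along the equivariant isomorphism; the other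
-- two conditions refer only to (V, 𝟙) and are checked directly.
theorem isParabolicAction_tensorPower (hne : one ≠ 0) (R S : Splitting one) :
    IsParabolicAction ν R (tensorPowerObj ν (S.toUnital hne)) (glActHom ν (S.toUnital hne)) where
  polynomial := (actsPolynomially_self hne R).of_iso (splittingIso ν hne R S)
    (glActHom_comp_splittingIso hne R S)
  locallyFinite := actsLocallyFinitely_tensorPower hne S
  degree := (glActHom_apply (S := S.toUnital hne) 1).trans glAct_one

/-- The isomorphism of the tensor powers for two splittings, with the actions of `gl(V)`. -/
noncomputable def parabolicIso (ν : ℂ) (hne : one ≠ 0) (R S T : Splitting one) :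
    ParabolicInd.mk (ν := ν) (R := R) (tensorPowerObj ν (S.toUnital hne))
        (glActHom ν (S.toUnital hne)) (isParabolicAction_tensorPower hne R S) ≅
      ParabolicInd.mk (ν := ν) (R := R) (tensorPowerObj ν (T.toUnital hne))
        (glActHom ν (T.toUnital hne)) (isParabolicAction_tensorPower hne R T) where
  hom := ⟨(splittingIso ν hne S T).hom, glActHom_comp_splittingIso hne S T⟩
  inv := ⟨(splittingIso ν hne T S).hom, glActHom_comp_splittingIso hne T S⟩
  hom_inv_id := ParabolicInd.Hom.ext (splittingIso ν hne S T).hom_inv_id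
  inv_hom_id := ParabolicInd.Hom.ext (splittingIso ν hne S T).inv_hom_id

end Polynomial

end DeligneCat

theorem mainTheorem6 (ν : ℂ) :
    (∃ F : SplitUnital.{u} ⥤ IndLin (RepS ν), F.toPrefunctor = tensorPower ν) ∧
    (∀ (S : SplitUnital.{u}) (φ : Module.End ℂ S.V), φ S.one = 0 →
      ∃ g : S ⟶ S, IsLocallyFiniteExp φ g.lin ∧ ∀ Y : RepS ν,
        IsLocallyFiniteExp (IndLin.secMap (glAct ν S φ) Y)
          (IndLin.secMap (tensorPowerMap ν g) Y)) ∧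
    ∀ (V : Type u) [AddCommGroup V] [Module ℂ V] [FiniteDimensional ℂ V] (one : V)
      (hne : one ≠ 0),
      ∃ ρ : ∀ S : Splitting one,
        Module.End ℂ V →ₗ⁅ℂ⁆ End (tensorPowerObj ν (S.toUnital hne)),
        (∀ S A, ρ S A = glAct ν (S.toUnital hne) A) ∧
        ∀ R : Splitting one,
          ∃ h : ∀ S : Splitting one, IsParabolicAction ν R (tensorPowerObj ν (S.toUnital hne)) (ρ S),
          ∃ e : ∀ S T : Splitting one,
            ParabolicInd.mk (ν := ν) (R := R) (tensorPowerObj ν (S.toUnital hne)) (ρ S) (h S :) ≅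
              ParabolicInd.mk (ν := ν) (R := R) (tensorPowerObj ν (T.toUnital hne)) (ρ T) (h T :),
            (∀ S T, (e S T).hom.hom = tensorPowerMap ν (Splitting.idHom hne S T)) ∧
            (∀ S, e S S = Iso.refl _) ∧
            ∀ S T W, e S T ≪≫ e T W = e S W := by
  refine ⟨⟨{ tensorPower ν with
      map_id := fun S => tensorPowerMap_id
      map_comp := fun φ ψ => tensorPowerMap_comp φ ψ }, rfl⟩,
    fun S φ hφ => exists_isLocallyFiniteExp_tensorPowerMap φ hφ,
    fun V _ _ _ one hne => ?_⟩
  refine ⟨fun S => glActHom ν (S.toUnital hne), fun S A => glActHom_apply (S := S.toUnital hne) A, fun R => ?_⟩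
  refine ⟨fun S => isParabolicAction_tensorPower hne R S, ?_⟩
  refine ⟨fun S T => parabolicIso ν hne R S T, fun S T => rfl, fun S => ?_, fun S T W => ?_⟩
  · refine Iso.ext (ParabolicInd.Hom.ext ?_)
    exact (congrArg (tensorPowerMap ν) (Splitting.idHom_self hne S)).trans tensorPowerMap_id
  · refine Iso.ext (ParabolicInd.Hom.ext ?_)
    exact ((tensorPowerMap_comp _ _).symm).trans
      (congrArg (tensorPowerMap ν) (Splitting.idHom_comp hne S T W))
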